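/- A Hopf algebroid $(A,\Gamma)$ consists of commutative rings with ring homomorphisms $\eta_L,\eta_R:A\to\Gamma$, $\epsilon:\Gamma\to A$, $\Delta:\Gamma\to\Gamma\otimes_{\eta_R,A,\eta_L}\Gamma$, $c:\Gamma\to\Gamma$ inducing, for every commutative ring $R$, source, target, identities, composition and inversion of a groupoid with objects $\mathrm{Hom}(A,R)$ and arrows $\mathrm{Hom}(\Gamma,R)$. It is called free if $\Gamma$ is, through $\eta_L$, a free $A$-module with a countable basis. $\mathrm{RCoMod}_\Gamma$ is the category of right $\Gamma$-comodules, i.e. $A$-modules $M$ with a coassociative and counitary map $\psi_M:M\to M\otimes_{A,\eta_L}\Gamma$ that is $A$-linear for the $\eta_R$-structure on $\Gamma$. The dual algebra is $\Gamma^\vee=\mathrm{Hom}_{A,\eta_L}(\Gamma,A)$ with product $D_2\circ D_1=\big(\Gamma\xrightarrow{\Delta}\Gamma\otimes_{\eta_R,A,\eta_L}\Gamma\xrightarrow{\mathrm{id}\otimes D_1}\Gamma\xrightarrow{D_2}A\big)$, unit $\epsilon$, and the compact-open topology ($\Gamma$, $A$ discrete). $\mathrm{Mod}^d_{\Gamma^\vee}$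 is the category of discrete abelian groups $M$ with a continuous ring homomorphism $\Gamma^\vee\to\mathrm{Hom}_{\mathbb Z}(M,M)$ (compact-open topology). There is a functor $\Phi_\Gamma:\mathrm{RCoMod}_\Gamma\to\mathrm{Mod}^d_{\Gamma^\vee}$ letting $D\in\Gamma^\vee$ act on a comodule $M$ by $M\xrightarrow{\psi_M}M\otimes_{A,\eta_L}\Gamma\xrightarrow{\mathrm{id}\otimes D}M$. A morphism $f=(f_o,f_m):(A,\Gamma)\to(B,\Sigma)$ of Hopf algebroids induces $f^*:\mathrm{RCoMod}_\Gamma\to\mathrm{RCoMod}_\Sigma$, $M\mapsto M\otimes_A B$, with coaction induced by $M\xrightarrow{\psi_M}M\otimes_{A,\eta_L}\Gamma\xrightarrow{\mathrm{id}\otimes f_m}M\otimes_{A,\eta_L}\Sigma\simeq(M\otimes_AB)\otimes_{B,\eta_L}\Sigma$. **Proposition.** Let $f=(f_o,f_m):(A,\Gamma)\to(B,\Sigma)$ be a morphism of free Hopf algebroids such that $\alpha:A\to\Gamma\otimes_{\eta_R,A,f_o}B$, $a\mapsto\eta_L(a)\otimes1$, is faithfully flat and makes $\Gamma\otimes_{\eta_R,A,f_o}B$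 a free $A$-module. Let $\Gamma_f=B\otimes_{f_o,A,\eta_L}\Gamma\otimes_{\eta_R,A,f_o}B$, with the Hopf algebroid structure over $B$ whose units are the inclusions of the outer factors and whose comultiplication, counit and conjugation are induced by those of $\Gamma$; let $\iota:\Gamma\to\Gamma_f$, $\gamma\mapsto1\otimes\gamma\otimes1$, and $\beta:\Gamma_f\to\Sigma$, $b\otimes\gamma\otimes b'\mapsto\eta_L(b)f_m(\gamma)\eta_R(b')$. Then: 1. $\Gamma_f$ is a free $B$-module through its left unit; if moreover $\alpha$ makes $\Gamma\otimes_{\eta_R,A,f_o}B$ a free $A$-module with a countable basis, then $(B,\Gamma_f)$ is a free Hopf algebroid. 2. $f$ is the composite of the morphisms of Hopf algebroids $(A,\Gamma)\xrightarrow{(f_o,\iota)}(B,\Gamma_f)\xrightarrow{(\mathrm{id},\beta)}(B,\Sigma)$. 3. The functors $(f_o,\iota)^*:\mathrm{RCoMod}_\Gamma\to\mathrm{RCoMod}_{\Gamma_f}$, $\Phi_{\Gamma_f}:\mathrm{RCoMod}_{\Gamma_f}\to\mathrm{Mod}^d_{\Gamma_f^\vee}$ and $\Phi_\Sigma:\mathrm{RCoMod}_\Sigma\to\mathrm{Mod}^d_{\Sigma^\vee}$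 are equivalences of categories. 4. Under these equivalences $f^*$ is identified with restriction of scalars $\beta^\vee_*:\mathrm{Mod}^d_{\Gamma_f^\vee}\to\mathrm{Mod}^d_{\Sigma^\vee}$ along the continuous ring homomorphism $\beta^\vee:\Sigma^\vee\to\Gamma_f^\vee$, $D\mapsto D\circ\beta$: there is a natural isomorphism $\Phi_\Sigma\circ f^*\simeq\beta^\vee_*\circ\Phi_{\Gamma_f}\circ(f_o,\iota)^*$, which is the identity on the underlying groups $M\otimes_AB$. -/

import Mathlib

open scoped TensorProduct
open CategoryTheory

universe u

noncomputable section

namespace DualAlg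

/-! ### Tensor products of commutative rings along explicit ring homomorphisms -/

section RingTensor

variable {R S T : Type u} [CommRing R] [CommRing S] [CommRing T]

/-- The ring `S`, regarded as an `R`-algebra through the ring homomorphism `p : R → S`. -/
def Along (_p : R →+* S) : Type u := S

instance (p : R →+* S) : CommRing (Along p) := inferInstanceAs (CommRing S)

instance (p : R →+* S) : Algebra R (Along p) := RingHom.toAlgebra (S := Along p) p

/-- The identity map of `S`, as an isomorphism of rings. -/
def Along.of (p : R →+* S) : S ≃+* Along p := RingEquiv.refl S

theorem Along.algebraMap_eq (p : R →+* S) (r : R) :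
    algebraMap R (Along p) r = Along.of p (p r) := rfl

theorem Along.smul_of (p : R →+* S) (r : R) (s : S) :
    r • Along.of p s = Along.of p (p r * s) := rfl

/-- The tensor product `S ⊗_{p, R, q} T` of commutative rings, where `S` is an `R`-algebra through
`p` and `T` is an `R`-algebra through `q`. -/
def RingTensor (p : R →+* S) (q : R →+* T) : Type u := Along p ⊗[R] Along q

namespace RingTensor

variable (p : R →+* S) (q : R →+* T)

instance instCommRing : CommRing (RingTensor p q) :=
  inferInstanceAs (CommRing (Along p ⊗[R] Along q))

/-- The identity map, as an isomorphism of rings. -/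
def equiv : RingTensor p q ≃+* Along p ⊗[R] Along q := RingEquiv.refl _

/-- The ring homomorphism `s ↦ s ⊗ 1`. -/
def inl : S →+* RingTensor p q :=
  ((equiv p q).symm : Along p ⊗[R] Along q →+* RingTensor p q).comp
    ((Algebra.TensorProduct.includeLeftRingHom : Along p →+* Along p ⊗[R] Along q).comp
      (Along.of p : S →+* Along p))

/-- The ring homomorphism `t ↦ 1 ⊗ t`. -/
def inr : T →+* RingTensor p q :=
  ((equiv p q).symm : Along p ⊗[R] Along q →+* RingTensor p q).comp
    (((Algebra.TensorProduct.includeRight : Along q →ₐ[R] Along p ⊗[R] Along q) :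
      Along q →+* Along p ⊗[R] Along q).comp (Along.of q : T →+* Along q))

theorem inl_mul_inr (s : S) (t : T) :
    inl p q s * inr p q t = (equiv p q).symm (Along.of p s ⊗ₜ[R] Along.of q t) := by
  change (equiv p q).symm (Along.of p s ⊗ₜ[R] 1) * (equiv p q).symm (1 ⊗ₜ[R] Along.of q t) = _
  rw [← map_mul]
  simp

theorem inl_eq_inr (r : R) : inl p q (p r) = inr p q (q r) := by
  have h₁ : inl p q (p r) = (equiv p q).symm (Along.of p (p r) ⊗ₜ[R] Along.of q 1) := by
    simpa using inl_mul_inr p q (p r) 1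
  have h₂ : inr p q (q r) = (equiv p q).symm (Along.of p 1 ⊗ₜ[R] Along.of q (q r)) := by
    simpa using inl_mul_inr p q 1 (q r)
  rw [h₁, h₂, ← mul_one (p r), ← mul_one (q r), ← Along.smul_of, ← Along.smul_of,
    TensorProduct.smul_tmul]

/-- `S ⊗_{p, R, q} T` is an `S`-algebra through `inl`. -/
instance instAlgebraLeft : Algebra S (RingTensor p q) := (inl p q).toAlgebra

/-- If `S` carries a (possibly different) `R`-algebra structure, then `S ⊗_{p, R, q} T` is
regarded as an `R`-algebra through that structure and `inl`. -/
instance instAlgebraBase [Algebra R S] : Algebra R (RingTensor p q) :=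
  ((inl p q).comp (algebraMap R S)).toAlgebra

theorem algebraMap_left (s : S) : algebraMap S (RingTensor p q) s = inl p q s := rfl

theorem algebraMap_base [Algebra R S] (r : R) :
    algebraMap R (RingTensor p q) r = inl p q (algebraMap R S r) := rfl

variable {p q}

@[elab_as_elim]
theorem induction {motive : RingTensor p q → Prop} (x : RingTensor p q)
    (zero : motive 0)
    (tmul : ∀ s t, motive (inl p q s * inr p q t))
    (add : ∀ x y, motive x → motive y → motive (x + y)) : motive x := by
  have key : ∀ y : Along p ⊗[R] Along q, motive ((equiv p q).symm y) := by
    intro y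
    induction y using TensorProduct.induction_on with
    | zero => simpa using zero
    | tmul s t =>
      have := tmul ((Along.of p).symm s) ((Along.of q).symm t)
      rw [inl_mul_inr] at this
      simpa using this
    | add x y hx hy => rw [map_add]; exact add _ _ hx hy
  simpa using key (equiv p q x)

/-- The additive map out of `S ⊗_{p, R, q} T` determined by a balanced biadditive map. -/
def liftAdd {G : Type*} [AddCommGroup G] (φ : S →+ T →+ G)
    (hφ : ∀ r s t, φ (p r * s) t = φ s (q r * t)) : RingTensor p q →+ G :=
  (TensorProduct.liftAddHom
    (((AddMonoidHom.compHom' ((Along.of q).symm : Along q →+ T)).comp φ).comp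
      ((Along.of p).symm : Along p →+ S)) (fun r s t => hφ r s t)).comp
    (equiv p q : RingTensor p q →+ Along p ⊗[R] Along q)

theorem liftAdd_mul {G : Type*} [AddCommGroup G] (φ : S →+ T →+ G)
    (hφ : ∀ r s t, φ (p r * s) t = φ s (q r * t)) (s : S) (t : T) :
    liftAdd φ hφ (inl p q s * inr p q t) = φ s t := by
  rw [inl_mul_inr]; rfl

/-- The universal property of `S ⊗_{p, R, q} T` as a pushout of commutative rings. -/
def lift {C : Type u} [CommRing C] (g : S →+* C) (h : T →+* C) (w : g.comp p = h.comp q) :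
    RingTensor p q →+* C :=
  ((Along.of (g.comp p)).symm : Along (g.comp p) →+* C).comp
    (((Algebra.TensorProduct.productMap
      (AlgHom.mk ((Along.of (g.comp p) : C →+* _).comp (g.comp ((Along.of p).symm : _ →+* S)))
        (fun _ => rfl) : Along p →ₐ[R] Along (g.comp p))
      (AlgHom.mk ((Along.of (g.comp p) : C →+* _).comp (h.comp ((Along.of q).symm : _ →+* T)))
        (fun r => (RingHom.congr_fun w r).symm) : Along q →ₐ[R] Along (g.comp p)) :
      Along p ⊗[R] Along q →ₐ[R] Along (g.comp p)) :
        Along p ⊗[R] Along q →+* Along (g.comp p)).comp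
      (equiv p q : RingTensor p q →+* Along p ⊗[R] Along q))

variable {C : Type u} [CommRing C] (g : S →+* C) (h : T →+* C) (w : g.comp p = h.comp q)

@[simp] theorem lift_inl (s : S) : lift g h w (inl p q s) = g s :=
  Algebra.TensorProduct.productMap_left_apply (R := R) (S := Along (g.comp p))
    (A := Along p) (B := Along q) _ _ s

@[simp] theorem lift_inr (t : T) : lift g h w (inr p q t) = h t :=
  Algebra.TensorProduct.productMap_right_apply (R := R) (S := Along (g.comp p))
    (A := Along p) (B := Along q) _ _ t

theorem hom_ext {f g : RingTensor p q →+* C} (hl : ∀ s, f (inl p q s) = g (inl p q s))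
    (hr : ∀ t, f (inr p q t) = g (inr p q t)) : f = g := by
  ext x
  refine induction x ?_ ?_ ?_
  · simp
  · intro s t; simp [hl, hr]
  · intro x y hx hy; simp [hx, hy]

end RingTensor

end RingTensor

/-! ### Hopf algebroids -/

/-- The structure maps of a Hopf algebroid `(A, Γ)`: the left unit `η_L` is `algebraMap A Γ`, and
`etaR`, `counit`, `comul`, `conj` are `η_R`, `ε`, `Δ`, `c`, with their compatibility with the
units. The comultiplication takes values in `Γ ⊗_{η_R, A, η_L} Γ`. -/
structure CogroupoidData (A Γ : Type u) [CommRing A] [CommRing Γ] [Algebra A Γ] where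
  etaR : A →+* Γ
  counit : Γ →ₐ[A] A
  counit_etaR : ∀ a, counit (etaR a) = a
  comul : Γ →ₐ[A] RingTensor etaR (algebraMap A Γ)
  comul_etaR : ∀ a, comul (etaR a) = RingTensor.inr etaR (algebraMap A Γ) (etaR a)
  conj : Γ →+* Γ
  conj_etaL : ∀ a, conj (algebraMap A Γ a) = etaR a
  conj_etaR : ∀ a, conj (etaR a) = algebraMap A Γ a

section

variable {A Γ : Type u} [CommRing A] [CommRing Γ] [Algebra A Γ]

namespace CogroupoidData

variable (H : CogroupoidData A Γ)

/-- The ring `Γ ⊗_{η_R, A, η_L} Γ`, regarded as an `A`-algebra through the left unit of the left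
factor. -/
abbrev Two : Type u := RingTensor H.etaR (algebraMap A Γ)

/-- The inclusion `γ ↦ γ ⊗ 1` of the left factor. -/
abbrev inl : Γ →+* H.Two := RingTensor.inl H.etaR (algebraMap A Γ)

/-- The inclusion `γ ↦ 1 ⊗ γ` of the right factor. -/
abbrev inr : Γ →+* H.Two := RingTensor.inr H.etaR (algebraMap A Γ)

theorem inl_etaR (a : A) : H.inl (H.etaR a) = H.inr (algebraMap A Γ a) :=
  RingTensor.inl_eq_inr _ _ a

/-- Let `R` be a commutative ring. An `R`-valued point `g : Γ → R` is regarded as an arrow with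
source `g ∘ η_L` and target `g ∘ η_R`; two composable arrows `g`, `h` have the composite
`Γ → Γ ⊗_{η_R, A, η_L} Γ → R`. -/
def comp {R : Type u} [CommRing R] (g h : Γ →+* R)
    (w : g.comp H.etaR = h.comp (algebraMap A Γ)) : Γ →+* R :=
  (RingTensor.lift g h w).comp (H.comul : Γ →+* H.Two)

variable {R : Type u} [CommRing R] (g h : Γ →+* R)
    (w : g.comp H.etaR = h.comp (algebraMap A Γ))

theorem comp_source : (H.comp g h w).comp (algebraMap A Γ) = g.comp (algebraMap A Γ) := by
  ext a
  simp [comp, RingTensor.algebraMap_base]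

theorem comp_target : (H.comp g h w).comp H.etaR = h.comp H.etaR := by
  ext a
  simp [comp, H.comul_etaR]

theorem id_left_composable : ((g.comp (algebraMap A Γ)).comp (H.counit : Γ →+* A)).comp H.etaR =
    g.comp (algebraMap A Γ) := by
  ext a; simp [H.counit_etaR]

theorem id_right_composable : g.comp H.etaR =
    ((g.comp H.etaR).comp (H.counit : Γ →+* A)).comp (algebraMap A Γ) := by
  ext a; simp

theorem inv_right_composable : g.comp H.etaR = (g.comp H.conj).comp (algebraMap A Γ) := by
  ext a; simp [H.conj_etaL]

theorem inv_left_composable : (g.comp H.conj).comp H.etaR = g.comp (algebraMap A Γ) := by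
  ext a; simp [H.conj_etaR]

end CogroupoidData

end

/-- A Hopf algebroid `(A, Γ)`: for every commutative ring `R`, the sets `Hom(A, R)` of objects and
`Hom(Γ, R)` of arrows form a groupoid, whose source, target, identities, composition and inversion
are induced by `η_L`, `η_R`, `ε`, `Δ` and `c`. -/
structure HopfAlgebroid (A Γ : Type u) [CommRing A] [CommRing Γ] [Algebra A Γ]
    extends CogroupoidData A Γ where
  assoc : ∀ (R : Type u) [CommRing R] (g h k : Γ →+* R)
    (w : g.comp etaR = h.comp (algebraMap A Γ)) (w' : h.comp etaR = k.comp (algebraMap A Γ)),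
    toCogroupoidData.comp (toCogroupoidData.comp g h w) k
        ((toCogroupoidData.comp_target g h w).trans w') =
      toCogroupoidData.comp g (toCogroupoidData.comp h k w')
        (w.trans (toCogroupoidData.comp_source h k w').symm)
  id_comp : ∀ (R : Type u) [CommRing R] (g : Γ →+* R),
    toCogroupoidData.comp ((g.comp (algebraMap A Γ)).comp (counit : Γ →+* A)) g
      (toCogroupoidData.id_left_composable g) = g
  comp_id : ∀ (R : Type u) [CommRing R] (g : Γ →+* R),
    toCogroupoidData.comp g ((g.comp etaR).comp (counit : Γ →+* A)) (toCogroupoidData.id_right_composable g) = g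
  comp_inv : ∀ (R : Type u) [CommRing R] (g : Γ →+* R),
    toCogroupoidData.comp g (g.comp conj) (toCogroupoidData.inv_right_composable g) =
      (g.comp (algebraMap A Γ)).comp (counit : Γ →+* A)
  inv_comp : ∀ (R : Type u) [CommRing R] (g : Γ →+* R),
    toCogroupoidData.comp (g.comp conj) g (toCogroupoidData.inv_left_composable g) =
      (g.comp etaR).comp (counit : Γ →+* A)

namespace HopfAlgebroid

section Basic

variable {A Γ : Type u} [CommRing A] [CommRing Γ] [Algebra A Γ]

/-- A Hopf algebroid is free if `Γ` is, through the left unit, a free `A`-module with a countable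
basis. -/
def IsFree (_H : HopfAlgebroid A Γ) : Prop :=
  ∃ I : Type, Countable I ∧ Nonempty (Module.Basis I A Γ)

end Basic

/-- A morphism `(f_o, f_m) : (A, Γ) → (B, S)` of Hopf algebroids, with object component `f_o` the
structure map `algebraMap A B` and arrow component `f_m = mor`. -/
@[ext] structure Hom {A Γ B S : Type u} [CommRing A] [CommRing Γ] [Algebra A Γ]
    [CommRing B] [CommRing S] [Algebra B S] [Algebra A B]
    (H : HopfAlgebroid A Γ) (K : HopfAlgebroid B S) where
  mor : Γ →+* S
  mor_etaL : ∀ a, mor (algebraMap A Γ a) = algebraMap B S (algebraMap A B a)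
  mor_etaR : ∀ a, mor (H.etaR a) = K.etaR (algebraMap A B a)
  mor_counit : ∀ γ, K.counit (mor γ) = algebraMap A B (H.counit γ)
  mor_comul : ∀ γ, K.comul (mor γ) =
    RingTensor.lift (K.inl.comp mor) (K.inr.comp mor)
      (by ext a; simp [mor_etaL, mor_etaR, K.inl_etaR]) (H.comul γ)
  mor_conj : ∀ γ, K.conj (mor γ) = mor (H.conj γ)

namespace Hom

variable {A Γ B S : Type u} [CommRing A] [CommRing Γ] [Algebra A Γ]
    [CommRing B] [CommRing S] [Algebra B S] [Algebra A B]
    {H : HopfAlgebroid A Γ} {K : HopfAlgebroid B S}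

/-- `f_m ⊗ f_m : Γ ⊗_{η_R, A, η_L} Γ → S ⊗_{η_R, B, η_L} S`. -/
def morTwo (f : Hom H K) : H.Two →+* K.Two :=
  RingTensor.lift (K.inl.comp f.mor) (K.inr.comp f.mor)
      (by ext a; simp [f.mor_etaL, f.mor_etaR, K.inl_etaR])

@[simp] theorem morTwo_inl (f : Hom H K) (γ : Γ) : f.morTwo (H.inl γ) = K.inl (f.mor γ) := by
  simp [morTwo]

@[simp] theorem morTwo_inr (f : Hom H K) (γ : Γ) : f.morTwo (H.inr γ) = K.inr (f.mor γ) := by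
  simp [morTwo]

theorem comul_mor (f : Hom H K) (γ : Γ) : K.comul (f.mor γ) = f.morTwo (H.comul γ) :=
  f.mor_comul γ

/-- Composition of morphisms of Hopf algebroids. -/
def comp {C T : Type u} [CommRing C] [CommRing T] [Algebra C T] [Algebra B C] [Algebra A C]
    [IsScalarTower A B C] {L : HopfAlgebroid C T} (g : Hom K L) (f : Hom H K) : Hom H L where
  mor := g.mor.comp f.mor
  mor_etaL a := by simp [f.mor_etaL, g.mor_etaL, ← IsScalarTower.algebraMap_apply]
  mor_etaR a := by simp [f.mor_etaR, g.mor_etaR, ← IsScalarTower.algebraMap_apply]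
  mor_counit γ := by simp [f.mor_counit, g.mor_counit, ← IsScalarTower.algebraMap_apply]
  mor_comul γ := by
    rw [RingHom.comp_apply, g.comul_mor, f.comul_mor, ← RingHom.comp_apply]
    refine RingHom.congr_fun (RingTensor.hom_ext ?_ ?_) _ <;> intro s <;> simp
  mor_conj γ := by simp [f.mor_conj, g.mor_conj]

end Hom

/-! ### Base change of a Hopf algebroid along a ring homomorphism -/

section BaseChange

variable {A Γ : Type u} [CommRing A] [CommRing Γ] [Algebra A Γ] (H : HopfAlgebroid A Γ)
  (B : Type u) [CommRing B] [Algebra A B]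

/-- The ring `Γ ⊗_{η_R, A, f_o} B`; its `A`-algebra structure is the one through `η_L`. -/
abbrev RightExt : Type u := RingTensor H.etaR (algebraMap A B)

/-- The ring homomorphism `α : A → Γ → Γ ⊗_{η_R, A, f_o} B`, `a ↦ η_L(a) ⊗ 1`. -/
def alpha : A →+* H.RightExt B :=
  (RingTensor.inl H.etaR (algebraMap A B)).comp (algebraMap A Γ)

theorem algebraMap_rightExt : algebraMap A (H.RightExt B) = H.alpha B := rfl

/-- The ring `Γ_f = B ⊗_{f_o, A, η_L} Γ ⊗_{η_R, A, f_o} B`, a `B`-algebra through the first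
factor. -/
abbrev BaseChange : Type u := RingTensor (algebraMap A B) (H.alpha B)

namespace BaseChange

/-- The inclusion of the middle factor. -/
def mid : Γ →+* H.BaseChange B :=
  (RingTensor.inr (algebraMap A B) (H.alpha B)).comp (RingTensor.inl H.etaR (algebraMap A B))

/-- The inclusion of the third factor. -/
def right : B →+* H.BaseChange B :=
  (RingTensor.inr (algebraMap A B) (H.alpha B)).comp (RingTensor.inr H.etaR (algebraMap A B))

theorem mid_etaL (a : A) :
    mid H B (algebraMap A Γ a) = algebraMap B (H.BaseChange B) (algebraMap A B a) :=
  (RingTensor.inl_eq_inr (algebraMap A B) (H.alpha B) a).symm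

theorem mid_etaR (a : A) : mid H B (H.etaR a) = right H B (algebraMap A B a) :=
  congrArg (RingTensor.inr (algebraMap A B) (H.alpha B))
    (RingTensor.inl_eq_inr H.etaR (algebraMap A B) a)

variable {H B} {R : Type u} [CommRing R]

/-- The ring homomorphism `x ⊗ g ⊗ y` out of `B ⊗_A Γ ⊗_A B`. -/
def lift (x : B →+* R) (g : Γ →+* R) (y : B →+* R)
    (hx : x.comp (algebraMap A B) = g.comp (algebraMap A Γ))
    (hy : g.comp H.etaR = y.comp (algebraMap A B)) : H.BaseChange B →+* R :=
  RingTensor.lift x (RingTensor.lift g y hy)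
    (by rw [hx]; ext a; simp [alpha])

section

variable (x : B →+* R) (g : Γ →+* R) (y : B →+* R)
    (hx : x.comp (algebraMap A B) = g.comp (algebraMap A Γ))
    (hy : g.comp H.etaR = y.comp (algebraMap A B))

@[simp] theorem lift_left (b : B) :
    lift x g y hx hy (algebraMap B (H.BaseChange B) b) = x b := by
  simp [lift, RingTensor.algebraMap_left]

@[simp] theorem lift_mid (γ : Γ) : lift x g y hx hy (mid H B γ) = g γ := by
  simp [lift, mid]

@[simp] theorem lift_right (b : B) : lift x g y hx hy (right H B b) = y b := by
  simp [lift, right]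

end

theorem hom_ext {f g : H.BaseChange B →+* R}
    (h₁ : ∀ b, f (algebraMap B (H.BaseChange B) b) = g (algebraMap B (H.BaseChange B) b))
    (h₂ : ∀ γ, f (mid H B γ) = g (mid H B γ))
    (h₃ : ∀ b, f (right H B b) = g (right H B b)) : f = g :=
  RingTensor.hom_ext h₁ fun t => RingHom.congr_fun
    (f := f.comp (RingTensor.inr (algebraMap A B) (H.alpha B)))
    (g := g.comp (RingTensor.inr (algebraMap A B) (H.alpha B)))
    (RingTensor.hom_ext h₂ h₃) t

variable (H B)

/-- The ring `Γ_f ⊗_B Γ_f`. -/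
abbrev Two : Type u := RingTensor (right H B) (algebraMap B (H.BaseChange B))

/-- The first inclusion `Γ_f → Γ_f ⊗_B Γ_f`. -/
abbrev inl : H.BaseChange B →+* Two H B :=
  RingTensor.inl (right H B) (algebraMap B (H.BaseChange B))

/-- The second inclusion `Γ_f → Γ_f ⊗_B Γ_f`. -/
abbrev inr : H.BaseChange B →+* Two H B :=
  RingTensor.inr (right H B) (algebraMap B (H.BaseChange B))

/-- The map `Γ ⊗_{η_R, A, η_L} Γ → Γ_f ⊗_B Γ_f`, `γ ⊗ γ' ↦ (1 ⊗ γ ⊗ 1) ⊗ (1 ⊗ γ' ⊗ 1)`. -/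
def midTwo : H.Two →+* Two H B :=
  RingTensor.lift ((inl H B).comp (mid H B)) ((inr H B).comp (mid H B)) (by
    ext a
    simp only [RingHom.comp_apply, mid_etaR, mid_etaL]
    exact RingTensor.inl_eq_inr _ _ _)

@[simp] theorem midTwo_inl (γ : Γ) : midTwo H B (H.inl γ) = inl H B (mid H B γ) := by
  simp [midTwo]

@[simp] theorem midTwo_inr (γ : Γ) : midTwo H B (H.inr γ) = inr H B (mid H B γ) := by
  simp [midTwo]

/-- The comultiplication of `Γ_f`, as a ring homomorphism: on the first and the third factor it is
the inclusion of the first and of the last factor of `Γ_f ⊗_B Γ_f`, and on `Γ` it is induced by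
the comultiplication of `Γ`. -/
def comulHom : H.BaseChange B →+* Two H B :=
  lift ((inl H B).comp (algebraMap B _)) ((midTwo H B).comp (H.comul : Γ →+* H.Two))
    ((inr H B).comp (right H B))
    (by
      ext a
      simp only [RingHom.comp_apply, AlgHom.commutes, RingHom.coe_coe,
        RingTensor.algebraMap_base]
      rw [midTwo_inl, mid_etaL])
    (by
      ext a
      simp only [RingHom.comp_apply, RingHom.coe_coe, H.comul_etaR]
      rw [midTwo_inr, mid_etaR])

/-- The counit of `Γ_f`, `b ⊗ γ ⊗ b' ↦ b f_o(ε(γ)) b'`. -/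
def counitHom : H.BaseChange B →+* B :=
  lift (RingHom.id B) ((algebraMap A B).comp (H.counit : Γ →+* A)) (RingHom.id B)
    (by ext a; simp) (by ext a; simp [H.counit_etaR])

/-- The conjugation of `Γ_f`, `b ⊗ γ ⊗ b' ↦ b' ⊗ c(γ) ⊗ b`. -/
def conjHom : H.BaseChange B →+* H.BaseChange B :=
  lift (right H B) ((mid H B).comp H.conj) (algebraMap B _)
    (by ext a; simp [H.conj_etaL, mid_etaR])
    (by ext a; simp [H.conj_etaR, mid_etaL])

/-- The structure maps of `(B, Γ_f)`. -/
def data : CogroupoidData B (H.BaseChange B) where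
  etaR := right H B
  counit := AlgHom.mk (counitHom H B) (fun b => by
    rw [counitHom]; exact lift_left (R := B) _ _ _ _ _ b)
  counit_etaR b := by
    change counitHom H B _ = _
    simp [counitHom]
  comul := AlgHom.mk (comulHom H B) (fun b => by
    change comulHom H B _ = _
    simp [comulHom, RingTensor.algebraMap_base])
  comul_etaR b := by
    change comulHom H B _ = _
    simp [comulHom]
  conj := conjHom H B
  conj_etaL b := by simp [conjHom]
  conj_etaR b := by simp [conjHom]

theorem data_etaR (b : B) : (data H B).etaR b = right H B b := rfl

theorem data_counit_mid (γ : Γ) :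
    (data H B).counit (mid H B γ) = algebraMap A B (H.counit γ) := by
  change counitHom H B _ = _
  simp [counitHom]

theorem data_comul_mid (γ : Γ) :
    (data H B).comul (mid H B γ) = midTwo H B (H.comul γ) := by
  change comulHom H B _ = _
  simp [comulHom]

theorem data_conj_mid (γ : Γ) : (data H B).conj (mid H B γ) = mid H B (H.conj γ) := by
  change conjHom H B _ = _
  simp [conjHom]

variable {H B}

theorem comp_eq (g h : H.BaseChange B →+* R)
    (w : g.comp (data H B).etaR = h.comp (algebraMap B (H.BaseChange B))) :
    (data H B).comp g h w = lift (g.comp (algebraMap B _))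
      (H.comp (g.comp (mid H B)) (h.comp (mid H B)) (by
        ext a
        have := RingHom.congr_fun w (algebraMap A B a)
        simpa [mid_etaR, mid_etaL, data_etaR] using this))
      (h.comp (right H B))
      (by rw [H.comp_source]; ext a; simp [mid_etaL])
      (by rw [H.comp_target]; ext a; simp [mid_etaR]) := by
  refine hom_ext ?_ ?_ ?_
  · intro b
    rw [lift_left]
    exact RingHom.congr_fun ((data H B).comp_source g h w) b
  · intro γ
    rw [lift_mid]
    have w' : g.comp (right H B) = h.comp (algebraMap B (H.BaseChange B)) := w
    have v : (g.comp (mid H B)).comp H.etaR = (h.comp (mid H B)).comp (algebraMap A Γ) := by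
      ext a
      have := RingHom.congr_fun w (algebraMap A B a)
      simpa [mid_etaR, mid_etaL, data_etaR] using this
    have key : (RingTensor.lift g h w').comp (midTwo H B) =
        RingTensor.lift (g.comp (mid H B)) (h.comp (mid H B)) v := by
      refine RingTensor.hom_ext ?_ ?_ <;> intro s
      · rw [RingHom.comp_apply, midTwo_inl, RingTensor.lift_inl, RingTensor.lift_inl]
        rfl
      · rw [RingHom.comp_apply, midTwo_inr, RingTensor.lift_inr, RingTensor.lift_inr]
        rfl
    have h₁ : (data H B).comp g h w (mid H B γ) =
        RingTensor.lift g h w' (midTwo H B (H.comul γ)) :=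
      congrArg (RingTensor.lift g h w') (data_comul_mid H B γ)
    rw [h₁]
    exact RingHom.congr_fun key (H.comul γ)
  · intro b
    rw [lift_right]
    exact RingHom.congr_fun ((data H B).comp_target g h w) b

end BaseChange

end BaseChange

theorem _root_.DualAlg.CogroupoidData.comp_congr {A Γ R : Type u} [CommRing A] [CommRing Γ] [Algebra A Γ]
    [CommRing R] (H : CogroupoidData A Γ) {g g' h h' : Γ →+* R} (hg : g = g') (hh : h = h')
    (w : g.comp H.etaR = h.comp (algebraMap A Γ)) :
    H.comp g h w = H.comp g' h' (by rw [← hg, ← hh]; exact w) := by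
  subst hg hh; rfl

section BaseChange

variable {A Γ : Type u} [CommRing A] [CommRing Γ] [Algebra A Γ] (H : HopfAlgebroid A Γ)
  (B : Type u) [CommRing B] [Algebra A B]

open BaseChange in
/-- The Hopf algebroid `(B, Γ_f)`, with `Γ_f = B ⊗_{f_o, A, η_L} Γ ⊗_{η_R, A, f_o} B`. -/
def baseChange : HopfAlgebroid B (H.BaseChange B) where
  toCogroupoidData := BaseChange.data H B
  assoc R _ g h k w w' := by
    refine hom_ext ?_ ?_ ?_
    · intro b
      simp [comp_eq]
    · intro γ
      simp only [comp_eq, lift_mid]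
      refine (RingHom.congr_fun (CogroupoidData.comp_congr _ (RingHom.ext ?_) rfl _) γ).trans
        ((RingHom.congr_fun (H.assoc R (g.comp (mid H B)) (h.comp (mid H B)) (k.comp (mid H B))
          ?_ ?_) γ).trans
        (RingHom.congr_fun (CogroupoidData.comp_congr _ rfl (RingHom.ext ?_) _) γ))
      · intro γ; simp
      · ext a
        have := RingHom.congr_fun w (algebraMap A B a)
        simpa [mid_etaR, mid_etaL, data_etaR] using this
      · ext a
        have := RingHom.congr_fun w' (algebraMap A B a)
        simpa [mid_etaR, mid_etaL, data_etaR] using this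
      · intro γ; simp
    · intro b
      simp [comp_eq]
  id_comp R _ g := by
    rw [comp_eq]
    refine hom_ext ?_ ?_ ?_
    · intro b; simp
    · intro γ
      rw [lift_mid]
      refine (RingHom.congr_fun (CogroupoidData.comp_congr _ (RingHom.ext ?_) rfl _) γ).trans
        (RingHom.congr_fun (H.id_comp R (g.comp (mid H B))) γ)
      intro γ
      simp [data_counit_mid, mid_etaL]
    · intro b; simp
  comp_id R _ g := by
    rw [comp_eq]
    refine hom_ext ?_ ?_ ?_
    · intro b; simp
    · intro γ
      rw [lift_mid]
      refine (RingHom.congr_fun (CogroupoidData.comp_congr _ rfl (RingHom.ext ?_) _) γ).trans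
        (RingHom.congr_fun (H.comp_id R (g.comp (mid H B))) γ)
      intro γ
      simp [data_counit_mid, mid_etaR, data_etaR]
    · intro b
      simpa [data_etaR] using congrArg (fun z => g (right H B z)) ((data H B).counit_etaR b)
  comp_inv R _ g := by
    rw [comp_eq]
    refine hom_ext ?_ ?_ ?_
    · intro b; simp
    · intro γ
      rw [lift_mid]
      refine (RingHom.congr_fun (CogroupoidData.comp_congr _ rfl (RingHom.ext ?_) _) γ).trans
        ((RingHom.congr_fun (H.comp_inv R (g.comp (mid H B))) γ).trans ?_)
      · intro γ
        simp [data_conj_mid]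
      · simp [data_counit_mid, mid_etaL]
    · intro b
      have h₁ := (data H B).conj_etaR b
      have h₂ := (data H B).counit_etaR b
      rw [data_etaR] at h₁ h₂
      simp [h₁, h₂]
  inv_comp R _ g := by
    rw [comp_eq]
    refine hom_ext ?_ ?_ ?_
    · intro b
      have h₁ := (data H B).conj_etaL b
      simp [h₁]
    · intro γ
      rw [lift_mid]
      refine (RingHom.congr_fun (CogroupoidData.comp_congr _ (RingHom.ext ?_) rfl _) γ).trans
        ((RingHom.congr_fun (H.inv_comp R (g.comp (mid H B))) γ).trans ?_)
      · intro γ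
        simp [data_conj_mid]
      · simp [data_counit_mid, mid_etaR, data_etaR]
    · intro b
      have h₂ := (data H B).counit_etaR b
      rw [data_etaR] at h₂
      simp [h₂, data_etaR]

/-- The morphism `(f_o, ι) : (A, Γ) → (B, Γ_f)`, where `ι(γ) = 1 ⊗ γ ⊗ 1`. -/
def iota : Hom H (H.baseChange B) where
  mor := BaseChange.mid H B
  mor_etaL := BaseChange.mid_etaL H B
  mor_etaR := BaseChange.mid_etaR H B
  mor_counit := BaseChange.data_counit_mid H B
  mor_comul := BaseChange.data_comul_mid H B
  mor_conj := BaseChange.data_conj_mid H B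

variable {H B} {S : Type u} [CommRing S] [Algebra B S] {K : HopfAlgebroid B S}

namespace Hom

open BaseChange

/-- The ring homomorphism `β : Γ_f → S`, `b ⊗ γ ⊗ b' ↦ η_L(b) f_m(γ) η_R(b')`. -/
def betaHom (f : Hom H K) : H.BaseChange B →+* S :=
  BaseChange.lift (algebraMap B S) f.mor K.etaR
    (by ext a; simp [f.mor_etaL]) (by ext a; simp [f.mor_etaR])

variable (f : Hom H K)

@[simp] theorem betaHom_left (b : B) :
    f.betaHom (algebraMap B (H.BaseChange B) b) = algebraMap B S b := by
  simp [betaHom]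

@[simp] theorem betaHom_mid (γ : Γ) : f.betaHom (mid H B γ) = f.mor γ := by
  simp [betaHom]

@[simp] theorem betaHom_right (b : B) : f.betaHom (right H B b) = K.etaR b := by
  simp [betaHom]

/-- `β ⊗ β : Γ_f ⊗_B Γ_f → S ⊗_B S`. -/
def betaTwo : BaseChange.Two H B →+* K.Two :=
  RingTensor.lift (K.inl.comp f.betaHom) (K.inr.comp f.betaHom)
    (by ext b; simp [K.inl_etaR])

@[simp] theorem betaTwo_inl (x : H.BaseChange B) :
    f.betaTwo (BaseChange.inl H B x) = K.inl (f.betaHom x) := by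
  simp [betaTwo]

@[simp] theorem betaTwo_inr (x : H.BaseChange B) :
    f.betaTwo (BaseChange.inr H B x) = K.inr (f.betaHom x) := by
  simp [betaTwo]

theorem betaTwo_midTwo (x : H.Two) : f.betaTwo (midTwo H B x) = f.morTwo x := by
  rw [← RingHom.comp_apply]
  refine RingHom.congr_fun (RingTensor.hom_ext ?_ ?_) x <;> intro s <;> simp

theorem counit_betaHom (x : H.BaseChange B) :
    K.counit (f.betaHom x) = (data H B).counit x := by
  have : (K.counit : S →+* B).comp f.betaHom = ((data H B).counit : H.BaseChange B →+* B) := by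
    refine hom_ext ?_ ?_ ?_
    · intro b; simp
    · intro γ; simp [data_counit_mid, f.mor_counit]
    · intro b
      have h := (data H B).counit_etaR b
      rw [data_etaR] at h
      simp [h, K.counit_etaR]
  exact RingHom.congr_fun this x

theorem comul_betaHom (x : H.BaseChange B) :
    K.comul (f.betaHom x) = f.betaTwo (comulHom H B x) := by
  have : (K.comul : S →+* K.Two).comp f.betaHom = f.betaTwo.comp (comulHom H B) := by
    refine hom_ext ?_ ?_ ?_
    · intro b
      simp [comulHom, RingTensor.algebraMap_base]
    · intro γ
      simp [comulHom, betaTwo_midTwo, f.comul_mor]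
    · intro b
      simp [comulHom, K.comul_etaR]
  exact RingHom.congr_fun this x

theorem conj_betaHom (x : H.BaseChange B) :
    K.conj (f.betaHom x) = f.betaHom ((data H B).conj x) := by
  have : K.conj.comp f.betaHom = f.betaHom.comp (data H B).conj := by
    refine hom_ext ?_ ?_ ?_
    · intro b
      change K.conj (f.betaHom _) = f.betaHom (conjHom H B _)
      simp [conjHom, K.conj_etaL]
    · intro γ
      change K.conj (f.betaHom _) = f.betaHom (conjHom H B _)
      simp [conjHom, f.mor_conj]
    · intro b
      change K.conj (f.betaHom _) = f.betaHom (conjHom H B _)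
      simp [conjHom, K.conj_etaR]
  exact RingHom.congr_fun this x

/-- The morphism `(id, β) : (B, Γ_f) → (B, S)`. -/
def beta : Hom (H.baseChange B) K where
  mor := f.betaHom
  mor_etaL b := f.betaHom_left b
  mor_etaR b := f.betaHom_right b
  mor_counit x := f.counit_betaHom x
  mor_comul x := f.comul_betaHom x
  mor_conj x := f.conj_betaHom x

end Hom

end BaseChange

end HopfAlgebroid

/-! ### The compact-open topology between discrete spaces, and discrete modules -/

section Topology

/-- The compact-open topology on a type `F` of maps from `X` to `Y`, where `X` and `Y` are
discrete. -/
@[reducible] def compactOpen (F X Y : Type*) [FunLike F X Y] : TopologicalSpace F :=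
  TopologicalSpace.induced
    (fun φ : F => @ContinuousMap.mk X Y ⊥ ⊥ φ continuous_bot)
    (@ContinuousMap.compactOpen X Y ⊥ ⊥)

theorem continuous_compactOpen_iff {Z F X Y : Type*} [TopologicalSpace Z] [FunLike F X Y]
    (g : Z → F) :
    @Continuous Z F _ (compactOpen F X Y) g ↔ ∀ x, @Continuous Z Y _ ⊥ (fun z => g z x) := by
  let _ : TopologicalSpace X := ⊥
  let _ : TopologicalSpace Y := ⊥
  have : DiscreteTopology X := ⟨rfl⟩
  let e : F → C(X, Y) := fun φ => ⟨φ, continuous_bot⟩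
  change @Continuous Z F _ (TopologicalSpace.induced e ContinuousMap.compactOpen) g ↔ _
  rw [continuous_induced_rng,
    (ContinuousMap.homeoFnOfDiscrete (X := X) (Y := Y)).isInducing.continuous_iff,
    continuous_pi_iff]
  rfl

theorem continuous_compactOpen_eval {F X Y : Type*} [FunLike F X Y] (x : X) :
    @Continuous F Y (compactOpen F X Y) ⊥ (fun φ => φ x) :=
  let _ : TopologicalSpace F := compactOpen F X Y
  (continuous_compactOpen_iff (id : F → F)).1 continuous_id x

/-- A discrete module over a topological ring `Λ`: a discrete abelian group `M` with a continuous
ring homomorphism `Λ → Hom_ℤ(M, M)`, the target having the compact-open topology. -/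
structure DiscreteModule (Λ : Type u) [Ring Λ] [TopologicalSpace Λ] where
  carrier : Type u
  [addCommGroup : AddCommGroup carrier]
  act : Λ →+* AddMonoid.End carrier
  continuous_act :
    @Continuous Λ (AddMonoid.End carrier) _ (compactOpen (AddMonoid.End carrier) carrier carrier) act

namespace DiscreteModule

attribute [instance] DiscreteModule.addCommGroup

variable {Λ : Type u} [Ring Λ] [TopologicalSpace Λ]

/-- A morphism of discrete modules. -/
@[ext] structure Hom (M N : DiscreteModule Λ) where
  hom : M.carrier →+ N.carrier
  map_act : ∀ (D : Λ) (m : M.carrier), hom (M.act D m) = N.act D (hom m)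

/-- The category of discrete modules over a topological ring. -/
instance : Category (DiscreteModule Λ) where
  Hom := Hom
  id M := ⟨AddMonoidHom.id _, fun _ _ => rfl⟩
  comp f g := ⟨g.hom.comp f.hom, fun D m => by simp [f.map_act, g.map_act]⟩

/-- Restriction of scalars along a continuous ring homomorphism. -/
def restrict {Λ' : Type u} [Ring Λ'] [TopologicalSpace Λ'] (φ : Λ →+* Λ') (hφ : Continuous φ) :
    DiscreteModule Λ' ⥤ DiscreteModule Λ where
  obj M :=
    { carrier := M.carrier
      act := M.act.comp φ
      continuous_act := by
        let _ := compactOpen (AddMonoid.End M.carrier) M.carrier M.carrier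
        exact M.continuous_act.comp hφ }
  map f := ⟨f.hom, fun D m => f.map_act (φ D) m⟩

end DiscreteModule

end Topology

namespace HopfAlgebroid

/-! ### The dual algebra -/

section Dual

variable {A Γ : Type u} [CommRing A] [CommRing Γ] [Algebra A Γ] (H : HopfAlgebroid A Γ)

/-- The dual algebra `Γ^∨ = Hom_{A, η_L}(Γ, A)`. -/
def Dual (_H : HopfAlgebroid A Γ) : Type u := Γ →ₗ[A] A

namespace Dual

instance : AddCommGroup H.Dual := inferInstanceAs (AddCommGroup (Γ →ₗ[A] A))

instance : FunLike H.Dual Γ A := inferInstanceAs (FunLike (Γ →ₗ[A] A) Γ A)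

instance : LinearMapClass H.Dual A Γ A := inferInstanceAs (LinearMapClass (Γ →ₗ[A] A) A Γ A)

/-- The compact-open topology on `Γ^∨`, with `Γ` and `A` discrete. -/
instance : TopologicalSpace H.Dual := compactOpen H.Dual Γ A

variable {H}

@[ext] theorem ext {D E : H.Dual} (h : ∀ γ, D γ = E γ) : D = E := DFunLike.ext _ _ h

@[simp] theorem add_apply (D E : H.Dual) (γ : Γ) : (D + E) γ = D γ + E γ := rfl

/-- An element of the dual algebra is an `A`-linear map. -/
def toLin : H.Dual →+ (Γ →ₗ[A] A) := AddMonoidHom.id _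

@[simp] theorem toLin_apply (D : H.Dual) (γ : Γ) : toLin D γ = D γ := rfl

theorem map_etaL_mul (D : H.Dual) (a : A) (γ : Γ) : D (algebraMap A Γ a * γ) = a * D γ := by
  rw [← Algebra.smul_def, map_smul, smul_eq_mul]

/-- The map `id ⊗ D : Γ ⊗_{η_R, A, η_L} Γ → Γ`, `γ ⊗ γ' ↦ γ η_R(D(γ'))`. -/
def contract (D : H.Dual) : H.Two →+ Γ :=
  RingTensor.liftAdd
    (AddMonoidHom.mul.compr₂ (AddMonoidHom.id Γ) |>.compl₂
      ((H.etaR : A →+ Γ).comp ((toLin D).toAddMonoidHom)))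
    (fun a γ γ' => by
      change H.etaR a * γ * H.etaR (D γ') = γ * H.etaR (D (algebraMap A Γ a * γ'))
      rw [map_etaL_mul, map_mul]; ring)

theorem contract_tmul (D : H.Dual) (γ γ' : Γ) :
    D.contract (H.inl γ * H.inr γ') = γ * H.etaR (D γ') :=
  RingTensor.liftAdd_mul _ _ _ _

theorem contract_inl_mul (D : H.Dual) (γ : Γ) (x : H.Two) :
    D.contract (H.inl γ * x) = γ * D.contract x := by
  induction x using RingTensor.induction with
  | zero => simp
  | tmul s t => rw [← mul_assoc, ← map_mul, contract_tmul, contract_tmul, mul_assoc]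
  | add x y hx hy => rw [mul_add, map_add, hx, hy, map_add, mul_add]

theorem comul_etaL_mul (a : A) (γ : Γ) :
    H.comul (algebraMap A Γ a * γ) = H.inl (algebraMap A Γ a) * H.comul γ := by
  rw [map_mul, AlgHom.commutes]; rfl

theorem comul_mul_etaR (a : A) (γ : Γ) :
    H.comul (γ * H.etaR a) = H.comul γ * H.inr (H.etaR a) := by
  rw [map_mul, H.comul_etaR]

/-- The product `D₂ ∘ D₁`: the composite of `Δ`, `id ⊗ D₁` and `D₂`. -/
def compose (D₂ D₁ : H.Dual) : H.Dual :=
  (LinearMap.mk ⟨fun γ => D₂ (D₁.contract (H.comul γ)), fun x y => by simp only [map_add]⟩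
    (fun a γ => by
      change D₂ (D₁.contract (H.comul (a • γ))) = a * D₂ (D₁.contract (H.comul γ))
      rw [Algebra.smul_def, comul_etaL_mul, contract_inl_mul, map_etaL_mul]) : Γ →ₗ[A] A)

instance : Mul H.Dual := ⟨compose⟩

instance : One H.Dual := ⟨H.counit.toLinearMap⟩

theorem mul_apply (D₂ D₁ : H.Dual) (γ : Γ) : (D₂ * D₁) γ = D₂ (D₁.contract (H.comul γ)) := rfl

theorem one_apply (γ : Γ) : (1 : H.Dual) γ = H.counit γ := rfl

theorem contract_add (D E : H.Dual) (x : H.Two) :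
    (D + E).contract x = D.contract x + E.contract x := by
  induction x using RingTensor.induction with
  | zero => simp
  | tmul s t => simp only [contract_tmul, add_apply, map_add, mul_add]
  | add x y hx hy => simp only [map_add, hx, hy]; abel

theorem one_mul' (D : H.Dual) : 1 * D = D := by
  ext γ
  rw [mul_apply, one_apply]
  have h : ∀ x : H.Two, H.counit (D.contract x) =
      D (RingTensor.lift ((algebraMap A Γ).comp (H.counit : Γ →+* A)) (RingHom.id Γ)
        (by ext a; simp [H.counit_etaR]) x) := by
    intro x
    induction x using RingTensor.induction with
    | zero => simp
    | tmul s t =>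
      rw [contract_tmul, map_mul, map_mul, H.counit_etaR, RingTensor.lift_inl, RingTensor.lift_inr]
      exact (map_etaL_mul D _ _).symm
    | add x y hx hy => simp only [map_add, hx, hy]
  rw [h]
  exact congrArg D (RingHom.congr_fun (H.id_comp Γ (RingHom.id Γ)) γ)

theorem mul_one' (D : H.Dual) : D * 1 = D := by
  ext γ
  rw [mul_apply]
  have h : ∀ x : H.Two, (1 : H.Dual).contract x =
      RingTensor.lift (RingHom.id Γ) (H.etaR.comp (H.counit : Γ →+* A))
        (by ext a; simp) x := by
    intro x
    induction x using RingTensor.induction with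
    | zero => simp
    | tmul s t =>
      rw [contract_tmul, map_mul, RingTensor.lift_inl, RingTensor.lift_inr]
      rfl
    | add x y hx hy => simp only [map_add, hx, hy]
  rw [h]
  exact congrArg D (RingHom.congr_fun (H.comp_id Γ (RingHom.id Γ)) γ)

/-- The ring `Γ ⊗_A Γ ⊗_A Γ`. -/
abbrev Three (H : HopfAlgebroid A Γ) : Type u :=
  RingTensor (H.inr.comp H.etaR) (algebraMap A Γ)

/-- The inclusion of the first two factors. -/
abbrev inl₃ (H : HopfAlgebroid A Γ) : H.Two →+* Three H :=
  RingTensor.inl (H.inr.comp H.etaR) (algebraMap A Γ)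

/-- The inclusion of the third factor. -/
abbrev inr₃ (H : HopfAlgebroid A Γ) : Γ →+* Three H :=
  RingTensor.inr (H.inr.comp H.etaR) (algebraMap A Γ)

theorem composable₁₂ (H : HopfAlgebroid A Γ) :
    ((inl₃ H).comp H.inl).comp H.etaR = ((inl₃ H).comp H.inr).comp (algebraMap A Γ) := by
  ext a; simp [H.inl_etaR]

theorem composable₂₃ (H : HopfAlgebroid A Γ) :
    ((inl₃ H).comp H.inr).comp H.etaR = (inr₃ H).comp (algebraMap A Γ) := by
  ext a
  exact RingTensor.inl_eq_inr _ _ a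

/-- `Δ ⊗ id : Γ ⊗_A Γ → Γ ⊗_A Γ ⊗_A Γ`. -/
def comulLeft (H : HopfAlgebroid A Γ) : H.Two →+* Three H :=
  RingTensor.lift ((inl₃ H).comp (H.comul : Γ →+* H.Two)) (inr₃ H) (by
    ext a
    simp only [RingHom.comp_apply, RingHom.coe_coe, H.comul_etaR]
    exact RingTensor.inl_eq_inr _ _ a)

/-- The inclusion of the last two factors. -/
def inc₂₃ (H : HopfAlgebroid A Γ) : H.Two →+* Three H :=
  RingTensor.lift ((inl₃ H).comp H.inr) (inr₃ H) (composable₂₃ H)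

/-- `id ⊗ Δ : Γ ⊗_A Γ → Γ ⊗_A Γ ⊗_A Γ`. -/
def comulRight (H : HopfAlgebroid A Γ) : H.Two →+* Three H :=
  RingTensor.lift ((inl₃ H).comp H.inl) ((inc₂₃ H).comp (H.comul : Γ →+* H.Two)) (by
    ext a
    simp only [RingHom.comp_apply, RingHom.coe_coe, AlgHom.commutes, RingTensor.algebraMap_base,
      H.inl_etaR]
    simp [inc₂₃])

theorem comulLeft_comul (γ : Γ) :
    comulLeft H (H.comul γ) = comulRight H (H.comul γ) := by
  have h := RingHom.congr_fun (H.assoc (Three H) _ _ _ (composable₁₂ H) (composable₂₃ H)) γ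
  have h₁ : RingTensor.lift ((inl₃ H).comp H.inl) ((inl₃ H).comp H.inr) (composable₁₂ H) =
      inl₃ H := RingTensor.hom_ext (by simp) (by simp)
  simp only [CogroupoidData.comp, h₁] at h
  exact h

/-- The additive map `γ₁ ⊗ γ₂ ⊗ γ₃ ↦ γ₁ η_R(D₂(γ₂ η_R(D₁(γ₃))))`. -/
def contract₃ (D₂ D₁ : H.Dual) : Three H →+ Γ :=
  RingTensor.liftAdd
    ((AddMonoidHom.mul.compr₂ D₂.contract).compl₂
      ((H.inr : Γ →+ H.Two).comp ((H.etaR : A →+ Γ).comp ((toLin D₁).toAddMonoidHom))))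
    (fun a t γ => by
      change D₂.contract (H.inr (H.etaR a) * t * H.inr (H.etaR (D₁ γ))) =
        D₂.contract (t * H.inr (H.etaR (D₁ (algebraMap A Γ a * γ))))
      rw [map_etaL_mul, map_mul H.etaR, map_mul H.inr]; congr 1; ring)

theorem contract₃_tmul (D₂ D₁ : H.Dual) (t : H.Two) (γ : Γ) :
    contract₃ D₂ D₁ (inl₃ H t * inr₃ H γ) = D₂.contract (t * H.inr (H.etaR (D₁ γ))) :=
  RingTensor.liftAdd_mul _ _ _ _

theorem contract₃_comulLeft (D₂ D₁ : H.Dual) (x : H.Two) :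
    contract₃ D₂ D₁ (comulLeft H x) = D₂.contract (H.comul (D₁.contract x)) := by
  induction x using RingTensor.induction with
  | zero => simp
  | tmul s t =>
    rw [contract_tmul, comul_mul_etaR, map_mul, comulLeft, RingTensor.lift_inl,
      RingTensor.lift_inr]
    exact contract₃_tmul _ _ _ _
  | add x y hx hy => simp only [map_add, hx, hy]

theorem contract₃_inc₂₃ (D₂ D₁ : H.Dual) (γ : Γ) (x : H.Two) :
    contract₃ D₂ D₁ (inl₃ H (H.inl γ) * inc₂₃ H x) = γ * H.etaR (D₂ (D₁.contract x)) := by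
  induction x using RingTensor.induction with
  | zero => simp
  | tmul s t =>
    rw [inc₂₃, RingHom.map_mul, RingTensor.lift_inl, RingTensor.lift_inr, RingHom.comp_apply,
      ← mul_assoc,
      ← map_mul, contract₃_tmul, contract_tmul, mul_assoc, ← map_mul, contract_tmul]
  | add x y hx hy => simp only [map_add, mul_add, hx, hy]

theorem contract₃_comulRight (D₂ D₁ : H.Dual) (x : H.Two) :
    contract₃ D₂ D₁ (comulRight H x) = (D₂ * D₁).contract x := by
  induction x using RingTensor.induction with
  | zero => simp
  | tmul s t =>
    rw [contract_tmul, map_mul, comulRight, RingTensor.lift_inl, RingTensor.lift_inr]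
    exact contract₃_inc₂₃ _ _ _ _
  | add x y hx hy => simp only [map_add, hx, hy]

theorem contract_comul_contract (D₂ D₁ : H.Dual) (γ : Γ) :
    D₂.contract (H.comul (D₁.contract (H.comul γ))) = (D₂ * D₁).contract (H.comul γ) := by
  rw [← contract₃_comulLeft, comulLeft_comul, contract₃_comulRight]

instance : Ring H.Dual where
  __ := (inferInstance : AddCommGroup H.Dual)
  left_distrib D E F := by
    ext γ; simp only [mul_apply, add_apply, contract_add, map_add]
  right_distrib D E F := by
    ext γ; simp only [mul_apply, add_apply]
  zero_mul D := by
    ext γ; rfl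
  mul_zero D := by
    have h : D * 0 + D * 0 = D * 0 + 0 := by
      ext γ
      rw [add_zero, add_apply, mul_apply, ← map_add, ← contract_add, add_zero]
    exact add_left_cancel h
  mul_assoc D E F := by
    ext γ
    rw [mul_apply, mul_apply, mul_apply, contract_comul_contract]
  one_mul := one_mul'
  mul_one := mul_one'

section Map

variable {S : Type u} [CommRing S] [Algebra A S] {K : HopfAlgebroid A S}

/-- The map `Hom_A(S, A) → Hom_A(Γ, A)`, `D ↦ D ∘ f_m`. -/
def precomp (f : Hom H K) (D : K.Dual) : H.Dual :=
  (LinearMap.mk ⟨fun γ => D (f.mor γ), fun x y => by simp only [map_add]⟩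
    (fun a γ => by
      change D (f.mor (a • γ)) = a * D (f.mor γ)
      rw [Algebra.smul_def, map_mul, f.mor_etaL]
      exact map_etaL_mul D a _) : Γ →ₗ[A] A)

theorem precomp_apply (f : Hom H K) (D : K.Dual) (γ : Γ) : precomp f D γ = D (f.mor γ) := rfl

theorem contract_morTwo (f : Hom H K) (D : K.Dual) (x : H.Two) :
    D.contract (f.morTwo x) = f.mor ((precomp f D).contract x) := by
  induction x using RingTensor.induction with
  | zero => simp
  | tmul s t =>
    rw [map_mul, f.morTwo_inl, f.morTwo_inr, contract_tmul, contract_tmul, map_mul, f.mor_etaR]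
    rfl
  | add x y hx hy => simp only [map_add, hx, hy]

/-- A morphism of Hopf algebroids which is the identity on the base induces the homomorphism
`D ↦ D ∘ f_m` of dual algebras. -/
def map (f : Hom H K) : K.Dual →+* H.Dual where
  toFun := precomp f
  map_zero' := rfl
  map_add' _ _ := rfl
  map_one' := by
    ext γ
    exact f.mor_counit γ
  map_mul' D E := by
    ext γ
    rw [precomp_apply, mul_apply, f.comul_mor, contract_morTwo]
    rfl

theorem continuous_map (f : Hom H K) : Continuous (map f) :=
  (continuous_compactOpen_iff _).2 fun γ => continuous_compactOpen_eval (f.mor γ)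

end Map

end Dual

end Dual

end HopfAlgebroid

namespace HopfAlgebroid

/-! ### Right comodules -/

section Comodule

variable {A Γ : Type u} [CommRing A] [CommRing Γ] [Algebra A Γ] (H : HopfAlgebroid A Γ)

/-- The inclusion `γ ↦ γ ⊗ 1` as a homomorphism of `A`-algebras (through the left units). -/
def inlAlg : Γ →ₐ[A] H.Two := AlgHom.mk H.inl (fun _ => rfl)

section

variable {H} {M : Type u} [AddCommGroup M] [Module A M]

theorem rTensor_smul {C C' : Type u} [CommRing C] [CommRing C'] [Algebra A C] [Algebra A C']
    (φ : C →ₐ[A] C') (c : C) (x : C ⊗[A] M) :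
    φ.toLinearMap.rTensor M (c • x) = φ c • φ.toLinearMap.rTensor M x := by
  induction x using TensorProduct.induction_on with
  | zero => simp
  | tmul s m => simp [TensorProduct.smul_tmul']
  | add x y hx hy => simp only [smul_add, map_add, hx, hy]

/-- The map `ψ ⊗ id : M ⊗_{A, η_L} Γ → M ⊗_{A, η_L} Γ ⊗_{η_R, A, η_L} Γ`, `m ⊗ γ ↦ ψ(m) ⊗ γ`. -/
def coactTwo (ψ : M →ₛₗ[H.etaR] Γ ⊗[A] M) : Γ ⊗[A] M →+ H.Two ⊗[A] M :=
  TensorProduct.liftAddHom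
    (AddMonoidHom.mk' (fun γ =>
        (DistribSMul.toAddMonoidHom (H.Two ⊗[A] M) (H.inr γ)).comp
          ((H.inlAlg.toLinearMap.rTensor M).toAddMonoidHom.comp ψ.toAddMonoidHom))
      (fun γ γ' => by ext m; simp [add_smul]))
    (fun a γ m => by
      change H.inr (a • γ) • H.inlAlg.toLinearMap.rTensor M (ψ m) =
        H.inr γ • H.inlAlg.toLinearMap.rTensor M (ψ (a • m))
      have h : H.inlAlg (H.etaR a) = H.inr (algebraMap A Γ a) := H.inl_etaR a
      rw [map_smulₛₗ ψ, rTensor_smul, smul_smul, h, ← map_mul, Algebra.smul_def, mul_comm])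

theorem coactTwo_tmul (ψ : M →ₛₗ[H.etaR] Γ ⊗[A] M) (γ : Γ) (m : M) :
    coactTwo ψ (γ ⊗ₜ m) = H.inr γ • H.inlAlg.toLinearMap.rTensor M (ψ m) := rfl

end

/-- A right `Γ`-comodule: an `A`-module `M` with a map `ψ : M → M ⊗_{A, η_L} Γ` that is linear
with respect to the `η_R`-structure of `Γ`, coassociative and counitary. The tensor product
`M ⊗_{A, η_L} Γ` is written with the factor `Γ` on the left, as `Γ ⊗[A] M`; similarly
`M ⊗_{A, η_L} Γ ⊗_{η_R, A, η_L} Γ` is `H.Two ⊗[A] M`. -/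
structure Comodule where
  carrier : Type u
  [addCommGroup : AddCommGroup carrier]
  [module : Module A carrier]
  coact : carrier →ₛₗ[H.etaR] Γ ⊗[A] carrier
  coassoc : ∀ m, H.comul.toLinearMap.rTensor carrier (coact m) = coactTwo coact (coact m)
  counit_coact : ∀ m,
    TensorProduct.lid A carrier (H.counit.toLinearMap.rTensor carrier (coact m)) = m

namespace Comodule

attribute [instance] Comodule.addCommGroup Comodule.module

variable {H}

/-- A morphism of comodules. -/
@[ext] structure Hom (M N : H.Comodule) where
  hom : M.carrier →ₗ[A] N.carrier
  map_coact : ∀ m, N.coact (hom m) = hom.lTensor Γ (M.coact m)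

/-- The category `RCoMod_Γ` of right `Γ`-comodules. -/
instance : Category H.Comodule where
  Hom := Hom
  id M := ⟨LinearMap.id, fun m => by simp⟩
  comp f g := ⟨g.hom ∘ₗ f.hom, fun m => by
    simp [f.map_coact, g.map_coact, LinearMap.lTensor_comp]⟩

/-- The action of `D ∈ Γ^∨` on a comodule `M`: the composite of `ψ : M → M ⊗_{A, η_L} Γ` and
`id ⊗ D`. -/
def actHom (M : H.Comodule) (D : H.Dual) : AddMonoid.End M.carrier :=
  ((TensorProduct.lid A M.carrier).toLinearMap ∘ₗ
    (Dual.toLin D).rTensor M.carrier).toAddMonoidHom.comp M.coact.toAddMonoidHom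

theorem actHom_apply (M : H.Comodule) (D : H.Dual) (m : M.carrier) :
    M.actHom D m =
      TensorProduct.lid A M.carrier ((Dual.toLin D).rTensor M.carrier (M.coact m)) := rfl

/-- `id_M ⊗ (id ⊗ D) : M ⊗ Γ ⊗ Γ → M ⊗ Γ`. -/
def contractTwo (D : H.Dual) (M : Type u) [AddCommGroup M] [Module A M] :
    H.Two ⊗[A] M →ₗ[A] Γ ⊗[A] M :=
  LinearMap.rTensor M
    (LinearMap.mk ⟨D.contract, map_add _⟩ (fun a x => by
      change D.contract (a • x) = a • D.contract x
      rw [Algebra.smul_def, Algebra.smul_def]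
      exact D.contract_inl_mul _ x) : H.Two →ₗ[A] Γ)

theorem contractTwo_tmul (D : H.Dual) (M : Type u) [AddCommGroup M] [Module A M] (x : H.Two)
    (m : M) : contractTwo D M (x ⊗ₜ m) = D.contract x ⊗ₜ m := rfl

theorem contractTwo_inr_smul (D : H.Dual) (M : Type u) [AddCommGroup M] [Module A M] (γ : Γ)
    (x : Γ ⊗[A] M) : contractTwo D M (H.inr γ • H.inlAlg.toLinearMap.rTensor M x) =
      H.etaR (D γ) • x := by
  induction x using TensorProduct.induction_on with
  | zero => simp
  | tmul s m =>
    have h : D.contract (H.inr γ * H.inl s) = H.etaR (D γ) * s := by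
      rw [mul_comm, Dual.contract_tmul, mul_comm]
    rw [LinearMap.rTensor_tmul, TensorProduct.smul_tmul', TensorProduct.smul_tmul',
      contractTwo_tmul]
    exact congrArg (· ⊗ₜ[A] m) h
  | add x y hx hy => simp only [map_add, smul_add, hx, hy]

theorem coact_lid_rTensor (M : H.Comodule) (D : H.Dual) (x : Γ ⊗[A] M.carrier) :
    M.coact (TensorProduct.lid A M.carrier ((Dual.toLin D).rTensor M.carrier x)) =
      contractTwo D M.carrier (coactTwo M.coact x) := by
  induction x using TensorProduct.induction_on with
  | zero => simp
  | tmul s m =>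
    rw [coactTwo_tmul, contractTwo_inr_smul, LinearMap.rTensor_tmul, TensorProduct.lid_tmul,
      map_smulₛₗ]
    rfl
  | add x y hx hy => simp only [map_add, hx, hy]

theorem rTensor_contractTwo (D₂ D₁ : H.Dual) (M : Type u) [AddCommGroup M] [Module A M]
    (x : Γ ⊗[A] M) :
    (Dual.toLin D₂).rTensor M (contractTwo D₁ M (H.comul.toLinearMap.rTensor M x)) =
      (Dual.toLin (D₂ * D₁)).rTensor M x := by
  induction x using TensorProduct.induction_on with
  | zero => simp
  | tmul s m => rfl
  | add x y hx hy => simp only [map_add, hx, hy]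

theorem actHom_mul (M : H.Comodule) (D₂ D₁ : H.Dual) (m : M.carrier) :
    M.actHom (D₂ * D₁) m = M.actHom D₂ (M.actHom D₁ m) := by
  rw [actHom_apply, actHom_apply, actHom_apply, coact_lid_rTensor, ← M.coassoc,
    rTensor_contractTwo]

theorem actHom_continuous (M : H.Comodule) :
    @Continuous H.Dual (AddMonoid.End M.carrier) _
      (compactOpen (AddMonoid.End M.carrier) M.carrier M.carrier) M.actHom := by
  rw [continuous_compactOpen_iff]
  intro m
  let _ : TopologicalSpace M.carrier := ⊥
  have : DiscreteTopology M.carrier := ⟨rfl⟩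
  simp only [actHom_apply]
  generalize M.coact m = x
  induction x using TensorProduct.induction_on with
  | zero => simpa using continuous_const
  | tmul γ m =>
    let _ : TopologicalSpace A := ⊥
    have : DiscreteTopology A := ⟨rfl⟩
    have h : Continuous (fun D : H.Dual => D γ) := continuous_compactOpen_eval γ
    exact (continuous_of_discreteTopology (f := fun a : A => a • m)).comp h
  | add x y hx hy =>
    simp only [map_add]
    exact (continuous_of_discreteTopology
      (f := fun p : M.carrier × M.carrier => p.1 + p.2)).comp (hx.prodMk hy)

/-- The discrete `Γ^∨`-module underlying a comodule. -/
def toDiscreteModule (M : H.Comodule) : DiscreteModule H.Dual where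
  carrier := M.carrier
  act :=
    { toFun := M.actHom
      map_one' := by
        ext m
        exact M.counit_coact m
      map_mul' D E := by
        ext m
        exact M.actHom_mul D E m
      map_zero' := by
        ext m
        simp [actHom_apply]
      map_add' D E := by
        ext m
        change M.actHom (D + E) m = M.actHom D m + M.actHom E m
        simp [actHom_apply, LinearMap.rTensor_add] }
  continuous_act := M.actHom_continuous

end Comodule

theorem Comodule.Hom.map_actHom {M N : H.Comodule} (f : Comodule.Hom M N) (D : H.Dual)
    (m : M.carrier) : f.hom (M.actHom D m) = N.actHom D (f.hom m) := by
  rw [Comodule.actHom_apply, Comodule.actHom_apply, f.map_coact]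
  generalize M.coact m = x
  induction x using TensorProduct.induction_on with
  | zero => simp
  | tmul γ m => simp
  | add x y hx hy => simp only [map_add, hx, hy]

/-- The functor `RCoMod_Γ → Mod^d_{Γ^∨}`, regarding comodules as discrete modules over the dual
algebra. -/
def toDiscrete : H.Comodule ⥤ DiscreteModule H.Dual where
  obj M := M.toDiscreteModule
  map f := ⟨f.hom.toAddMonoidHom, fun D m => Comodule.Hom.map_actHom H f D m⟩

end Comodule

end HopfAlgebroid

namespace HopfAlgebroid

/-! ### Pullback of comodules along a morphism -/

section PushTensor

variable {A B C C' : Type u} [CommRing A] [CommRing B] [CommRing C] [CommRing C'] [Algebra A B]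
  [Algebra A C] [Algebra B C']

/-- For a ring homomorphism `F : C → C'` compatible with `A → B`, the additive map
`M ⊗_A C → (M ⊗_A B) ⊗_B C'`, `m ⊗ c ↦ (m ⊗ 1) ⊗ F(c)`. -/
def pushTensor (F : C →+* C') (hF : ∀ a, F (algebraMap A C a) = algebraMap B C' (algebraMap A B a))
    (M : Type u) [AddCommGroup M] [Module A M] : C ⊗[A] M →+ C' ⊗[B] (B ⊗[A] M) :=
  TensorProduct.liftAddHom
    (AddMonoidHom.mk' (fun c => AddMonoidHom.mk' (fun m => F c ⊗ₜ[B] ((1 : B) ⊗ₜ[A] m))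
        (fun m m' => by rw [TensorProduct.tmul_add, TensorProduct.tmul_add]))
      (fun c c' => by ext m; simp [TensorProduct.add_tmul]))
    (fun a c m => by
      change F (a • c) ⊗ₜ[B] ((1 : B) ⊗ₜ[A] m) = F c ⊗ₜ[B] ((1 : B) ⊗ₜ[A] (a • m))
      rw [Algebra.smul_def, map_mul, hF, ← Algebra.smul_def, TensorProduct.smul_tmul,
        ← TensorProduct.smul_tmul a (1 : B) m, TensorProduct.smul_tmul', smul_eq_mul, mul_one,
        Algebra.smul_def, mul_one])

variable (F : C →+* C') (hF : ∀ a, F (algebraMap A C a) = algebraMap B C' (algebraMap A B a))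
  (M : Type u) [AddCommGroup M] [Module A M]

theorem pushTensor_tmul (c : C) (m : M) :
    pushTensor F hF M (c ⊗ₜ m) = F c ⊗ₜ[B] ((1 : B) ⊗ₜ[A] m) := rfl

theorem pushTensor_smul (c : C) (x : C ⊗[A] M) :
    pushTensor F hF M (c • x) = F c • pushTensor F hF M x := by
  induction x using TensorProduct.induction_on with
  | zero => simp
  | tmul s m => simp [TensorProduct.smul_tmul', pushTensor_tmul]
  | add x y hx hy => simp only [smul_add, map_add, hx, hy]

theorem pushTensor_rTensor {E E' : Type u} [CommRing E] [CommRing E'] [Algebra A E] [Algebra B E']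
    (G : E →+* E') (hG : ∀ a, G (algebraMap A E a) = algebraMap B E' (algebraMap A B a))
    (φ : C →ₐ[A] E) (φ' : C' →ₐ[B] E') (h : ∀ c, φ' (F c) = G (φ c)) (x : C ⊗[A] M) :
    φ'.toLinearMap.rTensor (B ⊗[A] M) (pushTensor F hF M x) =
      pushTensor G hG M (φ.toLinearMap.rTensor M x) := by
  induction x using TensorProduct.induction_on with
  | zero => simp
  | tmul s m => simp [pushTensor_tmul, h]
  | add x y hx hy => simp only [map_add, hx, hy]

theorem pushTensor_lTensor {M N : Type u} [AddCommGroup M] [Module A M] [AddCommGroup N]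
    [Module A N] (g : M →ₗ[A] N) (x : C ⊗[A] M) :
    (g.baseChange B).lTensor C' (pushTensor F hF M x) =
      pushTensor F hF N (g.lTensor C x) := by
  induction x using TensorProduct.induction_on with
  | zero => simp
  | tmul s m => simp [pushTensor_tmul]
  | add x y hx hy => simp only [map_add, hx, hy]

end PushTensor

section Pullback

variable {A Γ B S : Type u} [CommRing A] [CommRing Γ] [Algebra A Γ]
    [CommRing B] [CommRing S] [Algebra B S] [Algebra A B]
    {H : HopfAlgebroid A Γ} {K : HopfAlgebroid B S}

namespace Hom

variable (f : Hom H K)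

theorem morTwo_algebraMap (a : A) :
    f.morTwo (algebraMap A H.Two a) = algebraMap B K.Two (algebraMap A B a) := by
  rw [RingTensor.algebraMap_base, RingTensor.algebraMap_base, f.morTwo_inl, f.mor_etaL]

/-- The additive map underlying the coaction on `M ⊗_A B`. -/
def pullCoactAdd (M : H.Comodule) : B ⊗[A] M.carrier →+ S ⊗[B] (B ⊗[A] M.carrier) :=
  TensorProduct.liftAddHom
    (AddMonoidHom.mk' (fun b =>
        (DistribSMul.toAddMonoidHom (S ⊗[B] (B ⊗[A] M.carrier)) (K.etaR b)).comp
          ((pushTensor f.mor f.mor_etaL M.carrier).comp M.coact.toAddMonoidHom))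
      (fun b b' => by ext m; simp [add_smul]))
    (fun a b m => by
      change K.etaR (a • b) • pushTensor f.mor f.mor_etaL M.carrier (M.coact m) =
        K.etaR b • pushTensor f.mor f.mor_etaL M.carrier (M.coact (a • m))
      rw [map_smulₛₗ M.coact, pushTensor_smul, smul_smul, f.mor_etaR, ← map_mul,
        Algebra.smul_def, mul_comm])

theorem pullCoactAdd_tmul (M : H.Comodule) (b : B) (m : M.carrier) :
    f.pullCoactAdd M (b ⊗ₜ m) =
      K.etaR b • pushTensor f.mor f.mor_etaL M.carrier (M.coact m) := rfl

/-- The coaction on `M ⊗_A B`: the map `M ⊗_A B → (M ⊗_A B) ⊗_{B, η_L} S` sending `m ⊗ b` to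
`η_R(b)` times the image of `m` under
`M → M ⊗_{A, η_L} Γ → M ⊗_{A, η_L} S ≃ (M ⊗_A B) ⊗_{B, η_L} S`. -/
def pullCoact (M : H.Comodule) :
    B ⊗[A] M.carrier →ₛₗ[K.etaR] S ⊗[B] (B ⊗[A] M.carrier) where
  toFun := f.pullCoactAdd M
  map_add' := map_add _
  map_smul' b x := by
    induction x using TensorProduct.induction_on with
    | zero => simp
    | tmul b' m =>
      rw [TensorProduct.smul_tmul', pullCoactAdd_tmul, pullCoactAdd_tmul, smul_eq_mul, map_mul,
        mul_smul]
    | add x y hx hy => rw [smul_add, map_add, hx, hy, map_add, smul_add]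

theorem pullCoact_tmul (M : H.Comodule) (b : B) (m : M.carrier) :
    f.pullCoact M (b ⊗ₜ m) =
      K.etaR b • pushTensor f.mor f.mor_etaL M.carrier (M.coact m) := rfl

theorem coactTwo_smul {M : Type u} [AddCommGroup M] [Module A M] (ψ : M →ₛₗ[H.etaR] Γ ⊗[A] M)
    (γ : Γ) (x : Γ ⊗[A] M) : coactTwo ψ (γ • x) = H.inr γ • coactTwo ψ x := by
  induction x using TensorProduct.induction_on with
  | zero => simp
  | tmul s m => rw [TensorProduct.smul_tmul', smul_eq_mul, coactTwo_tmul, coactTwo_tmul, map_mul,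
      mul_smul]
  | add x y hx hy => simp only [smul_add, map_add, hx, hy]

theorem coactTwo_pushTensor (M : H.Comodule) (x : Γ ⊗[A] M.carrier) :
    coactTwo (f.pullCoact M) (pushTensor f.mor f.mor_etaL M.carrier x) =
      pushTensor f.morTwo f.morTwo_algebraMap M.carrier (coactTwo M.coact x) := by
  induction x using TensorProduct.induction_on with
  | zero => simp
  | tmul s m =>
    rw [pushTensor_tmul, coactTwo_tmul, coactTwo_tmul, pullCoact_tmul, map_one, one_smul,
      pushTensor_smul, f.morTwo_inr]
    rw [pushTensor_rTensor (B := B) f.mor f.mor_etaL M.carrier f.morTwo f.morTwo_algebraMap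
      H.inlAlg K.inlAlg (fun c => (f.morTwo_inl c).symm)]
  | add x y hx hy => simp only [map_add, hx, hy]

/-- The pullback of a comodule `M`, with underlying module `M ⊗_A B`. -/
def pullbackObj (M : H.Comodule) : K.Comodule where
  carrier := B ⊗[A] M.carrier
  coact := f.pullCoact M
  coassoc x := by
    induction x using TensorProduct.induction_on with
    | zero => simp
    | tmul b m =>
      rw [pullCoact_tmul, rTensor_smul, coactTwo_smul, coactTwo_pushTensor, ← M.coassoc,
        pushTensor_rTensor (B := B) f.mor f.mor_etaL M.carrier f.morTwo f.morTwo_algebraMap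
          H.comul K.comul f.comul_mor, K.comul_etaR]
    | add x y hx hy => simp only [map_add, hx, hy]
  counit_coact x := by
    induction x using TensorProduct.induction_on with
    | zero => simp
    | tmul b m =>
      rw [pullCoact_tmul, rTensor_smul,
        pushTensor_rTensor (B := B) f.mor f.mor_etaL M.carrier (algebraMap A B)
          (fun a => rfl) H.counit K.counit f.mor_counit, K.counit_etaR]
      have h : ∀ y : A ⊗[A] M.carrier, TensorProduct.lid B (B ⊗[A] M.carrier)
          (b • pushTensor (B := B) (C' := B) (algebraMap A B) (fun a => rfl) M.carrier y) =
          b ⊗ₜ TensorProduct.lid A M.carrier y := by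
        intro y
        induction y using TensorProduct.induction_on with
        | zero => simp
        | tmul a m =>
          rw [pushTensor_tmul]
          rw [TensorProduct.smul_tmul', TensorProduct.lid_tmul, TensorProduct.lid_tmul,
            TensorProduct.smul_tmul', TensorProduct.tmul_smul, TensorProduct.smul_tmul',
            smul_eq_mul, smul_eq_mul, mul_one, mul_comm, Algebra.smul_def]
        | add x y hx hy => simp only [map_add, smul_add, hx, hy, TensorProduct.tmul_add]
      rw [h, M.counit_coact]
    | add x y hx hy => simp only [map_add, hx, hy]

theorem pullCoact_baseChange {M N : H.Comodule} (g : Comodule.Hom M N)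
    (x : B ⊗[A] M.carrier) :
    f.pullCoact N (g.hom.baseChange B x) = (g.hom.baseChange B).lTensor S (f.pullCoact M x) := by
  have hs : ∀ (s : S) (y : S ⊗[B] (B ⊗[A] M.carrier)),
      (g.hom.baseChange B).lTensor S (s • y) = s • (g.hom.baseChange B).lTensor S y := by
    intro s y
    induction y using TensorProduct.induction_on with
    | zero => simp
    | tmul t m => simp [TensorProduct.smul_tmul']
    | add x y hx hy => simp only [smul_add, map_add, hx, hy]
  induction x using TensorProduct.induction_on with
  | zero => simp
  | tmul b m =>
    rw [LinearMap.baseChange_tmul, pullCoact_tmul, pullCoact_tmul, g.map_coact, hs,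
      pushTensor_lTensor]
  | add x y hx hy => simp only [map_add, hx, hy]

/-- The pullback functor `f^* : RCoMod_Γ → RCoMod_S`, `M ↦ M ⊗_A B`. -/
def pullback : H.Comodule ⥤ K.Comodule where
  obj := f.pullbackObj
  map g := ⟨g.hom.baseChange B, fun x => f.pullCoact_baseChange g x⟩
  map_id M := Comodule.Hom.ext (LinearMap.baseChange_id (R := A) (A := B) (M := M.carrier))
  map_comp g h := Comodule.Hom.ext (LinearMap.baseChange_comp (R := A) (A := B) g.hom h.hom)

end Hom

end Pullback

end HopfAlgebroid

end DualAlg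

end

open DualAlg

/-! Two facts carry the theorem: comodules over a free Hopf algebroid are the same as discrete
modules over its dual algebra, and comodules descend along `(f_o, ι)`.

Comodules and discrete modules. If `Γ` is free over `A` through the left unit, an element of `M ⊗ Γ`
is determined by its contractions with all `D` in the dual algebra (`eq_of_evalTensor_eq`). Hence a
coaction is determined by the induced action, and coassociativity and linearity of maps can be
tested on actions. Conversely, continuity says that on a fixed `m` the operator `D` depends only on
finitely many values of `D`. So only finitely many dual basis functionals matter, and the finite sum
of the `b i ⊗ (b i)^* m` is a coaction inducing the given action (`exists_evalTensor_eq`). The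
`A`-module structure is itself recovered from the elements `a ε`.

Descent. Write `P` for `Γ ⊗_{η_R, A, f_o} B`. The map `A → B` need not be flat; only `α : A → P` is
faithfully flat. For a comodule `M`, however, the coaction is an isomorphism between the base
changes of `M` to a `Γ`-algebra along `η_R` and along `η_L` (`twistEquiv`). Along `η_R`, the ring
`P` is a `B`-algebra, and the counit makes `B` an `A`-linear retract of it; along `η_L`, the
structure map of `P` is `α`. Therefore tensoring with `B` preserves exactness of sequences of
comodules (`exact_baseChange`), and a sequence that splits after tensoring with `B` was exact
already (`exact_of_split`).

The right adjoint of pullback sends `N` to the equalizer of two maps from the cofree comodule `N ⊗_A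
Γ` to `(N ⊗_B S) ⊗_A Γ`. If pullback takes cofree comodules to cofree comodules, the base change of
this equalizer is the start of the cobar resolution of `N`, which is contracted by the counit.
Exactness then makes the counit of the adjunction an isomorphism (`exists_pullback_iso`), and
faithful flatness does the same for the unit (`exact_adjunctHom_id`). For the target `Γ_f`,
preservation of cofree comodules is the associativity `(B ⊗ Γ ⊗ B) ⊗_B N ≃ B ⊗_A (Γ ⊗_A N)`
(`comparison_bijective`).

Freeness of `Γ_f` holds because it is the base change of `P` along `f_o`. The identification of
`f^*` holds because the two coactions on `M ⊗_A B` differ by `β`, so `D` acts through one as `D ∘ β`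
acts through the other. -/

noncomputable section

namespace DualAlg

namespace HopfAlgebroid

/-! ### Contraction with elements of the dual algebra -/

section Contraction

variable {A Γ : Type u} [CommRing A] [CommRing Γ] [Algebra A Γ] {H : HopfAlgebroid A Γ}

/-- The contraction `id ⊗ D : M ⊗_{A, η_L} Γ → M`. -/
def Dual.evalTensor (D : H.Dual) (M : Type u) [AddCommGroup M] [Module A M] :
    Γ ⊗[A] M →ₗ[A] M :=
  (TensorProduct.lid A M).toLinearMap ∘ₗ (Dual.toLin D).rTensor M

section

variable {M N : Type u} [AddCommGroup M] [Module A M] [AddCommGroup N] [Module A N]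

@[simp] theorem Dual.evalTensor_tmul (D : H.Dual) (γ : Γ) (m : M) :
    D.evalTensor M (γ ⊗ₜ m) = D γ • m := rfl

theorem Dual.evalTensor_lTensor (D : H.Dual) (g : M →ₗ[A] N) (x : Γ ⊗[A] M) :
    D.evalTensor N (g.lTensor Γ x) = g (D.evalTensor M x) := by
  induction x using TensorProduct.induction_on with
  | zero => simp
  | tmul γ m => simp
  | add x y hx hy => simp only [map_add, hx, hy]

theorem Comodule.actHom_eq_evalTensor (M : H.Comodule) (D : H.Dual) (m : M.carrier) :
    M.actHom D m = D.evalTensor M.carrier (M.coact m) := rfl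

theorem evalTensor_one (x : Γ ⊗[A] M) : (1 : H.Dual).evalTensor M x =
    TensorProduct.lid A M (H.counit.toLinearMap.rTensor M x) := rfl

/-- Elements of `M ⊗_{A, η_L} Γ` are separated by the dual algebra if `Γ` is free. -/
theorem eq_of_evalTensor_eq (H : HopfAlgebroid A Γ) [Module.Free A Γ] {x y : Γ ⊗[A] M}
    (h : ∀ D : H.Dual, D.evalTensor M x = D.evalTensor M y) : x = y := by
  let b := Module.Free.chooseBasis A Γ
  -- A basis identifies `Γ ⊗ M` with finitely supported families in `M`, and the `i`-th entry is the
  -- contraction with the dual functional `b.coord i`.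
  refine (TensorProduct.equivFinsuppOfBasisLeft (N := M) b).injective ?_
  ext i
  rw [TensorProduct.equivFinsuppOfBasisLeft_apply, TensorProduct.equivFinsuppOfBasisLeft_apply]
  exact h (b.coord i : Γ →ₗ[A] A)

/-- The element `a ε` of the dual algebra. -/
def Dual.scalar (H : HopfAlgebroid A Γ) : A →+* H.Dual where
  toFun a := (a • H.counit.toLinearMap : Γ →ₗ[A] A)
  map_zero' := zero_smul A H.counit.toLinearMap
  map_add' a b := add_smul a b H.counit.toLinearMap
  map_one' := one_smul A H.counit.toLinearMap
  map_mul' a b := by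
    ext γ
    -- The outer factor of the product is `a` times the unit, so `a` comes out and only the unit law
    -- for `E` remains.
    let E : H.Dual := (b • H.counit.toLinearMap : Γ →ₗ[A] A)
    have h : ((1 : H.Dual) * E) γ = b * H.counit γ :=
      congrArg (fun D : H.Dual => D γ) (one_mul E)
    change a * b * H.counit γ = a * ((1 : H.Dual) * E) γ
    rw [h, mul_assoc]

theorem Dual.scalar_apply (a : A) (γ : Γ) : Dual.scalar H a γ = a * H.counit γ := rfl

theorem Dual.scalar_mul_apply (a : A) (D : H.Dual) (γ : Γ) :
    (Dual.scalar H a * D) γ = a * D γ := by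
  have h : ((1 : H.Dual) * D) γ = D γ := congrArg (fun D : H.Dual => D γ) (one_mul _)
  rw [← h]
  rfl

theorem Dual.contract_comul_one (γ : Γ) : (1 : H.Dual).contract (H.comul γ) = γ := by
  have h : ∀ x : H.Two, (1 : H.Dual).contract x =
      RingTensor.lift (RingHom.id Γ) (H.etaR.comp (H.counit : Γ →+* A))
        (by ext a; simp) x := by
    intro x
    induction x using RingTensor.induction with
    | zero => simp
    | tmul s t =>
      rw [contract_tmul, map_mul, RingTensor.lift_inl, RingTensor.lift_inr]
      rfl
    | add x y hx hy => simp only [map_add, hx, hy]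
  rw [h]
  exact RingHom.congr_fun (H.comp_id Γ (RingHom.id Γ)) γ

theorem Dual.contract_scalar (a : A) (x : H.Two) :
    (Dual.scalar H a).contract x = H.etaR a * (1 : H.Dual).contract x := by
  induction x using RingTensor.induction with
  | zero => simp
  | tmul s t =>
    rw [contract_tmul, contract_tmul, scalar_apply, map_mul, one_apply]
    ring
  | add x y hx hy => simp only [map_add, hx, hy, mul_add]

/-- Multiplying by `a ε` on the left scales the values, while multiplying on the right precomposes
with multiplication by `η_R(a)`. The second rule is what makes coactions reconstructed from actions
linear for the right unit. -/
theorem Dual.mul_scalar_apply (a : A) (D : H.Dual) (γ : Γ) :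
    (D * Dual.scalar H a) γ = D (H.etaR a * γ) := by
  rw [mul_apply, contract_scalar, contract_comul_one]

theorem Dual.evalTensor_scalar (a : A) (x : Γ ⊗[A] M) :
    (Dual.scalar H a).evalTensor M x = a • (1 : H.Dual).evalTensor M x := by
  induction x using TensorProduct.induction_on with
  | zero => simp
  | tmul γ m => rw [evalTensor_tmul, evalTensor_tmul, scalar_apply, mul_smul]; rfl
  | add x y hx hy => simp only [map_add, hx, hy, smul_add]

theorem Dual.evalTensor_mul_scalar (a : A) (D : H.Dual) (x : Γ ⊗[A] M) :
    (D * Dual.scalar H a).evalTensor M x = D.evalTensor M (H.etaR a • x) := by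
  induction x using TensorProduct.induction_on with
  | zero => simp
  | tmul γ m =>
    rw [TensorProduct.smul_tmul', evalTensor_tmul, evalTensor_tmul, mul_scalar_apply, smul_eq_mul]
  | add x y hx hy => simp only [map_add, hx, hy, smul_add]

/-- The `A`-module structure is part of the action, so additive maps that commute with the dual
algebra are automatically `A`-linear. -/
theorem Comodule.actHom_scalar (M : H.Comodule) (a : A) (m : M.carrier) :
    M.actHom (Dual.scalar H a) m = a • m := by
  rw [actHom_eq_evalTensor, Dual.evalTensor_scalar, evalTensor_one, M.counit_coact]

end

/-! ### The tensor product `M ⊗ Γ` as a module through the right unit -/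

variable (H)

/-- The `A`-module `N ⊗_{A, η_L} Γ`, where `A` acts through the right unit. -/
def Cofree (_H : HopfAlgebroid A Γ) (N : Type u) [AddCommGroup N] [Module A N] : Type u :=
  Γ ⊗[A] N

variable (N : Type u) [AddCommGroup N] [Module A N]

instance : AddCommGroup (Cofree H N) := inferInstanceAs (AddCommGroup (Γ ⊗[A] N))

instance : Module Γ (Cofree H N) := inferInstanceAs (Module Γ (Γ ⊗[A] N))

instance : Module A (Cofree H N) := Module.compHom (Γ ⊗[A] N) H.etaR

namespace Cofree

/-- The identity map. -/
def of : Γ ⊗[A] N ≃+ Cofree H N := AddEquiv.refl _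

variable {H N}

theorem smul_of_tmul (a : A) (γ : Γ) (n : N) :
    a • of H N (γ ⊗ₜ n) = of H N ((H.etaR a * γ) ⊗ₜ n) := rfl

@[elab_as_elim]
theorem induction {motive : Cofree H N → Prop} (x : Cofree H N) (zero : motive 0)
    (tmul : ∀ γ n, motive (of H N (γ ⊗ₜ n)))
    (add : ∀ x y, motive x → motive y → motive (x + y)) : motive x :=
  TensorProduct.induction_on (motive := fun x => motive (of H N x)) x zero tmul add

variable (H N)

/-- The triadditive map `(γ, γ', n) ↦ γ' ⊗ (γ ⊗ n)`. -/
def splitBi : Γ →+ Γ →+ N →+ Γ ⊗[A] Cofree H N :=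
  AddMonoidHom.mk' (fun s => AddMonoidHom.mk' (fun t => AddMonoidHom.mk' (fun n =>
      t ⊗ₜ[A] of H N (s ⊗ₜ[A] n))
      (fun n n' => by rw [TensorProduct.tmul_add, map_add, TensorProduct.tmul_add]))
      (fun t t' => AddMonoidHom.ext fun n => TensorProduct.add_tmul t t' (of H N (s ⊗ₜ[A] n))))
      (fun s s' => AddMonoidHom.ext fun t => AddMonoidHom.ext fun n => by
        change t ⊗ₜ[A] of H N ((s + s') ⊗ₜ[A] n) =
          t ⊗ₜ[A] of H N (s ⊗ₜ[A] n) + t ⊗ₜ[A] of H N (s' ⊗ₜ[A] n)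
        rw [TensorProduct.add_tmul, map_add, TensorProduct.tmul_add])

theorem splitBi_apply (s t : Γ) (n : N) :
    splitBi H N s t n = t ⊗ₜ[A] of H N (s ⊗ₜ[A] n) := rfl

/-- The biadditive map underlying `split`. -/
def splitAdd : H.Two →+ N →+ Γ ⊗[A] Cofree H N :=
  RingTensor.liftAdd (splitBi H N) (fun a s t => AddMonoidHom.ext fun n => by
    rw [splitBi_apply, splitBi_apply, ← smul_of_tmul, ← Algebra.smul_def,
      TensorProduct.smul_tmul])

theorem splitAdd_mul (s t : Γ) (n : N) :
    splitAdd H N (H.inl s * H.inr t) n = t ⊗ₜ[A] of H N (s ⊗ₜ[A] n) :=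
  DFunLike.congr_fun (RingTensor.liftAdd_mul (splitBi H N) _ s t) n

theorem splitAdd_smul (a : A) (x : H.Two) (n : N) :
    splitAdd H N (a • x) n = splitAdd H N x (a • n) := by
  induction x using RingTensor.induction with
  | zero => rw [smul_zero, map_zero]; rfl
  | tmul s t =>
    have h : a • (H.inl s * H.inr t) = H.inl (a • s) * H.inr t := by
      rw [Algebra.smul_def, RingTensor.algebraMap_base, ← mul_assoc, ← map_mul,
        ← Algebra.smul_def]
    rw [h, splitAdd_mul, splitAdd_mul, TensorProduct.smul_tmul]
  | add x y hx hy =>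
    rw [smul_add, map_add, map_add, AddMonoidHom.add_apply, AddMonoidHom.add_apply, hx, hy]

/-- The map `N ⊗ Γ ⊗ Γ → (N ⊗ Γ) ⊗ Γ`. -/
def split : H.Two ⊗[A] N →+ Γ ⊗[A] Cofree H N :=
  TensorProduct.liftAddHom (splitAdd H N) (splitAdd_smul H N)

theorem split_tmul (s t : Γ) (n : N) :
    split H N ((H.inl s * H.inr t) ⊗ₜ n) = t ⊗ₜ of H N (s ⊗ₜ n) :=
  splitAdd_mul H N s t n

/-- The inverse of `split`. -/
def join : Γ ⊗[A] Cofree H N →+ H.Two ⊗[A] N :=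
  TensorProduct.liftAddHom
    (AddMonoidHom.mk' (fun γ =>
        (DistribSMul.toAddMonoidHom (H.Two ⊗[A] N) (H.inr γ)).comp
          ((H.inlAlg.toLinearMap.rTensor N).toAddMonoidHom.comp
            ((of H N).symm : Cofree H N →+ Γ ⊗[A] N)))
      (fun γ γ' => by ext m; simp [add_smul]))
    (fun a γ m => by
      change H.inr (a • γ) • H.inlAlg.toLinearMap.rTensor N ((of H N).symm m) =
        H.inr γ • H.inlAlg.toLinearMap.rTensor N (H.etaR a • (of H N).symm m)
      have h : H.inlAlg (H.etaR a) = H.inr (algebraMap A Γ a) := H.inl_etaR a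
      rw [rTensor_smul, smul_smul, h, ← map_mul, Algebra.smul_def, mul_comm])

/-- Injectivity of `split` is all that is used later, so this one composite suffices. -/
theorem join_split (x : H.Two ⊗[A] N) : join H N (split H N x) = x := by
  induction x using TensorProduct.induction_on with
  | zero => simp
  | tmul x n =>
    induction x using RingTensor.induction with
    | zero => simp
    | tmul s t =>
      rw [split_tmul]
      change H.inr t • (H.inl s ⊗ₜ[A] n) = _
      rw [TensorProduct.smul_tmul', smul_eq_mul, mul_comm]
    | add x y hx hy => simp only [TensorProduct.add_tmul, map_add, hx, hy]
  | add x y hx hy => simp only [map_add, hx, hy]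

theorem evalTensor_split (D : H.Dual) (x : H.Two ⊗[A] N) :
    D.evalTensor (Cofree H N) (split H N x) = of H N (Comodule.contractTwo D N x) := by
  induction x using TensorProduct.induction_on with
  | zero => simp
  | tmul x n =>
    rw [Comodule.contractTwo_tmul]
    induction x using RingTensor.induction with
    | zero => simp
    | tmul s t =>
      rw [split_tmul, Dual.evalTensor_tmul, smul_of_tmul, Dual.contract_tmul, mul_comm]
    | add x y hx hy => simp only [TensorProduct.add_tmul, map_add, hx, hy]
  | add x y hx hy => simp only [map_add, hx, hy]

end Cofree

variable {N H}

/-- Regrouping by `split` turns contraction of the last factor `Γ` into contraction on `(N ⊗ Γ) ⊗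
Γ`, where freeness separates elements. -/
theorem eq_of_contractTwo_eq [Module.Free A Γ] {x y : H.Two ⊗[A] N}
    (h : ∀ D : H.Dual, Comodule.contractTwo D N x = Comodule.contractTwo D N y) : x = y := by
  rw [← Cofree.join_split H N x, ← Cofree.join_split H N y]
  congr 1
  refine eq_of_evalTensor_eq H fun D => ?_
  rw [Cofree.evalTensor_split, Cofree.evalTensor_split, h]

end Contraction

/-! ### Comodules from actions of the dual algebra -/

section OfAction

variable {A Γ : Type u} [CommRing A] [CommRing Γ] [Algebra A Γ] {H : HopfAlgebroid A Γ}
  {M : Type u} [AddCommGroup M]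

theorem isOpen_zero_preimage (act : H.Dual →+* AddMonoid.End M)
    (hact : @Continuous H.Dual (AddMonoid.End M) _ (compactOpen (AddMonoid.End M) M M) act)
    (m : M) : IsOpen {D : H.Dual | act D m = 0} := by
  let _ : TopologicalSpace M := ⊥
  have : DiscreteTopology M := ⟨rfl⟩
  exact (isOpen_discrete {(0 : M)}).preimage ((continuous_compactOpen_iff act).1 hact m)

/-- For discrete `Γ` the compact-open topology is that of pointwise convergence, so a neighbourhood
of zero constrains only finitely many values. -/
theorem exists_finset_of_isOpen {U : Set H.Dual} (hU : IsOpen U) (h0 : (0 : H.Dual) ∈ U) :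
    ∃ s : Finset Γ, ∀ D : H.Dual, (∀ γ ∈ s, D γ = 0) → D ∈ U := by
  let _ : TopologicalSpace Γ := ⊥
  let _ : TopologicalSpace A := ⊥
  have : DiscreteTopology Γ := ⟨rfl⟩
  let e : H.Dual → C(Γ, A) := fun φ => ⟨φ, continuous_bot⟩
  have hi : Topology.IsInducing (fun (D : H.Dual) (γ : Γ) => D γ) :=
    (ContinuousMap.homeoFnOfDiscrete (X := Γ) (Y := A)).isInducing.comp
      (Topology.IsInducing.induced e)
  obtain ⟨V, hV, rfl⟩ := hi.isOpen_iff.1 hU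
  obtain ⟨s, v, hv, hs⟩ := isOpen_pi_iff.1 hV _ h0
  refine ⟨s, fun D hD => hs fun γ hγ => ?_⟩
  change D γ ∈ v γ
  rw [hD γ hγ]
  exact (hv γ hγ).2

variable [Module A M]

theorem coact_evalTensor (ψ : M →ₛₗ[H.etaR] Γ ⊗[A] M) (D : H.Dual) (x : Γ ⊗[A] M) :
    ψ (D.evalTensor M x) = Comodule.contractTwo D M (coactTwo ψ x) := by
  induction x using TensorProduct.induction_on with
  | zero => simp
  | tmul s m =>
    rw [coactTwo_tmul, Comodule.contractTwo_inr_smul, Dual.evalTensor_tmul, map_smulₛₗ]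
  | add x y hx hy => simp only [map_add, hx, hy]

theorem contractTwo_comul (D₂ D₁ : H.Dual) (x : Γ ⊗[A] M) :
    D₂.evalTensor M (Comodule.contractTwo D₁ M (H.comul.toLinearMap.rTensor M x)) =
      (D₂ * D₁).evalTensor M x :=
  congrArg (TensorProduct.lid A M) (Comodule.rTensor_contractTwo D₂ D₁ M x)

/-- Contracting the last factor with `D₁` and the remaining one with `D₂` turns the two sides of
coassociativity into the action of `D₂ * D₁` and the successive actions of `D₁` and `D₂`. These
contractions separate elements, so multiplicativity of the action is enough. -/
theorem coassoc_of_evalTensor [Module.Free A Γ] (ψ : M →ₛₗ[H.etaR] Γ ⊗[A] M)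
    (hψ : ∀ (D₂ D₁ : H.Dual) (m : M), (D₂ * D₁).evalTensor M (ψ m) =
      D₂.evalTensor M (ψ (D₁.evalTensor M (ψ m)))) (m : M) :
    H.comul.toLinearMap.rTensor M (ψ m) = coactTwo ψ (ψ m) := by
  refine eq_of_contractTwo_eq fun D₁ => eq_of_evalTensor_eq H fun D₂ => ?_
  rw [contractTwo_comul, ← coact_evalTensor, hψ]

/-- Continuity at `m` gives a finite `s` such that functionals vanishing on `s` kill `m`. On `s`,
each `D` agrees with its truncation to the finitely many basis vectors that occur in elements of
`s`; the action of the truncation on `m` is the contraction of a finite sum independent of `D`. -/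
theorem exists_evalTensor_eq [Module.Free A Γ] (act : H.Dual →+* AddMonoid.End M)
    (hact : @Continuous H.Dual (AddMonoid.End M) _ (compactOpen (AddMonoid.End M) M M) act)
    (hscalar : ∀ (a : A) (m : M), act (Dual.scalar H a) m = a • m) (m : M) :
    ∃ x : Γ ⊗[A] M, ∀ D : H.Dual, D.evalTensor M x = act D m := by
  classical
  let b := Module.Free.chooseBasis A Γ
  let c : Module.Free.ChooseBasisIndex A Γ → H.Dual := fun i => (b.coord i : Γ →ₗ[A] A)
  obtain ⟨s, hs⟩ := exists_finset_of_isOpen (isOpen_zero_preimage act hact m)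
    (by simp)
  let T := s.biUnion fun γ => (b.repr γ).support
  refine ⟨∑ i ∈ T, b i ⊗ₜ act (c i) m, fun D => ?_⟩
  -- Each `γ ∈ s` has its support in `T`, so the difference of `D` and its truncation vanishes on
  -- `s`.
  have h : act (D - ∑ i ∈ T, Dual.scalar H (D (b i)) * c i) m = 0 := by
    refine hs _ fun γ hγ => ?_
    have hsub : (b.repr γ).support ⊆ T := Finset.subset_biUnion_of_mem
      (fun γ => (b.repr γ).support) hγ
    have h1 : D γ = ∑ i ∈ T, D (b i) * b.repr γ i := by
      conv_lhs => rw [← b.linearCombination_repr γ, Finsupp.linearCombination_apply,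
        Finsupp.sum_of_support_subset _ hsub _ (by simp), map_sum]
      exact Finset.sum_congr rfl fun i _ => by rw [map_smul, smul_eq_mul, mul_comm]
    have h2 : (∑ i ∈ T, Dual.scalar H (D (b i)) * c i) γ = ∑ i ∈ T, D (b i) * b.repr γ i := by
      have hev : ∀ f : Module.Free.ChooseBasisIndex A Γ → H.Dual,
          (∑ i ∈ T, f i) γ = ∑ i ∈ T, f i γ := fun f =>
        map_sum (AddMonoidHom.mk' (fun E : H.Dual => E γ) fun _ _ => rfl) f T
      rw [hev]
      exact Finset.sum_congr rfl fun i _ => Dual.scalar_mul_apply _ _ _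
    have h3 : (D - ∑ i ∈ T, Dual.scalar H (D (b i)) * c i) γ =
      D γ - (∑ i ∈ T, Dual.scalar H (D (b i)) * c i) γ := rfl
    rw [h3, h1, h2, sub_self]
  have hev : ∀ f : Module.Free.ChooseBasisIndex A Γ → AddMonoid.End M,
      (∑ i ∈ T, f i) m = ∑ i ∈ T, f i m := fun f => AddMonoidHom.finsetSum_apply _ _ _
  rw [map_sub, map_sum] at h
  have h' := sub_eq_zero.1 (show act D m - (∑ i ∈ T, act (Dual.scalar H (D (b i)) * c i)) m = 0
    from h)
  rw [h', hev, map_sum]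
  refine Finset.sum_congr rfl fun i _ => ?_
  rw [Dual.evalTensor_tmul, map_mul, ← hscalar]
  rfl

variable (H) in
/-- The comodule determined by a continuous action of the dual algebra. -/
def comoduleOfAction [Module.Free A Γ] (act : H.Dual →+* AddMonoid.End M)
    (hact : @Continuous H.Dual (AddMonoid.End M) _ (compactOpen (AddMonoid.End M) M M) act)
    (hscalar : ∀ (a : A) (m : M), act (Dual.scalar H a) m = a • m) : H.Comodule :=
  have hx : ∀ m, ∀ D : H.Dual,
      D.evalTensor M (exists_evalTensor_eq act hact hscalar m).choose = act D m :=
    fun m => (exists_evalTensor_eq act hact hscalar m).choose_spec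
  -- The elements are chosen separately for each `m`; their uniqueness, by separation, makes the
  -- choice additive and semilinear.
  let ψ : M →ₛₗ[H.etaR] Γ ⊗[A] M :=
    { toFun := fun m => (exists_evalTensor_eq act hact hscalar m).choose
      map_add' := fun m m' => eq_of_evalTensor_eq H fun D => by
        rw [map_add, hx, hx, hx, map_add]
      map_smul' := fun a m => eq_of_evalTensor_eq H fun D => by
        rw [← Dual.evalTensor_mul_scalar, hx, hx, ← hscalar, map_mul]
        rfl }
  { carrier := M
    coact := ψ
    coassoc := coassoc_of_evalTensor ψ fun D₂ D₁ m => by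
      have h : D₁.evalTensor M (ψ m) = act D₁ m := hx m D₁
      rw [h]
      exact (hx m _).trans ((congrArg (fun e : AddMonoid.End M => e m)
        (map_mul act D₂ D₁)).trans (hx _ _).symm)
    counit_coact := fun m => (hx m 1).trans (by rw [map_one]; rfl) }

theorem comoduleOfAction_actHom [Module.Free A Γ] (act : H.Dual →+* AddMonoid.End M)
    (hact : @Continuous H.Dual (AddMonoid.End M) _ (compactOpen (AddMonoid.End M) M M) act)
    (hscalar : ∀ (a : A) (m : M), act (Dual.scalar H a) m = a • m) (D : H.Dual) (m : M) :
    (comoduleOfAction H act hact hscalar).actHom D m = act D m :=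
  (exists_evalTensor_eq act hact hscalar m).choose_spec D

/-- An additive map of comodules which commutes with the action of the dual algebra is a morphism
of comodules. -/
def Comodule.homOfAction [Module.Free A Γ] {M N : H.Comodule} (g : M.carrier →+ N.carrier)
    (hg : ∀ (D : H.Dual) m, g (M.actHom D m) = N.actHom D (g m)) : Comodule.Hom M N :=
  let g' : M.carrier →ₗ[A] N.carrier :=
    { toFun := g
      map_add' := map_add g
      map_smul' := fun a m => by
        rw [← M.actHom_scalar, hg, N.actHom_scalar]
        rfl }
  { hom := g'
    map_coact := fun m => eq_of_evalTensor_eq H fun D => by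
      rw [Dual.evalTensor_lTensor, ← Comodule.actHom_eq_evalTensor,
        ← Comodule.actHom_eq_evalTensor]
      exact (hg D m).symm }

instance toDiscrete_full [Module.Free A Γ] : H.toDiscrete.Full where
  map_surjective {M N} φ :=
    ⟨(Comodule.homOfAction (M := M) (N := N) φ.hom φ.map_act : Comodule.Hom M N), rfl⟩

instance toDiscrete_faithful : H.toDiscrete.Faithful where
  map_injective {M N} f g h := by
    refine Comodule.Hom.ext (LinearMap.ext fun m => ?_)
    exact DFunLike.congr_fun (congrArg DiscreteModule.Hom.hom h) m

instance toDiscrete_essSurj [Module.Free A Γ] : H.toDiscrete.EssSurj where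
  mem_essImage M := by
    -- The module structure is forced by `Comodule.actHom_scalar`: `a` must act as `a ε`.
    let _ : Module A M.carrier := Module.compHom M.carrier (M.act.comp (Dual.scalar H))
    let N := comoduleOfAction H M.act M.continuous_act (fun _ _ => rfl)
    have hN : ∀ D m, N.actHom D m = M.act D m :=
      comoduleOfAction_actHom M.act M.continuous_act (fun _ _ => rfl)
    exact ⟨N, ⟨{
      hom := ⟨AddMonoidHom.id M.carrier, hN⟩
      inv := ⟨AddMonoidHom.id M.carrier, fun D m => (hN D m).symm⟩
      hom_inv_id := rfl
      inv_hom_id := rfl }⟩⟩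

/-- Comodules over a free Hopf algebroid are the discrete modules over the dual algebra. -/
theorem toDiscrete_isEquivalence [Module.Free A Γ] : H.toDiscrete.IsEquivalence where

end OfAction

/-! ### Cofree comodules -/

section CofreeComodule

variable {A Γ : Type u} [CommRing A] [CommRing Γ] [Algebra A Γ] {H : HopfAlgebroid A Γ}
  {N : Type u} [AddCommGroup N] [Module A N]

theorem lTensor_smul_left {C M : Type u} [CommRing C] [Algebra A C] [AddCommGroup M] [Module A M]
    (g : M →ₗ[A] N) (c : C) (x : C ⊗[A] M) : g.lTensor C (c • x) = c • g.lTensor C x := by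
  induction x using TensorProduct.induction_on with
  | zero => simp
  | tmul s m => simp [TensorProduct.smul_tmul']
  | add x y hx hy => simp only [smul_add, map_add, hx, hy]

theorem Cofree.split_inr_smul (γ : Γ) (x : H.Two ⊗[A] N) :
    split H N (H.inr γ • x) = γ • split H N x := by
  induction x using TensorProduct.induction_on with
  | zero => simp
  | tmul x n =>
    induction x using RingTensor.induction with
    | zero => simp
    | tmul s t =>
      rw [TensorProduct.smul_tmul', smul_eq_mul, mul_left_comm, ← map_mul, split_tmul, split_tmul,
        TensorProduct.smul_tmul', smul_eq_mul]
    | add x y hx hy => simp only [TensorProduct.add_tmul, smul_add, map_add, hx, hy]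
  | add x y hx hy => simp only [smul_add, map_add, hx, hy]

theorem contractTwo_comul_one (x : Γ ⊗[A] N) :
    Comodule.contractTwo (1 : H.Dual) N (H.comul.toLinearMap.rTensor N x) = x := by
  induction x using TensorProduct.induction_on with
  | zero => simp
  | tmul γ n => exact congrArg (· ⊗ₜ[A] n) (Dual.contract_comul_one γ)
  | add x y hx hy => simp only [map_add, hx, hy]

/-- The action of the dual algebra on `Γ`, extended to `N ⊗ Γ`. Through `coassoc_of_evalTensor` it
yields coassociativity of the cofree comodule. -/
theorem contractTwo_comul_mul (D₂ D₁ : H.Dual) (x : Γ ⊗[A] N) :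
    Comodule.contractTwo (D₂ * D₁) N (H.comul.toLinearMap.rTensor N x) =
      Comodule.contractTwo D₂ N (H.comul.toLinearMap.rTensor N
        (Comodule.contractTwo D₁ N (H.comul.toLinearMap.rTensor N x))) := by
  induction x using TensorProduct.induction_on with
  | zero => simp
  | tmul γ n => exact congrArg (· ⊗ₜ[A] n) (Dual.contract_comul_contract D₂ D₁ γ).symm
  | add x y hx hy => simp only [map_add, hx, hy]

theorem contractTwo_comul_lTensor {M : Type u} [AddCommGroup M] [Module A M] (D : H.Dual)
    (g : M →ₗ[A] N) (x : Γ ⊗[A] M) :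
    Comodule.contractTwo D N (H.comul.toLinearMap.rTensor N (g.lTensor Γ x)) =
      g.lTensor Γ (Comodule.contractTwo D M (H.comul.toLinearMap.rTensor M x)) := by
  induction x using TensorProduct.induction_on with
  | zero => simp
  | tmul γ n => rfl
  | add x y hx hy => simp only [map_add, hx, hy]

variable (H N)

/-- The coaction on `N ⊗ Γ` induced by the comultiplication. -/
def Cofree.coact : Cofree H N →ₛₗ[H.etaR] Γ ⊗[A] Cofree H N where
  toFun w := split H N (H.comul.toLinearMap.rTensor N ((of H N).symm w))
  map_add' x y := by simp only [map_add]
  map_smul' a w := by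
    change split H N (H.comul.toLinearMap.rTensor N (H.etaR a • (of H N).symm w)) = _
    rw [rTensor_smul, H.comul_etaR]
    exact split_inr_smul _ _

theorem Cofree.coact_of (x : Γ ⊗[A] N) :
    coact H N (of H N x) = split H N (H.comul.toLinearMap.rTensor N x) := rfl

theorem Cofree.evalTensor_coact (D : H.Dual) (x : Γ ⊗[A] N) :
    D.evalTensor (Cofree H N) (coact H N (of H N x)) =
      of H N (Comodule.contractTwo D N (H.comul.toLinearMap.rTensor N x)) :=
  evalTensor_split H N D _

/-- The cofree comodule on an `A`-module `N`. -/
def cofree [Module.Free A Γ] : H.Comodule where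
  carrier := Cofree H N
  coact := Cofree.coact H N
  coassoc := coassoc_of_evalTensor _ fun D₂ D₁ w => by
    refine (Cofree.evalTensor_coact H N _ ((Cofree.of H N).symm w)).trans ?_
    rw [contractTwo_comul_mul]
    refine Eq.trans ?_ (congrArg (fun z => D₂.evalTensor (Cofree H N) (Cofree.coact H N z))
      (Cofree.evalTensor_coact H N D₁ ((Cofree.of H N).symm w)).symm)
    exact (Cofree.evalTensor_coact H N D₂ _).symm
  counit_coact w :=
    (Cofree.evalTensor_coact H N 1 ((Cofree.of H N).symm w)).trans
      (congrArg (Cofree.of H N) (contractTwo_comul_one _))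

/-- The map `N ⊗ Γ → N` induced by the counit. -/
def Cofree.counit : Cofree H N →ₗ[A] N where
  toFun w := (1 : H.Dual).evalTensor N ((of H N).symm w)
  map_add' x y := by simp only [map_add]
  map_smul' a w := by
    change (1 : H.Dual).evalTensor N (H.etaR a • (of H N).symm w) = _
    rw [← Dual.evalTensor_mul_scalar, one_mul, Dual.evalTensor_scalar]
    rfl

variable {N}

theorem Cofree.counit_of_tmul (γ : Γ) (n : N) :
    counit H N (of H N (γ ⊗ₜ n)) = H.counit γ • n := rfl

variable {H}

/-- The coaction of a comodule, as a linear map to the cofree comodule. -/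
def Comodule.coactLin (M : H.Comodule) : M.carrier →ₗ[A] Cofree H M.carrier where
  toFun m := Cofree.of H M.carrier (M.coact m)
  map_add' x y := by simp only [map_add]
  map_smul' a m := congrArg (Cofree.of H M.carrier) (map_smulₛₗ M.coact a m)

theorem Comodule.coactLin_apply (M : H.Comodule) (m : M.carrier) :
    M.coactLin m = Cofree.of H M.carrier (M.coact m) := rfl

theorem Cofree.counit_coactLin (M : H.Comodule) (m : M.carrier) :
    counit H M.carrier (M.coactLin m) = m :=
  M.counit_coact m

/-- The map of cofree comodules induced by a linear map. -/
def Cofree.map {M : Type u} [AddCommGroup M] [Module A M] (g : M →ₗ[A] N) :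
    Cofree H M →ₗ[A] Cofree H N where
  toFun w := of H N (g.lTensor Γ ((of H M).symm w))
  map_add' x y := by simp only [map_add]
  map_smul' a w := congrArg (of H N) (lTensor_smul_left g (H.etaR a) ((of H M).symm w))

theorem Cofree.counit_map {M : Type u} [AddCommGroup M] [Module A M] (g : M →ₗ[A] N)
    (x : Cofree H M) : counit H N (map g x) = g (counit H M x) :=
  Dual.evalTensor_lTensor 1 g ((of H M).symm x)

/-- The morphism to a cofree comodule determined by a linear map. -/
def toCofree [Module.Free A Γ] (M : H.Comodule) (g : M.carrier →ₗ[A] N) :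
    Comodule.Hom M (cofree H N) where
  hom := Cofree.map g ∘ₗ M.coactLin
  map_coact m := eq_of_evalTensor_eq H fun D => by
    rw [Dual.evalTensor_lTensor]
    refine (Cofree.evalTensor_coact H N D _).trans ?_
    change _ = Cofree.of H N (g.lTensor Γ (M.coact (D.evalTensor M.carrier (M.coact m))))
    -- By coassociativity the coaction of `M` is a morphism to the cofree comodule on `M`, and `g ⊗
    -- id` commutes with the comultiplication of `Γ`.
    rw [coact_evalTensor, ← M.coassoc, ← contractTwo_comul_lTensor]
    rfl

theorem counit_toCofree [Module.Free A Γ] (M : H.Comodule) (g : M.carrier →ₗ[A] N)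
    (m : M.carrier) : Cofree.counit H N ((toCofree M g).hom m) = g m :=
  (Cofree.counit_map g (M.coactLin m)).trans (congrArg g (Cofree.counit_coactLin M m))

end CofreeComodule

/-! ### Kernels and isomorphisms of comodules -/

section Kernel

variable {A Γ : Type u} [CommRing A] [CommRing Γ] [Algebra A Γ] {H : HopfAlgebroid A Γ}

/-- The action of the dual algebra on the kernel of a morphism of comodules. -/
def Comodule.Hom.kerAct {M N : H.Comodule} (h : Comodule.Hom M N) :
    H.Dual →+* AddMonoid.End (LinearMap.ker h.hom) where
  toFun D := AddMonoidHom.mk' (fun x => ⟨M.actHom D x, by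
      rw [LinearMap.mem_ker, h.map_actHom, LinearMap.mem_ker.1 x.2, map_zero]⟩)
    (fun x y => Subtype.ext (map_add (M.actHom D) (x : M.carrier) y))
  map_one' := AddMonoidHom.ext fun x => Subtype.ext (DFunLike.congr_fun
    (map_one M.toDiscreteModule.act) (x : M.carrier))
  map_mul' D E := AddMonoidHom.ext fun x => Subtype.ext (DFunLike.congr_fun
    (map_mul M.toDiscreteModule.act D E) (x : M.carrier))
  map_zero' := AddMonoidHom.ext fun x => Subtype.ext (DFunLike.congr_fun
    (map_zero M.toDiscreteModule.act) (x : M.carrier))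
  map_add' D E := AddMonoidHom.ext fun x => Subtype.ext (DFunLike.congr_fun
    (map_add M.toDiscreteModule.act D E) (x : M.carrier))

theorem Comodule.Hom.kerAct_continuous {M N : H.Comodule} (h : Comodule.Hom M N) :
    @Continuous H.Dual (AddMonoid.End (LinearMap.ker h.hom)) _
      (compactOpen (AddMonoid.End (LinearMap.ker h.hom)) (LinearMap.ker h.hom)
        (LinearMap.ker h.hom)) h.kerAct := by
  rw [continuous_compactOpen_iff]
  intro x
  let _ : TopologicalSpace M.carrier := ⊥
  have : DiscreteTopology M.carrier := ⟨rfl⟩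
  -- The discrete topology on the kernel is induced from discrete `M`, so continuity is inherited
  -- from the action on `M`.
  have hbot : (⊥ : TopologicalSpace (LinearMap.ker h.hom)) = instTopologicalSpaceSubtype :=
    (inferInstance : DiscreteTopology (LinearMap.ker h.hom)).eq_bot.symm
  rw [hbot, continuous_induced_rng]
  exact (continuous_compactOpen_iff _).1 M.actHom_continuous x

/-- Morphisms of comodules over a free Hopf algebroid have kernels, formed in modules. -/
theorem Comodule.Hom.exists_kernel [Module.Free A Γ] {M N : H.Comodule} (h : Comodule.Hom M N) :
    ∃ (K : H.Comodule) (i : Comodule.Hom K M), Function.Injective i.hom ∧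
      Function.Exact i.hom h.hom := by
  -- The kernel is stable under the action of the dual algebra, and a continuous action is a
  -- coaction; no lift of the coaction along an inclusion of tensor products is needed.
  let K := comoduleOfAction H h.kerAct h.kerAct_continuous
    (fun a x => Subtype.ext (M.actHom_scalar a x))
  refine ⟨K, { hom := (LinearMap.ker h.hom).subtype, map_coact := fun m => ?_ },
    Subtype.val_injective, fun x => ⟨fun hx => ⟨⟨x, hx⟩, rfl⟩, ?_⟩⟩
  · refine eq_of_evalTensor_eq H fun D => Eq.trans ?_
      (Dual.evalTensor_lTensor D (LinearMap.ker h.hom).subtype (K.coact m)).symm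
    exact (congrArg Subtype.val (comoduleOfAction_actHom h.kerAct h.kerAct_continuous
      (fun a x => Subtype.ext (M.actHom_scalar a x)) D m)).symm
  · rintro ⟨y, rfl⟩
    exact y.2

/-- A bijective morphism of comodules is an isomorphism. -/
def Comodule.isoOfBijective {M N : H.Comodule} (h : Comodule.Hom M N)
    (hb : Function.Bijective h.hom) : M ≅ N :=
  let e := LinearEquiv.ofBijective h.hom hb
  { hom := h
    inv :=
      { hom := e.symm.toLinearMap
        map_coact := fun n => by
          obtain ⟨m, rfl⟩ := e.surjective n
          have h1 : N.coact (e m) = h.hom.lTensor Γ (M.coact m) := h.map_coact m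
          rw [h1, ← LinearMap.lTensor_comp_apply]
          have h2 : e.symm.toLinearMap ∘ₗ h.hom = LinearMap.id :=
            LinearMap.ext fun m => e.symm_apply_apply m
          rw [h2, LinearMap.lTensor_id]
          exact congrArg M.coact (e.symm_apply_apply m) }
    hom_inv_id := Comodule.Hom.ext (LinearMap.ext fun m => e.symm_apply_apply m)
    inv_hom_id := Comodule.Hom.ext (LinearMap.ext fun m => e.apply_symm_apply m) }

end Kernel

/-! ### Comparison of the base changes of a comodule along the two units -/

section Twist

variable {A Γ : Type u} [CommRing A] [CommRing Γ] [Algebra A Γ] {H : HopfAlgebroid A Γ}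

theorem rTensor_coactTwo_tmul {C M : Type u} [CommRing C] [Algebra A C] [AddCommGroup M]
    [Module A M] (θ : H.Two →ₐ[A] C) (ψ : M →ₛₗ[H.etaR] Γ ⊗[A] M) (γ : Γ) (m : M) :
    θ.toLinearMap.rTensor M (coactTwo ψ (γ ⊗ₜ m)) =
      θ (H.inr γ) • (θ.comp H.inlAlg).toLinearMap.rTensor M (ψ m) := by
  rw [coactTwo_tmul, rTensor_smul, AlgHom.comp_toLinearMap, LinearMap.rTensor_comp_apply]

variable {C C' : Type u} [CommRing C] [Algebra A C] [CommRing C'] [Algebra A C']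

/-- For a homomorphism `φ : Γ → C'` through which the coaction of a comodule `M` takes values in
`M ⊗_A C'`, and a homomorphism `σ : C → C'` with `σ(a) = φ(η_R(a))`, the map
`M ⊗_A C → M ⊗_A C'`, `m ⊗ c ↦ σ(c) φ(ψ(m))`. -/
def twist (σ : C →+* C') (φ : Γ →ₐ[A] C') (h : ∀ a, σ (algebraMap A C a) = φ (H.etaR a))
    (M : H.Comodule) : C ⊗[A] M.carrier →+ C' ⊗[A] M.carrier :=
  TensorProduct.liftAddHom
    (AddMonoidHom.mk' (fun c =>
        (DistribSMul.toAddMonoidHom (C' ⊗[A] M.carrier) (σ c)).comp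
          ((φ.toLinearMap.rTensor M.carrier).toAddMonoidHom.comp M.coact.toAddMonoidHom))
      (fun c c' => by ext m; simp [add_smul]))
    (fun a c m => by
      change σ (a • c) • φ.toLinearMap.rTensor M.carrier (M.coact m) =
        σ c • φ.toLinearMap.rTensor M.carrier (M.coact (a • m))
      rw [map_smulₛₗ M.coact, rTensor_smul, smul_smul, ← h, ← map_mul, Algebra.smul_def,
        mul_comm])

variable (σ : C →+* C') (φ : Γ →ₐ[A] C') (h : ∀ a, σ (algebraMap A C a) = φ (H.etaR a))

theorem twist_tmul (M : H.Comodule) (c : C) (m : M.carrier) : twist σ φ h M (c ⊗ₜ m) =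
    σ c • φ.toLinearMap.rTensor M.carrier (M.coact m) := rfl

theorem twist_smul (M : H.Comodule) (c : C) (x : C ⊗[A] M.carrier) :
    twist σ φ h M (c • x) = σ c • twist σ φ h M x := by
  induction x using TensorProduct.induction_on with
  | zero => simp
  | tmul s m =>
    rw [TensorProduct.smul_tmul', twist_tmul, twist_tmul, smul_eq_mul, map_mul, mul_smul]
  | add x y hx hy => simp only [smul_add, map_add, hx, hy]

theorem twist_lTensor {M N : H.Comodule} (g : Comodule.Hom M N) (x : C ⊗[A] M.carrier) :
    twist σ φ h N (g.hom.lTensor C x) = g.hom.lTensor C' (twist σ φ h M x) := by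
  induction x using TensorProduct.induction_on with
  | zero => simp
  | tmul s m =>
    rw [LinearMap.lTensor_tmul, twist_tmul, twist_tmul, lTensor_smul_left, g.map_coact,
      ← LinearMap.comp_apply, ← LinearMap.comp_apply, LinearMap.rTensor_comp_lTensor,
      LinearMap.lTensor_comp_rTensor]
  | add x y hx hy => simp only [map_add, hx, hy]

/-- In groupoid terms, `χ` and `τ ∘ φ` are composable arrows whose composite is an identity, and `θ`
is the composable pair. The double twist of `m` is `θ` applied to the twice iterated coaction;
coassociativity rewrites this as `θ ∘ Δ` applied to the coaction, which the counit law collapses. -/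
theorem twist_twist (τ : C' →+* C) (χ : Γ →ₐ[A] C)
    (h' : ∀ a, τ (algebraMap A C' a) = χ (H.etaR a)) (hτ : ∀ c, τ (σ c) = c)
    (θ : H.Two →ₐ[A] C) (hl : ∀ γ, θ (H.inl γ) = χ γ) (hr : ∀ γ, θ (H.inr γ) = τ (φ γ))
    (hθ : ∀ γ, θ (H.comul γ) = algebraMap A C (H.counit γ)) (M : H.Comodule)
    (x : C ⊗[A] M.carrier) : twist τ χ h' M (twist σ φ h M x) = x := by
  have hl' : θ.comp H.inlAlg = χ := AlgHom.ext hl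
  have h1 : ∀ y : Γ ⊗[A] M.carrier, twist τ χ h' M (φ.toLinearMap.rTensor M.carrier y) =
      θ.toLinearMap.rTensor M.carrier (coactTwo M.coact y) := by
    intro y
    induction y using TensorProduct.induction_on with
    | zero => simp
    | tmul γ m =>
      rw [rTensor_coactTwo_tmul, hl', hr]
      rfl
    | add x y hx hy => simp only [map_add, hx, hy]
  have h2 : ∀ y : Γ ⊗[A] M.carrier,
      θ.toLinearMap.rTensor M.carrier (H.comul.toLinearMap.rTensor M.carrier y) =
        (1 : C) ⊗ₜ TensorProduct.lid A M.carrier (H.counit.toLinearMap.rTensor M.carrier y) := by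
    intro y
    induction y using TensorProduct.induction_on with
    | zero => simp
    | tmul γ m =>
      rw [LinearMap.rTensor_tmul, LinearMap.rTensor_tmul, LinearMap.rTensor_tmul,
        TensorProduct.lid_tmul, AlgHom.toLinearMap_apply, AlgHom.toLinearMap_apply, hθ,
        Algebra.algebraMap_eq_smul_one, TensorProduct.smul_tmul]
      rfl
    | add x y hx hy => simp only [map_add, hx, hy, TensorProduct.tmul_add]
  induction x using TensorProduct.induction_on with
  | zero => simp
  | tmul c m =>
    rw [twist_tmul, twist_smul, h1, ← M.coassoc, h2, M.counit_coact, hτ,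
      TensorProduct.smul_tmul', smul_eq_mul, mul_one]
  | add x y hx hy => simp only [map_add, hx, hy]

variable (H) (C : Type u) [CommRing C] [Algebra Γ C] [Algebra A C] [IsScalarTower A Γ C]

/-- A `Γ`-algebra `C`, regarded as an `A`-algebra through the right unit. -/
abbrev ViaRight : Type u := Along ((algebraMap Γ C).comp H.etaR)

/-- The isomorphism between the base changes of a comodule to a `Γ`-algebra along the right and the
left unit. -/
def twistEquiv (M : H.Comodule) : H.ViaRight C ⊗[A] M.carrier ≃+ C ⊗[A] M.carrier :=
  let p := (algebraMap Γ C).comp H.etaR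
  let σ : H.ViaRight C →+* C := (Along.of p).symm
  let τ : C →+* H.ViaRight C := Along.of p
  let φ : Γ →ₐ[A] C := IsScalarTower.toAlgHom A Γ C
  let χ : Γ →ₐ[A] H.ViaRight C := AlgHom.mk (τ.comp ((algebraMap Γ C).comp H.conj))
    (fun a => congrArg (fun γ => τ (algebraMap Γ C γ)) (H.conj_etaL a))
  have h : ∀ a, σ (algebraMap A (H.ViaRight C) a) = φ (H.etaR a) := fun a => rfl
  have h' : ∀ a, τ (algebraMap A C a) = χ (H.etaR a) := fun a => by
    rw [IsScalarTower.algebraMap_apply A Γ C]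
    exact (congrArg (fun γ => τ (algebraMap Γ C γ)) (H.conj_etaR a)).symm
  { twist σ φ h M with
    invFun := twist τ χ h' M
    -- The inverse twists by the conjugation. The two round trips are the two inverse laws of the
    -- groupoid, applied to the arrow given by the structure map `Γ → C`.
    left_inv := by
      let θ₀ : H.Two →+* C := RingTensor.lift ((algebraMap Γ C).comp H.conj) (algebraMap Γ C)
        (H.inv_left_composable (algebraMap Γ C))
      let θ : H.Two →ₐ[A] H.ViaRight C := AlgHom.mk (τ.comp θ₀) (fun a => by
        change τ (θ₀ (H.inl (algebraMap A Γ a))) = τ (algebraMap Γ C (H.etaR a))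
        rw [RingTensor.lift_inl, RingHom.comp_apply, H.conj_etaL])
      exact twist_twist σ φ h τ χ h' (fun _ => rfl) θ
        (fun γ => congrArg τ (RingTensor.lift_inl _ _ _ γ))
        (fun γ => congrArg τ (RingTensor.lift_inr _ _ _ γ))
        (fun γ => congrArg τ (RingHom.congr_fun (H.inv_comp C (algebraMap Γ C)) γ)) M
    right_inv := by
      let θ₀ : H.Two →+* C := RingTensor.lift (algebraMap Γ C) ((algebraMap Γ C).comp H.conj)
        (H.inv_right_composable (algebraMap Γ C))
      let θ : H.Two →ₐ[A] C := AlgHom.mk θ₀ (fun a => by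
        change θ₀ (H.inl (algebraMap A Γ a)) = _
        rw [RingTensor.lift_inl, ← IsScalarTower.algebraMap_apply])
      exact twist_twist τ χ h' σ φ h (fun _ => rfl) θ
        (fun γ => RingTensor.lift_inl _ _ (H.inv_right_composable (algebraMap Γ C)) γ)
        (fun γ => RingTensor.lift_inr _ _ (H.inv_right_composable (algebraMap Γ C)) γ)
        (fun γ => (RingHom.congr_fun (H.comp_inv C (algebraMap Γ C)) γ).trans
          (IsScalarTower.algebraMap_apply A Γ C _).symm) M }

variable {H}

theorem twistEquiv_lTensor {M N : H.Comodule} (g : Comodule.Hom M N)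
    (x : H.ViaRight C ⊗[A] M.carrier) :
    twistEquiv H C N (g.hom.lTensor (H.ViaRight C) x) =
      g.hom.lTensor C (twistEquiv H C M x) :=
  twist_lTensor _ _ (fun _ => rfl) g x

/-- `twistEquiv` is natural for morphisms of comodules, so it is an isomorphism between the two
sequences. This lets flatness along the left unit be used for base change along the right unit. -/
theorem exact_lTensor_viaRight_iff {M N Q : H.Comodule} (g : Comodule.Hom M N)
    (h : Comodule.Hom N Q) :
    Function.Exact (g.hom.lTensor (H.ViaRight C)) (h.hom.lTensor (H.ViaRight C)) ↔
      Function.Exact (g.hom.lTensor C) (h.hom.lTensor C) := by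
  have hg := twistEquiv_lTensor C g
  have hh := twistEquiv_lTensor C h
  constructor
  · intro e y
    obtain ⟨x, rfl⟩ := (twistEquiv H C N).surjective y
    rw [← hh, EmbeddingLike.map_eq_zero_iff, e x]
    constructor
    · rintro ⟨z, rfl⟩; exact ⟨_, (hg z).symm⟩
    · rintro ⟨z, hz⟩
      obtain ⟨z, rfl⟩ := (twistEquiv H C M).surjective z
      rw [← hg] at hz
      exact ⟨z, (twistEquiv H C N).injective hz⟩
  · intro e x
    rw [← EmbeddingLike.map_eq_zero_iff (f := twistEquiv H C Q), hh, e]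
    constructor
    · rintro ⟨z, hz⟩
      obtain ⟨z, rfl⟩ := (twistEquiv H C M).surjective z
      rw [← hg] at hz
      exact ⟨z, (twistEquiv H C N).injective hz⟩
    · rintro ⟨z, rfl⟩; exact ⟨_, (hg z).symm⟩

theorem injective_lTensor_viaRight_iff {M N : H.Comodule} (g : Comodule.Hom M N) :
    Function.Injective (g.hom.lTensor (H.ViaRight C)) ↔
      Function.Injective (g.hom.lTensor C) := by
  have hg : g.hom.lTensor C ∘ twistEquiv H C M =
      twistEquiv H C N ∘ g.hom.lTensor (H.ViaRight C) :=
    funext fun x => (twistEquiv_lTensor C g x).symm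
  rw [← EquivLike.injective_comp (twistEquiv H C M), hg, EquivLike.comp_injective]

end Twist

/-! ### Exactness of the pullback along `(f_o, ι)` -/

section Exactness

/-! ### Exactness of base change: retracts and split sequences. -/

section Modules

variable {A B C : Type u} [CommRing A] [CommRing B] [CommRing C] [Algebra A B] [Algebra A C]
  {M N Q : Type u} [AddCommGroup M] [Module A M] [AddCommGroup N] [Module A N]
  [AddCommGroup Q] [Module A Q] (g : M →ₗ[A] N) (h : N →ₗ[A] Q)

theorem rTensor_lTensor_comm (r : B →ₗ[A] C) (x : B ⊗[A] M) :
    r.rTensor N (g.lTensor B x) = g.lTensor C (r.rTensor M x) := by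
  rw [← LinearMap.comp_apply, ← LinearMap.comp_apply, LinearMap.rTensor_comp_lTensor,
    LinearMap.lTensor_comp_rTensor]

theorem rTensor_of_leftInverse (r : B →ₗ[A] C) (s : C →ₗ[A] B) (hs : s ∘ₗ r = LinearMap.id)
    (x : B ⊗[A] M) : s.rTensor M (r.rTensor M x) = x := by
  rw [← LinearMap.rTensor_comp_apply, hs, LinearMap.rTensor_id, LinearMap.id_apply]

/-- The sequence with coefficients `B` is a retract of the one with coefficients `C`, by naturality
in the coefficients. -/
theorem exact_lTensor_of_retract (r : B →ₗ[A] C) (s : C →ₗ[A] B) (hs : s ∘ₗ r = LinearMap.id)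
    (e : Function.Exact (g.lTensor C) (h.lTensor C)) :
    Function.Exact (g.lTensor B) (h.lTensor B) := by
  intro x
  constructor
  · intro hx
    obtain ⟨y, hy⟩ := (e (r.rTensor N x)).1 (by rw [← rTensor_lTensor_comm, hx, map_zero])
    exact ⟨s.rTensor M y, by
      rw [← rTensor_lTensor_comm, hy, rTensor_of_leftInverse r s hs]⟩
  · rintro ⟨y, rfl⟩
    rw [← rTensor_of_leftInverse r s hs (h.lTensor B _), rTensor_lTensor_comm h,
      rTensor_lTensor_comm g, (e _).2 ⟨_, rfl⟩, map_zero]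

theorem injective_lTensor_of_retract (r : B →ₗ[A] C) (s : C →ₗ[A] B)
    (hs : s ∘ₗ r = LinearMap.id) (e : Function.Injective (g.lTensor C)) :
    Function.Injective (g.lTensor B) := by
  intro x y hxy
  rw [← rTensor_of_leftInverse r s hs x, ← rTensor_of_leftInverse r s hs y]
  congr 1
  refine e ?_
  rw [← rTensor_lTensor_comm, ← rTensor_lTensor_comm, hxy]

variable [Algebra B C] [IsScalarTower A B C]

theorem cancelBaseChange_lTensor (x : C ⊗[B] (B ⊗[A] M)) :
    TensorProduct.AlgebraTensorModule.cancelBaseChange A B B C N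
        ((g.baseChange B).lTensor C x) =
      g.lTensor C (TensorProduct.AlgebraTensorModule.cancelBaseChange A B B C M x) := by
  induction x using TensorProduct.induction_on with
  | zero => simp
  | tmul c y =>
    induction y using TensorProduct.induction_on with
    | zero => simp
    | tmul b m => simp
    | add x y hx hy => simp only [TensorProduct.tmul_add, map_add, hx, hy]
  | add x y hx hy => simp only [map_add, hx, hy]

/-- A `B`-linear splitting survives every further base change `B → C`, without flatness, and `C ⊗_B
(B ⊗_A M)` is `C ⊗_A M`. -/
theorem exact_lTensor_of_split (hgh : h ∘ₗ g = 0) (s : B ⊗[A] N →ₗ[B] B ⊗[A] M)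
    (t : B ⊗[A] Q →ₗ[B] B ⊗[A] N)
    (hst : ∀ x, g.baseChange B (s x) + t (h.baseChange B x) = x) :
    Function.Exact (g.lTensor C) (h.lTensor C) := by
  intro x
  constructor
  · intro hx
    obtain ⟨y, rfl⟩ :=
      (TensorProduct.AlgebraTensorModule.cancelBaseChange A B B C N).surjective x
    rw [← cancelBaseChange_lTensor, EmbeddingLike.map_eq_zero_iff] at hx
    refine ⟨TensorProduct.AlgebraTensorModule.cancelBaseChange A B B C M (s.lTensor C y), ?_⟩
    rw [← cancelBaseChange_lTensor]
    congr 1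
    have key : (g.baseChange B).lTensor C (s.lTensor C y) +
        t.lTensor C ((h.baseChange B).lTensor C y) = y := by
      rw [← LinearMap.lTensor_comp_apply, ← LinearMap.lTensor_comp_apply,
        ← LinearMap.add_apply, ← LinearMap.lTensor_add]
      have : g.baseChange B ∘ₗ s + t ∘ₗ h.baseChange B = LinearMap.id := LinearMap.ext hst
      rw [this, LinearMap.lTensor_id, LinearMap.id_apply]
    rw [hx, map_zero, add_zero] at key
    exact key
  · rintro ⟨y, rfl⟩
    rw [← LinearMap.lTensor_comp_apply, hgh, LinearMap.lTensor_zero, LinearMap.zero_apply]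

theorem injective_lTensor_of_split (s : B ⊗[A] N →ₗ[B] B ⊗[A] M)
    (hs : ∀ x, s (g.baseChange B x) = x) : Function.Injective (g.lTensor C) := by
  have h1 : Function.Injective ((g.baseChange B).lTensor C) := by
    refine Function.LeftInverse.injective (g := s.lTensor C) fun x => ?_
    rw [← LinearMap.lTensor_comp_apply]
    have : s ∘ₗ g.baseChange B = LinearMap.id := LinearMap.ext hs
    rw [this, LinearMap.lTensor_id, LinearMap.id_apply]
  rw [← EquivLike.injective_comp (TensorProduct.AlgebraTensorModule.cancelBaseChange A B B C M)]
  have h2 : g.lTensor C ∘ TensorProduct.AlgebraTensorModule.cancelBaseChange A B B C M =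
      TensorProduct.AlgebraTensorModule.cancelBaseChange A B B C N ∘
        (g.baseChange B).lTensor C := funext fun x => (cancelBaseChange_lTensor g x).symm
  rw [h2]
  exact (TensorProduct.AlgebraTensorModule.cancelBaseChange A B B C N).injective.comp h1

end Modules

variable {A Γ : Type u} [CommRing A] [CommRing Γ] [Algebra A Γ] {H : HopfAlgebroid A Γ}
  {B : Type u} [CommRing B] [Algebra A B]

instance : IsScalarTower A Γ (H.RightExt B) := IsScalarTower.of_algebraMap_eq fun _ => rfl

variable (H B)

/-- The inclusion of `B` in `Γ ⊗_{η_R, A, f_o} B`. -/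
def RightExt.incl : B →ₐ[A] H.ViaRight (H.RightExt B) :=
  let p := (algebraMap Γ (H.RightExt B)).comp H.etaR
  AlgHom.mk ((Along.of p : H.RightExt B →+* Along p).comp
    (RingTensor.inr H.etaR (algebraMap A B)))
    (fun a => (RingTensor.inl_eq_inr H.etaR (algebraMap A B) a).symm)

/-- The retraction of `Γ ⊗_{η_R, A, f_o} B` to `B` induced by the counit. -/
def RightExt.counitHom : H.RightExt B →+* B :=
  RingTensor.lift ((algebraMap A B).comp (H.counit : Γ →+* A)) (RingHom.id B)
    (by ext a; simp [H.counit_etaR])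

theorem RightExt.counitHom_inl (γ : Γ) :
    counitHom H B (RingTensor.inl H.etaR (algebraMap A B) γ) = algebraMap A B (H.counit γ) :=
  RingTensor.lift_inl _ _ _ γ

theorem RightExt.counitHom_inr (b : B) :
    counitHom H B (RingTensor.inr H.etaR (algebraMap A B) b) = b :=
  RingTensor.lift_inr _ _ _ b

/-- The retraction of `RightExt.incl` induced by the counit. -/
def RightExt.retract : H.ViaRight (H.RightExt B) →ₐ[A] B :=
  let p := (algebraMap Γ (H.RightExt B)).comp H.etaR
  AlgHom.mk ((counitHom H B).comp ((Along.of p).symm : Along p →+* H.RightExt B))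
    (fun a => (counitHom_inl H B (H.etaR a)).trans
      (congrArg (algebraMap A B) (H.counit_etaR a)))

/-- Exhibits `B` as an `A`-linear direct summand of `Γ ⊗_{η_R, A, f_o} B` for the action through the
right unit. -/
theorem RightExt.retract_incl :
    (RightExt.retract H B).toLinearMap ∘ₗ (RightExt.incl H B).toLinearMap = LinearMap.id :=
  LinearMap.ext fun b => counitHom_inr H B b

variable {H}

/-- Flatness of `α` gives exactness after base change to `Γ ⊗ B` along the left unit; the twist
moves it to the right unit, and there `B` is a retract. -/
theorem exact_baseChange [Module.Flat A (H.RightExt B)] {M N Q : H.Comodule}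
    (g : Comodule.Hom M N) (h : Comodule.Hom N Q) (e : Function.Exact g.hom h.hom) :
    Function.Exact (g.hom.baseChange B) (h.hom.baseChange B) :=
  exact_lTensor_of_retract g.hom h.hom _ _ (RightExt.retract_incl H B)
    ((exact_lTensor_viaRight_iff (H.RightExt B) g h).2 (Module.Flat.lTensor_exact _ e))

theorem injective_baseChange [Module.Flat A (H.RightExt B)] {M N : H.Comodule}
    (g : Comodule.Hom M N) (e : Function.Injective g.hom) :
    Function.Injective (g.hom.baseChange B) :=
  injective_lTensor_of_retract g.hom _ _ (RightExt.retract_incl H B)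
    ((injective_lTensor_viaRight_iff (H.RightExt B) g).2
      (Module.Flat.lTensor_preserves_injective_linearMap _ e))

variable {B}

/-- Along the right unit `Γ ⊗ B` is a `B`-algebra, so the splitting over `B` gives exactness there.
The twist moves this to the left unit, where faithful flatness of `α` reflects it. -/
theorem exact_of_split [Module.FaithfullyFlat A (H.RightExt B)] {M N Q : H.Comodule}
    (g : Comodule.Hom M N) (h : Comodule.Hom N Q) (hgh : h.hom ∘ₗ g.hom = 0)
    (s : B ⊗[A] N.carrier →ₗ[B] B ⊗[A] M.carrier) (t : B ⊗[A] Q.carrier →ₗ[B] B ⊗[A] N.carrier)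
    (hst : ∀ x, g.hom.baseChange B (s x) + t (h.hom.baseChange B x) = x) :
    Function.Exact g.hom h.hom := by
  let _ : Algebra B (H.ViaRight (H.RightExt B)) := (RightExt.incl H B).toRingHom.toAlgebra
  have : IsScalarTower A B (H.ViaRight (H.RightExt B)) :=
    IsScalarTower.of_algebraMap_eq fun a => ((RightExt.incl H B).commutes a).symm
  refine (Module.FaithfullyFlat.lTensor_exact_iff_exact A (H.RightExt B) _ _).1 ?_
  exact (exact_lTensor_viaRight_iff (H.RightExt B) g h).1
    (exact_lTensor_of_split g.hom h.hom hgh s t hst)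

theorem injective_of_split [Module.FaithfullyFlat A (H.RightExt B)] {M N : H.Comodule}
    (g : Comodule.Hom M N) (s : B ⊗[A] N.carrier →ₗ[B] B ⊗[A] M.carrier)
    (hs : ∀ x, s (g.hom.baseChange B x) = x) : Function.Injective g.hom := by
  let _ : Algebra B (H.ViaRight (H.RightExt B)) := (RightExt.incl H B).toRingHom.toAlgebra
  have : IsScalarTower A B (H.ViaRight (H.RightExt B)) :=
    IsScalarTower.of_algebraMap_eq fun a => ((RightExt.incl H B).commutes a).symm
  refine (Module.FaithfullyFlat.lTensor_injective_iff_injective A (H.RightExt B) _).1 ?_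
  exact (injective_lTensor_viaRight_iff (H.RightExt B) g).1
    (injective_lTensor_of_split g.hom s hs)

end Exactness

/-! ### Comparison of cofree comodules -/

section CounitLeft

variable {A Γ : Type u} [CommRing A] [CommRing Γ] [Algebra A Γ] (H : HopfAlgebroid A Γ)

/-- The map `ε ⊗ id : Γ ⊗_{η_R, A, η_L} Γ → Γ`. -/
def counitLeft : H.Two →+* Γ :=
  RingTensor.lift ((algebraMap A Γ).comp (H.counit : Γ →+* A)) (RingHom.id Γ)
    (by ext a; simp [H.counit_etaR])

theorem counitLeft_mul (s t : Γ) :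
    H.counitLeft (H.inl s * H.inr t) = algebraMap A Γ (H.counit s) * t := by
  rw [map_mul, counitLeft, RingTensor.lift_inl, RingTensor.lift_inr]
  rfl

theorem counitLeft_comul (γ : Γ) : H.counitLeft (H.comul γ) = γ :=
  RingHom.congr_fun (H.id_comp Γ (RingHom.id Γ)) γ

variable {H} {N : Type u} [AddCommGroup N] [Module A N]

theorem lTensor_counit_split (x : H.Two) (n : N) :
    (Cofree.counit H N).lTensor Γ (Cofree.split H N (x ⊗ₜ n)) = H.counitLeft x ⊗ₜ n := by
  induction x using RingTensor.induction with
  | zero => simp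
  | tmul s t =>
    rw [Cofree.split_tmul, LinearMap.lTensor_tmul, Cofree.counit_of_tmul, counitLeft_mul,
      ← Algebra.smul_def, TensorProduct.smul_tmul]
  | add x y hx hy => simp only [TensorProduct.add_tmul, map_add, hx, hy]

/-- An element of a cofree comodule is recovered from its coaction by the left counit law. For a
subcomodule, this expresses the inclusion through its own coaction and the counit. -/
theorem lTensor_counit_coact (w : Cofree H N) :
    Cofree.of H N ((Cofree.counit H N).lTensor Γ (Cofree.coact H N w)) = w := by
  induction w using Cofree.induction with
  | zero => simp
  | tmul γ n =>
    rw [Cofree.coact_of, LinearMap.rTensor_tmul, lTensor_counit_split]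
    exact congrArg (fun z => Cofree.of H N (z ⊗ₜ n)) (H.counitLeft_comul γ)
  | add x y hx hy => simp only [map_add, hx, hy]

variable (H N) in
/-- The coaction of a cofree comodule, as a linear map. -/
def Cofree.coactLin : Cofree H N →ₗ[A] Cofree H (Cofree H N) where
  toFun w := of H (Cofree H N) (coact H N w)
  map_add' x y := by simp only [map_add]
  map_smul' a m := congrArg (of H (Cofree H N)) (map_smulₛₗ (coact H N) a m)

theorem Cofree.counit_coactLin_cofree (w : Cofree H N) :
    counit H (Cofree H N) (coactLin H N w) = w :=
  (evalTensor_coact H N 1 ((of H N).symm w)).trans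
      (congrArg (of H N) (contractTwo_comul_one _))

end CounitLeft

/-! ### Cofree comodules over the target, as `A`-modules. -/

section Restrict

variable {B S : Type u} [CommRing B] [CommRing S] [Algebra B S] (A : Type u) [CommRing A]
  [Algebra A B] (K : HopfAlgebroid B S) (N : Type u) [AddCommGroup N] [Module B N]

/-- The cofree comodule on a `B`-module, regarded also as an `A`-module. -/
def CofreeRestrict (_A : Type u) [CommRing _A] [Algebra _A B] (K : HopfAlgebroid B S) (N : Type u)
    [AddCommGroup N] [Module B N] : Type u :=
  Cofree K N

namespace CofreeRestrict

instance : AddCommGroup (CofreeRestrict A K N) := inferInstanceAs (AddCommGroup (Cofree K N))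

instance : Module B (CofreeRestrict A K N) := inferInstanceAs (Module B (Cofree K N))

instance : Module A (CofreeRestrict A K N) := Module.compHom (Cofree K N) (algebraMap A B)

instance : IsScalarTower A B (CofreeRestrict A K N) :=
  IsScalarTower.of_algebraMap_smul fun _ _ => rfl

/-- The identity map. -/
def of : Cofree K N ≃ₗ[B] CofreeRestrict A K N := LinearEquiv.refl B (Cofree K N)

end CofreeRestrict

end Restrict

/-! ### Pullbacks of cofree comodules against cofree comodules over the target. -/

section Comparison

variable {A Γ B S : Type u} [CommRing A] [CommRing Γ] [Algebra A Γ]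
    [CommRing B] [CommRing S] [Algebra B S] [Algebra A B]
    {H : HopfAlgebroid A Γ} {K : HopfAlgebroid B S} (f : Hom H K)

namespace Hom

variable (N : Type u) [AddCommGroup N] [Module A N] [Module B N] [IsScalarTower A B N]

/-- The map `N ⊗_A Γ → N ⊗_B S`, `n ⊗ γ ↦ n ⊗ f_m(γ)`. -/
def mapTensor : Γ ⊗[A] N →+ S ⊗[B] N :=
  TensorProduct.liftAddHom
    (AddMonoidHom.mk' (fun γ => AddMonoidHom.mk' (fun n => f.mor γ ⊗ₜ[B] n)
        (fun n n' => TensorProduct.tmul_add _ _ _))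
      (fun γ γ' => by ext n; simp [TensorProduct.add_tmul]))
    (fun a γ n => by
      change f.mor (a • γ) ⊗ₜ[B] n = f.mor γ ⊗ₜ[B] (a • n)
      rw [Algebra.smul_def, map_mul, f.mor_etaL, ← Algebra.smul_def, TensorProduct.smul_tmul,
        algebraMap_smul])

theorem mapTensor_tmul (γ : Γ) (n : N) : f.mapTensor N (γ ⊗ₜ n) = f.mor γ ⊗ₜ n := rfl

theorem mapTensor_smul (γ : Γ) (x : Γ ⊗[A] N) :
    f.mapTensor N (γ • x) = f.mor γ • f.mapTensor N x := by
  induction x using TensorProduct.induction_on with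
  | zero => simp
  | tmul s m => simp [TensorProduct.smul_tmul', mapTensor_tmul]
  | add x y hx hy => simp only [smul_add, map_add, hx, hy]

/-- The map of cofree comodules induced by `f`. -/
def mapCofree : Cofree H N →ₗ[A] CofreeRestrict A K N where
  toFun w := CofreeRestrict.of A K N (Cofree.of K N (f.mapTensor N ((Cofree.of H N).symm w)))
  map_add' x y := by simp only [map_add]
  map_smul' a w := by
    change Cofree.of K N (f.mapTensor N (H.etaR a • (Cofree.of H N).symm w)) = _
    rw [mapTensor_smul, f.mor_etaR]
    rfl

theorem mapCofree_of (x : Γ ⊗[A] N) : f.mapCofree N (Cofree.of H N x) =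
    CofreeRestrict.of A K N (Cofree.of K N (f.mapTensor N x)) := rfl

/-- The comparison of the base change of a cofree comodule with a cofree comodule. -/
def cofreeComparison : B ⊗[A] Cofree H N →ₗ[B] Cofree K N :=
  (CofreeRestrict.of A K N).symm.toLinearMap ∘ₗ (f.mapCofree N).liftBaseChange B

theorem cofreeComparison_tmul (b : B) (w : Cofree H N) : f.cofreeComparison N (b ⊗ₜ w) =
    b • (CofreeRestrict.of A K N).symm (f.mapCofree N w) := by
  rw [cofreeComparison, LinearMap.comp_apply, LinearMap.liftBaseChange_tmul, map_smul]
  rfl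

variable {N} in
theorem lTensor_pushTensor {M : Type u} [AddCommGroup M] [Module A M] (c : B ⊗[A] M →ₗ[B] N)
    (c₀ : M →ₗ[A] N) (hc : ∀ m, c (1 ⊗ₜ m) = c₀ m) (x : Γ ⊗[A] M) :
    c.lTensor S (pushTensor f.mor f.mor_etaL M x) = f.mapTensor N (c₀.lTensor Γ x) := by
  induction x using TensorProduct.induction_on with
  | zero => simp
  | tmul γ m => rw [pushTensor_tmul, LinearMap.lTensor_tmul, hc]; rfl
  | add x y hx hy => simp only [map_add, hx, hy]

end Hom

/-! ### The equalizer defining the right adjoint of pullback. -/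

variable (N : K.Comodule)

namespace Hom

/-- The map of cofree comodules over the target which corresponds to `cofreeDiffHom`. -/
def cofreeDiffTarget : Cofree K N.carrier →ₗ[B] Cofree K (CofreeRestrict A K N.carrier) :=
  Cofree.map (CofreeRestrict.of A K N.carrier).toLinearMap ∘ₗ
    (Cofree.map N.coactLin - Cofree.coactLin K N.carrier)

/-- The contracting homotopy of the cobar resolution of `N`: if `x` is killed by the difference,
then `x` is the coaction of its counit. It supplies the splitting in `exact_adjunctHom_id`. -/
theorem counit_cofreeDiffTarget (x : Cofree K N.carrier) :
    Cofree.counit K _ (cofreeDiffTarget (A := A) N x) =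
      CofreeRestrict.of A K N.carrier (N.coactLin (Cofree.counit K N.carrier x) - x) := by
  rw [cofreeDiffTarget, LinearMap.comp_apply, Cofree.counit_map, LinearMap.sub_apply, map_sub,
    Cofree.counit_map, Cofree.counit_coactLin_cofree]
  rfl

/-- This is coassociativity of `N`, transported by `Cofree.split`. -/
theorem cofreeDiffTarget_coactLin (n : N.carrier) :
    cofreeDiffTarget (A := A) N (N.coactLin n) = 0 := by
  have h : ∀ y : S ⊗[B] N.carrier, Cofree.split K N.carrier (coactTwo N.coact y) =
      N.coactLin.lTensor S y := by
    intro y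
    induction y using TensorProduct.induction_on with
    | zero => simp
    | tmul γ m =>
      rw [coactTwo_tmul, Cofree.split_inr_smul, LinearMap.lTensor_tmul, Comodule.coactLin_apply]
      generalize N.coact m = z
      induction z using TensorProduct.induction_on with
      | zero => simp
      | tmul s m =>
        have h1 : K.inlAlg.toLinearMap.rTensor N.carrier (s ⊗ₜ m) =
          (K.inl s * K.inr 1) ⊗ₜ m := by rw [map_one, mul_one]; rfl
        rw [h1, Cofree.split_tmul, TensorProduct.smul_tmul', smul_eq_mul, mul_one]
      | add x y hx hy => simp only [map_add, smul_add, hx, hy, TensorProduct.tmul_add]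
    | add x y hx hy => simp only [map_add, hx, hy]
  have h2 : Cofree.map N.coactLin (N.coactLin n) = Cofree.coactLin K N.carrier (N.coactLin n) := by
    refine (congrArg (Cofree.of K _) (h (N.coact n))).symm.trans ?_
    rw [← N.coassoc]
    rfl
  rw [cofreeDiffTarget, LinearMap.comp_apply, LinearMap.sub_apply, h2, sub_self, map_zero]

variable [Module A N.carrier] [IsScalarTower A B N.carrier]

/-- The difference of the two maps from the cofree comodule on `N` whose equalizer on cofree
comodules is the comodule corresponding to `N`. -/
def cofreeDiff : Cofree H N.carrier →ₗ[A] CofreeRestrict A K N.carrier :=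
  (((CofreeRestrict.of A K N.carrier).toLinearMap ∘ₗ N.coactLin).restrictScalars A) ∘ₗ
    Cofree.counit H N.carrier - f.mapCofree N.carrier

theorem cofreeDiff_apply (w : Cofree H N.carrier) :
    f.cofreeDiff N w = CofreeRestrict.of A K N.carrier
      (N.coactLin (Cofree.counit H N.carrier w)) - f.mapCofree N.carrier w := rfl

/-- The map of cofree comodules determined by `cofreeDiff`. -/
def cofreeDiffLin : Cofree H N.carrier →ₗ[A] Cofree H (CofreeRestrict A K N.carrier) :=
  Cofree.map (f.cofreeDiff N) ∘ₗ Cofree.coactLin H N.carrier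

/-- Needed only for `x = Δ(γ)`, but stated for all `x` so that it can be checked on pure tensors.
The two terms come from the two parts of `cofreeDiff`: the counit on one factor, and `f_m ⊗ f_m`. -/
theorem mapTensor_split (x : H.Two) (n : N.carrier) :
    f.mapTensor (CofreeRestrict A K N.carrier)
        ((f.cofreeDiff N).lTensor Γ (Cofree.split H N.carrier (x ⊗ₜ n))) =
      (CofreeRestrict.of A K N.carrier).toLinearMap.lTensor S
        (f.mor (H.counitLeft x) ⊗ₜ N.coactLin n -
          Cofree.split K N.carrier (f.morTwo x ⊗ₜ n)) := by
  induction x using RingTensor.induction with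
  | zero => simp only [TensorProduct.zero_tmul, map_zero, sub_zero]
  | tmul s t =>
    have h1 : f.mor (H.counitLeft (H.inl s * H.inr t)) ⊗ₜ[B] N.coactLin n =
        f.mor t ⊗ₜ N.coactLin (H.counit s • n) := by
      rw [counitLeft_mul, map_mul, f.mor_etaL, ← Algebra.smul_def, TensorProduct.smul_tmul,
        ← map_smul, algebraMap_smul]
    rw [Cofree.split_tmul, LinearMap.lTensor_tmul, mapTensor_tmul, h1, map_mul,
      f.morTwo_inl, f.morTwo_inr, Cofree.split_tmul, ← TensorProduct.tmul_sub]
    rfl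
  | add x y hx hy =>
    simp only [TensorProduct.add_tmul, map_add, map_sub] at hx hy ⊢
    rw [hx, hy]
    exact sub_add_sub_comm _ _ _ _

theorem mapCofree_cofreeDiffLin (w : Cofree H N.carrier) :
    (CofreeRestrict.of A K _).symm (f.mapCofree (CofreeRestrict A K N.carrier)
      (f.cofreeDiffLin N w)) = cofreeDiffTarget (A := A) N
        ((CofreeRestrict.of A K N.carrier).symm (f.mapCofree N.carrier w)) := by
  induction w using Cofree.induction with
  | zero => simp only [map_zero]
  | tmul γ n =>
    refine (congrArg (Cofree.of K (CofreeRestrict A K N.carrier))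
      (f.mapTensor_split N (H.comul γ) n)).trans ?_
    rw [H.counitLeft_comul, ← f.comul_mor]
    rfl
  | add x y hx hy => simp only [map_add, hx, hy]

/-- When the comparison maps are bijective, this identifies the base change of the equalizer diagram
over `Γ` with the cobar diagram of `N`. -/
theorem cofreeComparison_cofreeDiffLin (y : B ⊗[A] Cofree H N.carrier) :
    f.cofreeComparison (CofreeRestrict A K N.carrier) ((f.cofreeDiffLin N).baseChange B y) =
      cofreeDiffTarget (A := A) N (f.cofreeComparison N.carrier y) := by
  induction y using TensorProduct.induction_on with
  | zero => simp only [map_zero]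
  | tmul b w =>
    rw [LinearMap.baseChange_tmul, cofreeComparison_tmul, mapCofree_cofreeDiffLin, cofreeComparison_tmul, map_smul]
  | add x y hx hy => simp only [map_add, hx, hy]

end Hom

end Comparison

/-! ### Descent of comodules -/

section Descent

variable {A Γ B S : Type u} [CommRing A] [CommRing Γ] [Algebra A Γ]
    [CommRing B] [CommRing S] [Algebra B S] [Algebra A B]
    {H : HopfAlgebroid A Γ} {K : HopfAlgebroid B S} (f : Hom H K)

/-- A morphism of comodules with values in the image of an injective morphism lifts. -/
theorem Comodule.Hom.exists_lift [Module.Free A Γ] {L M N : H.Comodule} (j : Comodule.Hom M N)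
    (hj : Function.Injective j.hom) (g : Comodule.Hom L N)
    (hg : ∀ x, ∃ y, j.hom y = g.hom x) : ∃ e : Comodule.Hom L M, ∀ x, j.hom (e.hom x) = g.hom x := by
  choose e he using hg
  refine ⟨Comodule.homOfAction (AddMonoidHom.mk' e fun x y => hj ?_) fun D x => hj ?_, he⟩
  · rw [he, map_add, map_add, he, he]
  · change j.hom (e _) = j.hom (M.actHom D (e x))
    rw [he, j.map_actHom, he, g.map_actHom]

namespace Hom

section Adjunction

variable {M : H.Comodule} {N : K.Comodule} [Module A N.carrier] [IsScalarTower A B N.carrier]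

/-- The morphism out of a pullback determined by a linear map which is compatible with the
coactions. -/
def ofPullback (c : M.carrier →ₗ[A] N.carrier)
    (hc : ∀ m, N.coact (c m) = f.mapTensor N.carrier (c.lTensor Γ (M.coact m))) :
    Comodule.Hom (f.pullbackObj M) N where
  hom := c.liftBaseChange B
  map_coact x := by
    have h : ∀ x : B ⊗[A] M.carrier, N.coact (c.liftBaseChange B x) =
        (c.liftBaseChange B).lTensor S (f.pullCoact M x) := by
      intro x
      induction x using TensorProduct.induction_on with
      | zero => simp only [map_zero]
      | tmul b m =>
        rw [LinearMap.liftBaseChange_tmul, map_smulₛₗ, pullCoact_tmul, lTensor_smul_left, hc,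
          f.lTensor_pushTensor (c.liftBaseChange B) c (fun m => by
            rw [LinearMap.liftBaseChange_tmul, one_smul])]
      | add x y hx hy => simp only [map_add, hx, hy]
    exact h x

end Adjunction

/-- The morphism of cofree comodules determined by `cofreeDiff`. -/
def cofreeDiffHom [Module.Free A Γ] (N : K.Comodule) [Module A N.carrier] [IsScalarTower A B N.carrier] :
    Comodule.Hom (cofree H N.carrier) (cofree H (CofreeRestrict A K N.carrier)) :=
  toCofree (cofree H N.carrier) (f.cofreeDiff N)

/-- Every comodule over the target is a pullback, if the pullback preserves exact sequences and
cofree comodules. -/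
theorem exists_pullback_iso [Module.Free A Γ] [Module.Flat A (H.RightExt B)] (N : K.Comodule)
    [Module A N.carrier] [IsScalarTower A B N.carrier]
    (hN : Function.Bijective (f.cofreeComparison N.carrier))
    (hN' : Function.Bijective (f.cofreeComparison (CofreeRestrict A K N.carrier))) :
    ∃ M : H.Comodule, Nonempty (f.pullbackObj M ≅ N) := by
  -- `M` is the value at `N` of the right adjoint, and the base-changed `c` below will be the counit
  -- of the adjunction.
  obtain ⟨M, i, hi, hexact⟩ := (f.cofreeDiffHom N).exists_kernel
  let i' : M.carrier →ₗ[A] Cofree H N.carrier := i.hom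
  let c : M.carrier →ₗ[A] N.carrier := Cofree.counit H N.carrier ∘ₗ i'
  have hi' : ∀ m, N.coactLin (c m) =
      (CofreeRestrict.of A K N.carrier).symm (f.mapCofree N.carrier (i' m)) := by
    intro m
    have h0 : (f.cofreeDiffHom N).hom (i.hom m) = 0 := (hexact _).2 ⟨m, rfl⟩
    have h1 : f.cofreeDiff N (i' m) = 0 :=
      (counit_toCofree (cofree H N.carrier) (f.cofreeDiff N) (i.hom m)).symm.trans
        ((congrArg (Cofree.counit H _) h0).trans (map_zero _))
    rw [cofreeDiff_apply, sub_eq_zero] at h1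
    rw [← h1, LinearEquiv.symm_apply_apply]
    rfl
  have hc : ∀ m, N.coact (c m) = f.mapTensor N.carrier (c.lTensor Γ (M.coact m)) := by
    intro m
    have h2 : c.lTensor Γ (M.coact m) = (Cofree.of H N.carrier).symm (i' m) := by
      have h3 : Cofree.coact H N.carrier (i' m) = i'.lTensor Γ (M.coact m) := i.map_coact m
      rw [LinearMap.lTensor_comp_apply, ← h3]
      exact lTensor_counit_coact (i' m)
    rw [h2]
    exact hi' m
  -- The right side is injective in `x`, since `i` stays injective over `B`; this gives injectivity
  -- of the candidate isomorphism.
  have hcomp : ∀ x : B ⊗[A] M.carrier, N.coactLin (c.liftBaseChange B x) =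
      f.cofreeComparison N.carrier (i'.baseChange B x) := by
    intro x
    induction x using TensorProduct.induction_on with
    | zero => simp only [map_zero]
    | tmul b m =>
      rw [LinearMap.liftBaseChange_tmul, map_smul, hi', LinearMap.baseChange_tmul,
        cofreeComparison_tmul]
    | add x y hx hy => simp only [map_add, hx, hy]
  have hbi : Function.Injective (i'.baseChange B) := injective_baseChange B i hi
  have hbe : Function.Exact (i'.baseChange B) ((f.cofreeDiffLin N).baseChange B) :=
    exact_baseChange B i (f.cofreeDiffHom N) hexact
  refine ⟨M, ⟨Comodule.isoOfBijective (f.ofPullback c hc) ⟨fun x y hxy =>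
    hbi (hN.1 ((hcomp x).symm.trans ((congrArg N.coactLin hxy).trans (hcomp y)))), fun n => ?_⟩⟩⟩
  · obtain ⟨y, hy⟩ := hN.2 (N.coactLin n)
    -- `y` corresponds to the coaction of `n`, which the difference over the target kills.
    -- Injectivity of the second comparison puts `y` in the base-changed kernel, which comes from
    -- `M` by exactness.
    have h4 : (f.cofreeDiffLin N).baseChange B y = 0 := by
      refine hN'.1 ?_
      rw [cofreeComparison_cofreeDiffLin, hy, cofreeDiffTarget_coactLin, map_zero]
    obtain ⟨z, rfl⟩ := (hbe y).1 h4
    refine ⟨z, ?_⟩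
    change c.liftBaseChange B z = n
    rw [← Cofree.counit_coactLin N (c.liftBaseChange B z), hcomp, hy, Cofree.counit_coactLin]

/-! ### Full faithfulness, through the unit of the adjunction. -/

instance (M : H.Comodule) : Module A (f.pullbackObj M).carrier :=
  inferInstanceAs (Module A (B ⊗[A] M.carrier))

instance (M : H.Comodule) : IsScalarTower A B (f.pullbackObj M).carrier :=
  inferInstanceAs (IsScalarTower A B (B ⊗[A] M.carrier))

/-- The map `m ↦ m ⊗ 1` to the pullback. -/
def toPullback (M : H.Comodule) : M.carrier →ₗ[A] (f.pullbackObj M).carrier :=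
  TensorProduct.mk A B M.carrier 1

variable {L M : H.Comodule} (φ : Comodule.Hom (f.pullbackObj L) (f.pullbackObj M))

/-- The restriction of a morphism of pullbacks along `m ↦ m ⊗ 1`. -/
def adjunct : L.carrier →ₗ[A] (f.pullbackObj M).carrier :=
  (φ.hom.restrictScalars A) ∘ₗ f.toPullback L

/-- The map to the cofree comodule on a pullback corresponding to a morphism of pullbacks. -/
def adjunctCofree : L.carrier →ₗ[A] Cofree H (f.pullbackObj M).carrier :=
  Cofree.map (f.adjunct φ) ∘ₗ L.coactLin

/-- This is the compatibility of `φ` with the coactions, restricted to elements `x ⊗ 1`. It makes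
the two terms of `cofreeDiff` agree on the transpose of `φ`. -/
theorem mapCofree_adjunctCofree (x : L.carrier) :
    f.mapCofree (f.pullbackObj M).carrier (f.adjunctCofree φ x) =
      CofreeRestrict.of A K _ ((f.pullbackObj M).coactLin (φ.hom ((1 : B) ⊗ₜ[A] x))) := by
  refine congrArg (fun z => CofreeRestrict.of A K _ (Cofree.of K _ z)) (Eq.trans
    (f.lTensor_pushTensor φ.hom (f.adjunct φ) (fun _ => rfl) (L.coact x)).symm ?_)
  refine Eq.trans (congrArg (φ.hom.lTensor S) (Eq.symm ((f.pullCoact_tmul L 1 x).trans ?_)))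
    (φ.map_coact ((1 : B) ⊗ₜ[A] x)).symm
  rw [map_one, one_smul]

theorem counit_adjunctCofree (x : L.carrier) :
    Cofree.counit H (f.pullbackObj M).carrier (f.adjunctCofree φ x) = φ.hom ((1 : B) ⊗ₜ[A] x) :=
  (Cofree.counit_map (f.adjunct φ) (L.coactLin x)).trans
    (congrArg (f.adjunct φ) (Cofree.counit_coactLin L x))

theorem cofreeDiff_adjunctCofree :
    f.cofreeDiff (f.pullbackObj M) ∘ₗ f.adjunctCofree φ = 0 := by
  ext x
  rw [LinearMap.comp_apply, cofreeDiff_apply, mapCofree_adjunctCofree, counit_adjunctCofree,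
    sub_self, LinearMap.zero_apply]

/-- The morphism to the cofree comodule on a pullback corresponding to a morphism of pullbacks. -/
def adjunctHom [Module.Free A Γ] : Comodule.Hom L (cofree H (f.pullbackObj M).carrier) :=
  toCofree L (f.adjunct φ)

theorem cofreeDiffLin_adjunctCofree [Module.Free A Γ] :
    f.cofreeDiffLin (f.pullbackObj M) ∘ₗ f.adjunctCofree φ = 0 := by
  ext x
  have h : Cofree.coact H _ (f.adjunctCofree φ x) =
    (f.adjunctCofree φ).lTensor Γ (L.coact x) := (f.adjunctHom φ).map_coact x
  change Cofree.of H _ ((f.cofreeDiff (f.pullbackObj M)).lTensor Γ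
    (Cofree.coact H _ (f.adjunctCofree φ x))) = 0
  rw [h, ← LinearMap.lTensor_comp_apply, cofreeDiff_adjunctCofree, LinearMap.lTensor_zero,
    LinearMap.zero_apply, map_zero]

/-- After base change the transpose of `φ` becomes `φ` followed by the coaction. For the identity it
is the coaction itself, which the counit splits. -/
theorem cofreeComparison_adjunctCofree (x : B ⊗[A] L.carrier) :
    f.cofreeComparison (f.pullbackObj M).carrier ((f.adjunctCofree φ).baseChange B x) =
      (f.pullbackObj M).coactLin (φ.hom x) := by
  induction x using TensorProduct.induction_on with
  | zero => simp only [map_zero]; exact ((congrArg _ (map_zero φ.hom)).trans (map_zero _)).symm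
  | tmul b x =>
    rw [LinearMap.baseChange_tmul, cofreeComparison_tmul, mapCofree_adjunctCofree,
      LinearEquiv.symm_apply_apply, ← map_smul]
    have h : b ⊗ₜ[A] x = b • ((1 : B) ⊗ₜ[A] x) := by
      rw [TensorProduct.smul_tmul', smul_eq_mul, mul_one]
    rw [h]
    exact congrArg (f.pullbackObj M).coactLin (map_smul φ.hom b _).symm
  | add x y hx hy =>
    simp only [map_add, hx, hy]
    exact ((congrArg _ (map_add φ.hom x y)).trans (map_add _ _ _)).symm

variable (M)

/-- The unit of the adjunction between pullback and its right adjoint identifies a comodule with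
the kernel of `cofreeDiffHom`. -/
theorem exact_adjunctHom_id [Module.Free A Γ] [Module.FaithfullyFlat A (H.RightExt B)]
    (hN : Function.Bijective (f.cofreeComparison (f.pullbackObj M).carrier)) :
    Function.Injective (f.adjunctHom (𝟙 (f.pullbackObj M))).hom ∧
      Function.Exact (f.adjunctHom (𝟙 (f.pullbackObj M))).hom
        (f.cofreeDiffHom (f.pullbackObj M)).hom := by
  let N := f.pullbackObj M
  let j := f.adjunctCofree (𝟙 N)
  let ρ := LinearEquiv.ofBijective (f.cofreeComparison N.carrier) hN
  let s : B ⊗[A] Cofree H N.carrier →ₗ[B] N.carrier :=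
    Cofree.counit K N.carrier ∘ₗ ρ.toLinearMap
  -- The sign compensates `counit_cofreeDiffTarget`, where the counit of the difference is the
  -- coaction of the counit of `x`, minus `x`.
  let t : B ⊗[A] Cofree H (CofreeRestrict A K N.carrier) →ₗ[B] B ⊗[A] Cofree H N.carrier :=
    -(ρ.symm.toLinearMap ∘ₗ (CofreeRestrict.of A K N.carrier).symm.toLinearMap ∘ₗ
      Cofree.counit K _ ∘ₗ f.cofreeComparison (CofreeRestrict A K N.carrier))
  have hj : ∀ x : N.carrier, ρ (j.baseChange B x) = N.coactLin x :=
    f.cofreeComparison_adjunctCofree (𝟙 N)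
  have hs : ∀ x : N.carrier, s (j.baseChange B x) = x := fun x => by
    change Cofree.counit K N.carrier (ρ (j.baseChange B x)) = x
    rw [hj, Cofree.counit_coactLin]
  have hst : ∀ x, j.baseChange B (s x) + t ((f.cofreeDiffLin N).baseChange B x) = x := by
    intro x
    refine ρ.injective ?_
    rw [map_add, hj]
    change N.coactLin (Cofree.counit K N.carrier (ρ x)) +
      ρ (-(ρ.symm ((CofreeRestrict.of A K N.carrier).symm (Cofree.counit K _
        (f.cofreeComparison (CofreeRestrict A K N.carrier)
          ((f.cofreeDiffLin N).baseChange B x)))))) = ρ x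
    rw [cofreeComparison_cofreeDiffLin, counit_cofreeDiffTarget, LinearEquiv.symm_apply_apply,
      map_neg, LinearEquiv.apply_symm_apply, neg_sub]
    exact add_sub_cancel _ _
  exact ⟨injective_of_split (f.adjunctHom (𝟙 N)) s hs,
    exact_of_split (f.adjunctHom (𝟙 N)) (f.cofreeDiffHom N) (f.cofreeDiffLin_adjunctCofree (𝟙 N))
      s t hst⟩

variable {M}

theorem pullback_full_faithful [Module.Free A Γ] [Module.FaithfullyFlat A (H.RightExt B)]
    (hρ : ∀ M : H.Comodule, Function.Bijective (f.cofreeComparison (f.pullbackObj M).carrier)) :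
    f.pullback.Full ∧ f.pullback.Faithful := by
  constructor
  · refine ⟨fun {L M} φ => ?_⟩
    obtain ⟨hj, he⟩ := f.exact_adjunctHom_id M (hρ M)
    -- The transpose of `φ` lands in the kernel of the difference, which is the image of the unit at
    -- `M`. The lift `e` is the preimage of `φ`, and the counit shows that they agree on elements `x
    -- ⊗ 1`.
    obtain ⟨e, he⟩ := Comodule.Hom.exists_lift (f.adjunctHom (𝟙 (f.pullbackObj M))) hj
      (f.adjunctHom φ) fun x => (he _).1
        (DFunLike.congr_fun (f.cofreeDiffLin_adjunctCofree φ) x)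
    refine ⟨e, Comodule.Hom.ext (LinearMap.ext fun x => ?_)⟩
    have h1 : ∀ x : L.carrier, (1 : B) ⊗ₜ[A] e.hom x = φ.hom ((1 : B) ⊗ₜ[A] x) := fun x => by
      refine (f.counit_adjunctCofree (𝟙 (f.pullbackObj M)) (e.hom x)).symm.trans
        (Eq.trans ?_ (f.counit_adjunctCofree φ x))
      exact congrArg (Cofree.counit H _) (he x)
    change e.hom.baseChange B x = φ.hom x
    induction x using TensorProduct.induction_on with
    | zero => exact (map_zero _).trans (map_zero φ.hom).symm
    | tmul b x =>
      have h2 : b ⊗ₜ[A] x = b • ((1 : B) ⊗ₜ[A] x) := by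
        rw [TensorProduct.smul_tmul', smul_eq_mul, mul_one]
      rw [h2, map_smul, LinearMap.baseChange_tmul, h1]
      exact (map_smul φ.hom b _).symm
    | add x y hx hy =>
      rw [map_add, hx, hy]
      exact (map_add φ.hom x y).symm
  · refine ⟨fun {L M} g g' h => Comodule.Hom.ext (LinearMap.ext fun x =>
      (f.exact_adjunctHom_id M (hρ M)).1 ?_)⟩
    -- The transpose of the pullback of `g` is `g` followed by the injective unit, so it determines
    -- `g`.
    have key : ∀ g : Comodule.Hom L M, f.adjunctCofree (𝟙 (f.pullbackObj M)) (g.hom x) =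
        f.adjunctCofree (L := L) (M := M) (f.pullback.map g) x := by
      intro g
      refine congrArg (Cofree.of H _) ?_
      change (f.adjunct (𝟙 (f.pullbackObj M))).lTensor Γ (M.coact (g.hom x)) =
        (f.adjunct (L := L) (M := M) (f.pullback.map g)).lTensor Γ (L.coact x)
      rw [g.map_coact, ← LinearMap.lTensor_comp_apply]
      rfl
    exact (key g).trans ((congrArg (fun φ => f.adjunctCofree (L := L) (M := M) φ x) h).trans
      (key g').symm)

/-- Descent for comodules. -/
theorem pullback_isEquivalence [Module.Free A Γ] [Module.FaithfullyFlat A (H.RightExt B)]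
    (hρ : ∀ (N : Type u) [AddCommGroup N] [Module A N] [Module B N] [IsScalarTower A B N],
      Function.Bijective (f.cofreeComparison N)) :
    f.pullback.IsEquivalence where
  full := (f.pullback_full_faithful fun M => hρ _).1
  faithful := (f.pullback_full_faithful fun M => hρ _).2
  essSurj := ⟨fun N => by
    let _ : Module A N.carrier := Module.compHom N.carrier (algebraMap A B)
    have : IsScalarTower A B N.carrier := IsScalarTower.of_algebraMap_smul fun _ _ => rfl
    exact f.exists_pullback_iso N (hρ _) (hρ _)⟩

end Hom

end Descent

/-! ### The Hopf algebroid `(B, Γ_f)` -/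

section BaseChangeComparison

variable {A Γ : Type u} [CommRing A] [CommRing Γ] [Algebra A Γ] (H : HopfAlgebroid A Γ)
  (B : Type u) [CommRing B] [Algebra A B]

namespace BaseChange

theorem left_mul_mid_mul_right (b b' : B) (γ : Γ) :
    algebraMap B (H.BaseChange B) b * mid H B γ * right H B b' =
      RingTensor.inl (algebraMap A B) (H.alpha B) b * RingTensor.inr (algebraMap A B) (H.alpha B)
        (RingTensor.inl H.etaR (algebraMap A B) γ * RingTensor.inr H.etaR (algebraMap A B) b') := by
  rw [map_mul, ← mul_assoc]
  rfl

variable {H B} in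
@[elab_as_elim]
theorem induction {motive : H.BaseChange B → Prop} (x : H.BaseChange B) (zero : motive 0)
    (tmul : ∀ b γ b', motive (algebraMap B (H.BaseChange B) b * mid H B γ * right H B b'))
    (add : ∀ x y, motive x → motive y → motive (x + y)) : motive x := by
  induction x using RingTensor.induction with
  | zero => exact zero
  | tmul b p =>
    induction p using RingTensor.induction with
    | zero => rw [map_zero, mul_zero]; exact zero
    | tmul γ b' => rw [← left_mul_mid_mul_right]; exact tmul b γ b'
    | add x y hx hy => rw [map_add, mul_add]; exact add _ _ hx hy
  | add x y hx hy => exact add _ _ hx hy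

variable (N : Type u) [AddCommGroup N] [Module A N]

/-- The map `γ ⊗ b ↦ (n ↦ b ⊗ (γ ⊗ n))`. -/
def unfoldRight : H.RightExt B →+ N →+ B ⊗[A] Cofree H N :=
  RingTensor.liftAdd
    (AddMonoidHom.mk' (fun γ => AddMonoidHom.mk' (fun b => AddMonoidHom.mk' (fun n =>
        b ⊗ₜ[A] Cofree.of H N (γ ⊗ₜ[A] n))
        (fun n n' => by rw [TensorProduct.tmul_add, map_add, TensorProduct.tmul_add]))
        (fun b b' => AddMonoidHom.ext fun n => TensorProduct.add_tmul _ _ _))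
        (fun γ γ' => AddMonoidHom.ext fun b => AddMonoidHom.ext fun n => by
          change b ⊗ₜ[A] Cofree.of H N ((γ + γ') ⊗ₜ[A] n) =
            b ⊗ₜ[A] Cofree.of H N (γ ⊗ₜ[A] n) + b ⊗ₜ[A] Cofree.of H N (γ' ⊗ₜ[A] n)
          rw [TensorProduct.add_tmul, map_add, TensorProduct.tmul_add]))
    (fun a γ b => AddMonoidHom.ext fun n => by
      change b ⊗ₜ[A] Cofree.of H N ((H.etaR a * γ) ⊗ₜ[A] n) =
        (algebraMap A B a * b) ⊗ₜ[A] Cofree.of H N (γ ⊗ₜ[A] n)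
      rw [← Cofree.smul_of_tmul, ← Algebra.smul_def, TensorProduct.smul_tmul])

theorem unfoldRight_mul (γ : Γ) (b : B) (n : N) :
    unfoldRight H B N (RingTensor.inl H.etaR (algebraMap A B) γ *
      RingTensor.inr H.etaR (algebraMap A B) b) n = b ⊗ₜ[A] Cofree.of H N (γ ⊗ₜ[A] n) :=
  DFunLike.congr_fun (RingTensor.liftAdd_mul (p := H.etaR) (q := algebraMap A B) _ _ γ b) n

theorem unfoldRight_alpha_mul (a : A) (p : H.RightExt B) (n : N) :
    unfoldRight H B N (H.alpha B a * p) n = unfoldRight H B N p (a • n) := by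
  induction p using RingTensor.induction with
  | zero => rw [mul_zero, map_zero]; rfl
  | tmul γ b =>
    rw [alpha, RingHom.comp_apply, ← mul_assoc, ← map_mul, unfoldRight_mul, unfoldRight_mul,
      ← Algebra.smul_def, TensorProduct.smul_tmul]
  | add x y hx hy =>
    rw [mul_add, map_add, map_add, AddMonoidHom.add_apply, AddMonoidHom.add_apply, hx, hy]

variable [Module B N] [IsScalarTower A B N]

/-- The map `b ⊗ γ ⊗ b' ↦ (n ↦ b' ⊗ (γ ⊗ b n))`. -/
def unfoldAdd : H.BaseChange B →+ N →+ B ⊗[A] Cofree H N :=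
  RingTensor.liftAdd
    (AddMonoidHom.mk' (fun b => AddMonoidHom.mk' (fun p =>
        (unfoldRight H B N p).comp (DistribSMul.toAddMonoidHom N b))
        (fun p p' => AddMonoidHom.ext fun n => by rw [map_add]; rfl))
        (fun b b' => AddMonoidHom.ext fun p => AddMonoidHom.ext fun n => by
          change unfoldRight H B N p ((b + b') • n) =
            unfoldRight H B N p (b • n) + unfoldRight H B N p (b' • n)
          rw [add_smul, map_add]))
    (fun a b p => AddMonoidHom.ext fun n => by
      change unfoldRight H B N p ((algebraMap A B a * b) • n) =
        unfoldRight H B N (H.alpha B a * p) (b • n)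
      rw [unfoldRight_alpha_mul, mul_smul, algebraMap_smul])

theorem unfoldAdd_mul (b : B) (γ : Γ) (b' : B) (n : N) :
    unfoldAdd H B N (algebraMap B (H.BaseChange B) b * mid H B γ * right H B b') n =
      b' ⊗ₜ[A] Cofree.of H N (γ ⊗ₜ[A] (b • n)) := by
  rw [left_mul_mid_mul_right, ← unfoldRight_mul]
  exact DFunLike.congr_fun
    (RingTensor.liftAdd_mul (p := algebraMap A B) (q := H.alpha B) _ _ b _) n

/-- The inverse of the comparison of cofree comodules. -/
def unfold : (H.BaseChange B) ⊗[B] N →+ B ⊗[A] Cofree H N :=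
  TensorProduct.liftAddHom (unfoldAdd H B N) (fun b x n => by
    induction x using BaseChange.induction with
    | zero => rw [smul_zero, map_zero]; rfl
    | tmul b₀ γ b₁ =>
      rw [Algebra.smul_def, ← mul_assoc, ← mul_assoc, ← map_mul, unfoldAdd_mul, unfoldAdd_mul,
        mul_comm, mul_smul]
    | add x y hx hy =>
      rw [smul_add, map_add, map_add, AddMonoidHom.add_apply, AddMonoidHom.add_apply, hx, hy])

theorem unfold_tmul (b : B) (γ : Γ) (b' : B) (n : N) :
    unfold H B N ((algebraMap B (H.BaseChange B) b * mid H B γ * right H B b') ⊗ₜ n) =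
      b' ⊗ₜ[A] Cofree.of H N (γ ⊗ₜ[A] (b • n)) :=
  unfoldAdd_mul H B N b γ b' n

theorem comparison_tmul (b : B) (γ : Γ) (n : N) :
    (H.iota B).cofreeComparison N (b ⊗ₜ Cofree.of H N (γ ⊗ₜ n)) =
      Cofree.of (H.baseChange B) N ((right H B b * mid H B γ) ⊗ₜ n) := by
  rw [Hom.cofreeComparison_tmul]
  rfl

/-- In `(B ⊗ Γ ⊗ B) ⊗_B N` the left factor `B` is absorbed by `N`, which leaves `B ⊗_A (Γ ⊗_A N)`.
No flatness enters. -/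
theorem comparison_bijective : Function.Bijective ((H.iota B).cofreeComparison N) := by
  have hl : ∀ y, unfold H B N ((Cofree.of (H.baseChange B) N).symm
      ((H.iota B).cofreeComparison N y)) = y := by
    intro y
    induction y using TensorProduct.induction_on with
    | zero => simp only [map_zero]
    | tmul b w =>
      induction w using Cofree.induction with
      | zero => simp only [TensorProduct.tmul_zero, map_zero]
      | tmul γ n =>
        have h : right H B b * mid H B γ =
            algebraMap B (H.BaseChange B) 1 * mid H B γ * right H B b := by
          rw [map_one, one_mul, mul_comm]
        rw [comparison_tmul, AddEquiv.symm_apply_apply, h, unfold_tmul, one_smul]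
      | add x y hx hy => simp only [TensorProduct.tmul_add, map_add, hx, hy]
    | add x y hx hy => simp only [map_add, hx, hy]
  have hr : ∀ x : (H.BaseChange B) ⊗[B] N,
      (H.iota B).cofreeComparison N (unfold H B N x) = Cofree.of (H.baseChange B) N x := by
    intro x
    induction x using TensorProduct.induction_on with
    | zero => simp only [map_zero]
    | tmul x n =>
      induction x using BaseChange.induction with
      | zero => simp only [TensorProduct.zero_tmul, map_zero]
      | tmul b γ b' =>
        rw [unfold_tmul, comparison_tmul, ← TensorProduct.smul_tmul, Algebra.smul_def]
        congr 2
        ring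
      | add x y hx hy => simp only [TensorProduct.add_tmul, map_add, hx, hy]
    | add x y hx hy => simp only [map_add, hx, hy]
  exact ⟨Function.LeftInverse.injective (g := fun x => unfold H B N
    ((Cofree.of (H.baseChange B) N).symm x)) hl, fun x => ⟨_, hr ((Cofree.of _ N).symm x)⟩⟩

end BaseChange

/-- Descent of comodules along `(f_o, ι)`. -/
theorem iota_pullback_isEquivalence [Module.Free A Γ] [Module.FaithfullyFlat A (H.RightExt B)] :
    (H.iota B).pullback.IsEquivalence :=
  (H.iota B).pullback_isEquivalence fun N => BaseChange.comparison_bijective H B N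

/-- `Γ_f` is the base change of `Γ ⊗_{η_R, A, f_o} B`. -/
def BaseChange.equivTensor : B ⊗[A] H.RightExt B ≃ₗ[B] H.BaseChange B :=
  let e₁ : B ≃ₗ[A] Along (algebraMap A B) :=
    { (Along.of (algebraMap A B)).toAddEquiv with
      map_smul' := fun a b => congrArg (Along.of (algebraMap A B)) (Algebra.smul_def a b) }
  let e₂ : H.RightExt B ≃ₗ[A] Along (H.alpha B) :=
    { (Along.of (H.alpha B)).toAddEquiv with
      map_smul' := fun a b => congrArg (Along.of (H.alpha B)) (Algebra.smul_def a b) }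
  let e : B ⊗[A] H.RightExt B ≃+ H.BaseChange B :=
    (TensorProduct.congr e₁ e₂).toAddEquiv.trans (RingTensor.equiv _ _).symm.toAddEquiv
  have he : ∀ b p, e (b ⊗ₜ p) = RingTensor.inl (algebraMap A B) (H.alpha B) b *
      RingTensor.inr (algebraMap A B) (H.alpha B) p := fun b p =>
    (RingTensor.inl_mul_inr (algebraMap A B) (H.alpha B) b p).symm
  { e with
    map_smul' := fun b x => by
      change e (b • x) = b • e x
      induction x using TensorProduct.induction_on with
      | zero => rw [smul_zero, map_zero, smul_zero]
      | tmul b' p =>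
        rw [TensorProduct.smul_tmul', he, he, smul_eq_mul, map_mul, Algebra.smul_def, mul_assoc]
        rfl
      | add x y hx hy => rw [smul_add, map_add, hx, hy, map_add, smul_add] }

end BaseChangeComparison

/-! ### Pullback along `f` as restriction of scalars. -/

section Restriction

variable {A Γ B S : Type u} [CommRing A] [CommRing Γ] [Algebra A Γ]
    [CommRing B] [CommRing S] [Algebra B S] [Algebra A B]
    {H : HopfAlgebroid A Γ} {K : HopfAlgebroid B S} (f : Hom H K)

theorem Hom.beta_comp_iota : f.beta.comp (H.iota B) = f :=
  Hom.ext (RingHom.ext fun γ => f.betaHom_mid γ)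

/-- Both coactions on `M ⊗_A B` are built from that of `M`, with coefficients `η_R(b) f_m(γ)` for
`f` and `1 ⊗ γ ⊗ b` for `ι`. Since `β` sends the second to the first, `D` sees the first as `D ∘ β`
sees the second. -/
theorem Hom.actHom_pullbackObj (D : K.Dual) (M : H.Comodule) (x : B ⊗[A] M.carrier) :
    (f.pullbackObj M).actHom D x =
      ((H.iota B).pullbackObj M).actHom (Dual.map f.beta D) x := by
  have h : ∀ (b : B) (y : Γ ⊗[A] M.carrier),
      D.evalTensor (B ⊗[A] M.carrier) (K.etaR b • pushTensor f.mor f.mor_etaL M.carrier y) =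
        (Dual.map f.beta D).evalTensor (B ⊗[A] M.carrier) ((H.baseChange B).etaR b •
          pushTensor (H.iota B).mor (H.iota B).mor_etaL M.carrier y) := by
    intro b y
    induction y using TensorProduct.induction_on with
    | zero => simp only [map_zero, smul_zero]
    | tmul γ m =>
      rw [pushTensor_tmul, pushTensor_tmul, TensorProduct.smul_tmul', TensorProduct.smul_tmul',
        Dual.evalTensor_tmul, Dual.evalTensor_tmul]
      congr 1
      change D (K.etaR b * f.mor γ) = D (f.betaHom (BaseChange.right H B b * BaseChange.mid H B γ))
      rw [RingHom.map_mul, f.betaHom_right, f.betaHom_mid]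
    | add x y hx hy => simp only [map_add, smul_add, hx, hy]
  change D.evalTensor (B ⊗[A] M.carrier) (f.pullCoact M x) =
    (Dual.map f.beta D).evalTensor (B ⊗[A] M.carrier) ((H.iota B).pullCoact M x)
  induction x using TensorProduct.induction_on with
  | zero => simp only [map_zero]
  | tmul b m => exact h b (M.coact m)
  | add x y hx hy => simp only [map_add, hx, hy]

/-- Pullback along `f` is restriction of scalars along the dual of `β`. -/
def Hom.pullbackIso : f.pullback ⋙ K.toDiscrete ≅
    (H.iota B).pullback ⋙ (H.baseChange B).toDiscrete ⋙
      DiscreteModule.restrict (Dual.map f.beta) (Dual.continuous_map f.beta) :=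
  NatIso.ofComponents (fun M =>
    { hom := ⟨AddMonoidHom.id (B ⊗[A] M.carrier), fun D x => f.actHom_pullbackObj D M x⟩
      inv := ⟨AddMonoidHom.id (B ⊗[A] M.carrier), fun D x => (f.actHom_pullbackObj D M x).symm⟩
      hom_inv_id := rfl
      inv_hom_id := rfl }) (fun _ => rfl)

end Restriction

end HopfAlgebroid

end DualAlg

end

/-! ### The theorem. -/

theorem mainTheorem3 {A Γ B S : Type u} [CommRing A] [CommRing Γ] [Algebra A Γ]
    [CommRing B] [CommRing S] [Algebra B S] [Algebra A B]
    (H : HopfAlgebroid A Γ) (K : HopfAlgebroid B S) (hH : H.IsFree) (hK : K.IsFree)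
    (f : HopfAlgebroid.Hom H K)
    (hflat : (H.alpha B).FaithfullyFlat)
    (hfree : Module.Free A (H.RightExt B)) :
    -- `Γ_f` is a free `B`-module through the left unit, with a countable basis if `α` makes
    -- `Γ ⊗_{η_R, A, f} B` a free module with a countable basis
    Module.Free B (H.BaseChange B) ∧
    ((∃ I : Type, Countable I ∧ Nonempty (Module.Basis I A (H.RightExt B))) →
      (H.baseChange B).IsFree) ∧
    -- `f` is the composite of `(f_o, ι) : (A, Γ) → (B, Γ_f)` and `(id, β) : (B, Γ_f) → (B, S)`
    f.beta.comp (H.iota B) = f ∧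
    -- the equivalences of categories
    (H.iota B).pullback.IsEquivalence ∧
    (H.baseChange B).toDiscrete.IsEquivalence ∧
    K.toDiscrete.IsEquivalence ∧
    -- under these equivalences `f^*` is restriction of scalars along `β^∨`; both functors send a
    -- comodule `M` to a module with underlying group `M ⊗_A B`, and the isomorphism is the identity
    ∃ e : f.pullback ⋙ K.toDiscrete ≅
        (H.iota B).pullback ⋙ (H.baseChange B).toDiscrete ⋙
          DiscreteModule.restrict (HopfAlgebroid.Dual.map f.beta)
            (HopfAlgebroid.Dual.continuous_map f.beta),
      ∀ (M : H.Comodule) (x : B ⊗[A] M.carrier), (e.hom.app M).hom x = x := by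
  obtain ⟨I, -, ⟨bH⟩⟩ := hH
  obtain ⟨J, -, ⟨bK⟩⟩ := hK
  have hΓ : Module.Free A Γ := Module.Free.of_basis bH
  have hS : Module.Free B S := Module.Free.of_basis bK
  -- The `A`-algebra structure of `Γ ⊗ B` is by definition the one given by `α`.
  have hP : Module.FaithfullyFlat A (H.RightExt B) := hflat
  have hΓf : Module.Free B (H.BaseChange B) :=
    Module.Free.of_equiv (HopfAlgebroid.BaseChange.equivTensor H B)
  refine ⟨hΓf, ?_, f.beta_comp_iota, H.iota_pullback_isEquivalence B,
    HopfAlgebroid.toDiscrete_isEquivalence, HopfAlgebroid.toDiscrete_isEquivalence,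
    f.pullbackIso, fun _ _ => rfl⟩
  rintro ⟨I', hI', ⟨b⟩⟩
  -- Base change along `f_o` keeps the index set of a basis, hence its countability.
  exact ⟨I', hI', ⟨(b.baseChange B).map (HopfAlgebroid.BaseChange.equivTensor H B)⟩⟩
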